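/- **Theorem (Jump formula).** Let $V$ be a real vector space of finite dimension $r\ge 1$ with an orientation $o$, and let $\Delta\subset V\setminus\{0\}$ be a finite set which spans $V$ and satisfies $-\Delta=\Delta$. *Notation.* A *wall* is a hyperplane of $V$ generated by $r-1$ linearly independent elements of $\Delta$; $V_{reg}$ is the complement of the union of the walls, and $V^*_{reg}$ is the complement in $V^*$ of the hyperplanes $\alpha=0$, $\alpha\in\Delta$. A *chamber* of $V^*$ is a connected component of $V^*_{reg}$; for a chamber $\delta$, $\delta^\vee=\{h\in V:\langle y,h\rangle\ge 0\ \forall y\in\delta\}$. Let $S(V)$, $S(V^*)$ be the rings of polynomial functions on $V^*$, $V$; let $\hat S(V)$ be the ring of formal power series, $R_\Delta=\Delta^{-1}S(V)$ and $\hat R_\Delta=\Delta^{-1}\hat S(V)$. Let $G_\Delta\subset R_\Delta$ be the span of the functions $1/\prod_{\alpha\in\kappa}\alpha^{n_\alpha}$ with $\kappa\subset\Delta$ generating $V$ and all $n_\alpha\ge 1$, and $NG_\Delta$ the span of the functions $\psi/\prod_{\alpha\in\kappa}\alpha^{n_\alpha}$ with $\psi\in S(V)$, $\kappa\subset\Delta$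 not generating $V$ and $n_\alpha\ge 0$; one has $R_\Delta=G_\Delta\oplus NG_\Delta$. The map $Princ_\Delta:\hat R_\Delta\to G_\Delta$ is the truncation to degrees $\le -r$ followed by the projection to $G_\Delta$ along $NG_\Delta$. Let $\mathcal P_\Delta$ be the space of functions on $V_{reg}$ which are polynomial on each connected component, and $\mathcal P_\Delta(\delta)$ the span of the functions $f\,[C(\sigma)]$ with $f\in S(V^*)$ and $\sigma\subset\Delta$ a basis of $V$ whose closed convex cone $C(\sigma)$ lies in $\delta^\vee$. For $\phi\in\hat R_\Delta$ and $\omega\in\wedge^rV$, the *inverse Laplace transform* $F^o_\delta(\phi\otimes\omega)$ is the unique $f\in\mathcal P_\Delta(\delta)$ such that $$\int_{V,o}e^{-\langle y,h\rangle}f(h)\,dh=Princ_\Delta(\phi)(y)\,\langle\omega,dh\rangle\qquad(y\in\delta,\ dh\in\wedge^rV^*).$$ Let $V_0$ be a wall with an orientation $o_0$, and let $\Delta_0=\Delta\cap V_0$. For an equation $z_0\in V^*$ of $V_0$ and $\omega\in\wedge^rV$, let $\omega_0\in\wedge^{r-1}V_0$ be the contraction ${\rm int}(z_0)\omega$. The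 residue $Res_{V/V_0}:\hat R_\Delta\otimes\wedge^rV\to\hat R_{\Delta_0}\otimes\wedge^{r-1}V_0$ is defined degree by degree by $$Res_{V/V_0}(\phi\otimes\omega)(y)=-Res_{t=\infty}\big(\phi(y+tz_0)\,dt\big)\otimes\omega_0 ,\qquad y\in V^*,$$ the right-hand side depending only on the image of $y$ in $V_0^*$. Choose an equation $z$ of $V_0$ such that $o=z\wedge o_0$, and let $V_\pm=\{h\in V:\pm\langle z,h\rangle>0\}$. Let $f\in\mathcal P_\Delta$. Let $U$ be a connected component of $(V_0)_{reg}$, and let $U_\pm$ be connected components of $V_{reg}$ contained in $V_\pm$ such that $\overline{U_+}\cap\overline{U_-}$ contains a point of $U$ which lies on no wall other than $V_0$; such pairs $U_\pm$ exist for every $U$. Let $f^\pm$ be the polynomial which equals $f$ on $U_\pm$. A function $g\in\mathcal P_{\Delta_0}$ is the *jump* $Jump_{o/o_0}(f)$ if $g|_U=f^+|_U-f^-|_U$ for all such $U$, $U_+$, $U_-$. *Statement.* Let $\delta$ be a chamber of $V^*$ and $\delta_0$ a chamber of $V_0^*$ (with respect to $\Delta_0$) such that $\delta_0^\vee\subset\delta^\vee$.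 Then for every $\phi\in\hat R_\Delta$ and every $\omega\in\wedge^rV$, the residue $Res_{V/V_0}(\phi\otimes\omega)$ and both inverse Laplace transforms below are well defined, the jump of $F^o_\delta(\phi\otimes\omega)$ exists, and $$Jump_{o/o_0}\big(F^o_\delta(\phi\otimes\omega)\big)=F^{o_0}_{\delta_0}\big(Res_{V/V_0}(\phi\otimes\omega)\big).$$ -/

import Mathlib

open MeasureTheory Filter Topology

namespace HyperplaneLaplace

noncomputable section

/-! ### Polynomials and rational functions on the dual space -/

/-- The symmetric algebra `S(V)`, identified with the ring of polynomial functions on `V*`. -/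
def symDual (V : Type*) [NormedAddCommGroup V] [NormedSpace ℝ V] :
    Subalgebra ℝ (StrongDual ℝ V → ℝ) :=
  Algebra.adjoin ℝ (Set.range fun (v : V) (y : StrongDual ℝ V) => y v)

/-- The symmetric algebra `S(V*)`, identified with the ring of polynomial functions on `V`. -/
def sym (V : Type*) [NormedAddCommGroup V] [NormedSpace ℝ V] : Subalgebra ℝ (V → ℝ) :=
  Algebra.adjoin ℝ (Set.range fun (y : StrongDual ℝ V) (v : V) => y v)

/-- The set `V*_reg` of regular elements of `V*`: the complement of the hyperplanes `α = 0`. -/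
def dualReg {V : Type*} [NormedAddCommGroup V] [NormedSpace ℝ V] (Δ : Set V) :
    Set (StrongDual ℝ V) :=
  {y | ∀ α ∈ Δ, y α ≠ 0}

/-- The space `G_Δ`, as a space of functions on `V*_reg`: the span of the functions
`1 / ∏_{α ∈ κ} α ^ n_α` with `κ ⊆ Δ` generating and all `n_α` positive. -/
def G {V : Type*} [NormedAddCommGroup V] [NormedSpace ℝ V] (Δ : Set V) :
    Submodule ℝ (dualReg Δ → ℝ) :=
  Submodule.span ℝ {φ | ∃ (κ : Finset V) (m : V → ℕ), (κ : Set V) ⊆ Δ ∧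
    Submodule.span ℝ (κ : Set V) = ⊤ ∧ (∀ α ∈ κ, 0 < m α) ∧
    φ = fun y => 1 / ∏ α ∈ κ, y.1 α ^ m α}

/-- The space `NG_Δ`, as a space of functions on `V*_reg`: the span of the functions
`ψ / ∏_{α ∈ κ} α ^ n_α` with `ψ ∈ S(V)`, `κ ⊆ Δ` not generating and `n_α` nonnegative. -/
def NG {V : Type*} [NormedAddCommGroup V] [NormedSpace ℝ V] (Δ : Set V) :
    Submodule ℝ (dualReg Δ → ℝ) :=
  Submodule.span ℝ {φ | ∃ (ψ : StrongDual ℝ V → ℝ) (κ : Finset V) (m : V → ℕ),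
    ψ ∈ symDual V ∧ (κ : Set V) ⊆ Δ ∧ Submodule.span ℝ (κ : Set V) ≠ ⊤ ∧
    φ = fun y => ψ y.1 / ∏ α ∈ κ, y.1 α ^ m α}

/-! ### The ring `R̂_Δ` and the principal part -/

/-- A formal power series `∑_d ψ_d`, i.e. an element of the completion `Ŝ(V) = ∏_d S^d(V)`:
the term `ψ_d` is a polynomial function on `V*`, homogeneous of degree `d`. -/
def IsFormalPowerSeries {V : Type*} [NormedAddCommGroup V] [NormedSpace ℝ V]
    (ψ : ℕ → StrongDual ℝ V → ℝ) : Prop :=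
  ∀ d, ψ d ∈ symDual V ∧ ∀ (t : ℝ) (y : StrongDual ℝ V), ψ d (t • y) = t ^ d * ψ d y

/-- `R̂_Δ = Δ⁻¹ Ŝ(V)`. An element is recorded by its homogeneous components `φ_j` (`j ∈ ℤ`), which
are functions on `V*_reg`. The family `φ` is in `R̂_Δ` iff it is the family of homogeneous
components of a fraction `(∑_d ψ_d) / D`, with `∑_d ψ_d` a formal power series and
`D = ∏_{α ∈ κ} α ^ m_α` a product of elements of `Δ`; so `φ_j = ψ_{j + deg D} / D`. -/
def RHat {V : Type*} [NormedAddCommGroup V] [NormedSpace ℝ V] (Δ : Set V) :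
    Set (ℤ → dualReg Δ → ℝ) :=
  {φ | ∃ (ψ : ℕ → StrongDual ℝ V → ℝ) (κ : Finset V) (m : V → ℕ),
    IsFormalPowerSeries ψ ∧ (κ : Set V) ⊆ Δ ∧
    ∀ (j : ℤ) (y : dualReg Δ), φ j y =
      if 0 ≤ j + ∑ α ∈ κ, (m α : ℤ) then
        ψ (j + ∑ α ∈ κ, (m α : ℤ)).toNat y.1 / ∏ α ∈ κ, y.1 α ^ m α
      else 0}

/-- The Taylor expansion `Taylor_{[≤ K]}`: the sum of the components of degree at most `K`
(for an element of `R̂_Δ`, only finitely many of these are nonzero). -/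
def taylor {V : Type*} [NormedAddCommGroup V] [NormedSpace ℝ V] {Δ : Set V} (K : ℤ)
    (φ : ℤ → dualReg Δ → ℝ) : dualReg Δ → ℝ :=
  ∑ᶠ j ∈ Set.Iic K, φ j

/-- `g = Princ_Δ(φ)`: the projection to `G_Δ`, along `NG_Δ`, of `Taylor_{[≤ -r]} φ`, where
`r = dim V`. -/
def IsPrinc {V : Type*} [NormedAddCommGroup V] [NormedSpace ℝ V] {Δ : Set V}
    (φ : ℤ → dualReg Δ → ℝ) (g : dualReg Δ → ℝ) : Prop :=
  g ∈ G Δ ∧ taylor (-(Module.finrank ℝ V : ℤ)) φ - g ∈ NG Δ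

/-! ### Walls, chambers, locally polynomial functions -/

/-- A wall: a hyperplane generated by `r - 1` linearly independent elements of `Δ`. -/
def IsWall {V : Type*} [NormedAddCommGroup V] [NormedSpace ℝ V] (Δ : Set V)
    (W : Submodule ℝ V) : Prop :=
  ∃ κ : Finset V, (κ : Set V) ⊆ Δ ∧ LinearIndepOn ℝ id (κ : Set V) ∧
    κ.card + 1 = Module.finrank ℝ V ∧ Submodule.span ℝ (κ : Set V) = W

/-- The set `V_reg` of regular elements of `V`: the complement of the union of the walls. -/
def reg {V : Type*} [NormedAddCommGroup V] [NormedSpace ℝ V] (Δ : Set V) : Set V :=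
  {h | ∀ W, IsWall Δ W → h ∉ W}

/-- `U` is a connected component of `S`. -/
def IsComponent {X : Type*} [TopologicalSpace X] (S U : Set X) : Prop :=
  ∃ x ∈ S, U = connectedComponentIn S x

/-- `𝒫_Δ`: functions on `V_reg` given by a polynomial on each connected component. -/
def locPoly {V : Type*} [NormedAddCommGroup V] [NormedSpace ℝ V] (Δ : Set V) :
    Set (reg Δ → ℝ) :=
  {f | ∀ U, IsComponent (reg Δ) U → ∃ p ∈ sym V, ∀ h : reg Δ, h.1 ∈ U → f h = p h.1}

/-- The dual cone `δ^∨ ⊆ V` of a subset `δ` of `V*`. -/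
def dualCone {V : Type*} [NormedAddCommGroup V] [NormedSpace ℝ V] (δ : Set (StrongDual ℝ V)) :
    Set V :=
  {h | ∀ y ∈ δ, 0 ≤ y h}

/-- The closed convex cone `C(σ)` generated by `σ`. -/
def cone {V : Type*} [NormedAddCommGroup V] [NormedSpace ℝ V] (σ : Finset V) : Set V :=
  {h | ∃ c : V → ℝ, (∀ α ∈ σ, 0 ≤ c α) ∧ h = ∑ α ∈ σ, c α • α}

/-- `𝒫_Δ(δ)`: the span of the functions `f [C(σ)]` on `V_reg`, with `f ∈ S(V*)` and `σ` a basis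
of `Δ` such that `C(σ) ⊆ δ^∨`. -/
def locPolyCone {V : Type*} [NormedAddCommGroup V] [NormedSpace ℝ V] (Δ : Set V)
    (δ : Set (StrongDual ℝ V)) : Submodule ℝ (reg Δ → ℝ) :=
  Submodule.span ℝ {F | ∃ (f : V → ℝ) (σ : Finset V), f ∈ sym V ∧ (σ : Set V) ⊆ Δ ∧
    LinearIndepOn ℝ id (σ : Set V) ∧ Submodule.span ℝ (σ : Set V) = ⊤ ∧
    cone σ ⊆ dualCone δ ∧ F = fun h => (cone σ).indicator f h.1}

/-! ### Laplace transform and its inverse -/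

/-- The top degree form `dh` is positive for the orientation `o`. -/
def IsPositive {V : Type*} [NormedAddCommGroup V] [NormedSpace ℝ V] {r : ℕ}
    (o : Orientation ℝ V (Fin r)) (dh : V [⋀^Fin r]→ₗ[ℝ] ℝ) : Prop :=
  ∃ h0 : dh ≠ 0, rayOfNeZero ℝ dh h0 = o

open Classical in
/-- The integral `∫_{V,o} F dh` of a top degree form over the oriented space `(V, o)`. Here
`dh.measure` is the positive measure which gives mass `|dh(v₁, …, v_r)|` to the parallelepiped
spanned by `v₁, …, v_r`. -/
def orientedIntegral {V : Type*} [NormedAddCommGroup V] [NormedSpace ℝ V]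
    [FiniteDimensional ℝ V] [MeasurableSpace V] [BorelSpace V] {r : ℕ}
    [Fact (Module.finrank ℝ V = r)] (o : Orientation ℝ V (Fin r))
    (F : V → ℝ) (dh : V [⋀^Fin r]→ₗ[ℝ] ℝ) : ℝ :=
  if IsPositive o dh then ∫ h, F h ∂dh.measure else -∫ h, F h ∂dh.measure

/-- `L^o_δ(f) = g ⊗ ω`, where `ω ∈ ⋀^r V`: for every `dh ∈ ⋀^r V*` and every `y ∈ δ`,
`∫_{V,o} e^{-⟨y,h⟩} f(h) dh` converges and equals `g(y) ⟨ω, dh⟩`. -/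
def HasLaplaceTransform {V : Type*} [NormedAddCommGroup V] [NormedSpace ℝ V]
    [FiniteDimensional ℝ V] [MeasurableSpace V] [BorelSpace V] {r : ℕ}
    [Fact (Module.finrank ℝ V = r)] {Δ : Set V} (o : Orientation ℝ V (Fin r))
    (δ : Set (StrongDual ℝ V)) (f : reg Δ → ℝ) (g : dualReg Δ → ℝ) (ω : ⋀[ℝ]^r V) : Prop :=
  ∀ (dh : V [⋀^Fin r]→ₗ[ℝ] ℝ) (y : dualReg Δ), y.1 ∈ δ →
    Integrable (fun h => Real.exp (-y.1 h) * Function.extend Subtype.val f 0 h) dh.measure ∧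
    orientedIntegral o (fun h => Real.exp (-y.1 h) * Function.extend Subtype.val f 0 h) dh =
      g y * exteriorPower.alternatingMapLinearEquiv dh ω

/-- `f = F^o_δ(φ ⊗ ω) = (L^o_δ)⁻¹(Princ_Δ(φ) ⊗ ω)`. -/
def IsInverseLaplace {V : Type*} [NormedAddCommGroup V] [NormedSpace ℝ V]
    [FiniteDimensional ℝ V] [MeasurableSpace V] [BorelSpace V] {r : ℕ}
    [Fact (Module.finrank ℝ V = r)] {Δ : Set V} (o : Orientation ℝ V (Fin r))
    (δ : Set (StrongDual ℝ V)) (φ : ℤ → dualReg Δ → ℝ) (ω : ⋀[ℝ]^r V)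
    (f : reg Δ → ℝ) : Prop :=
  f ∈ locPolyCone Δ δ ∧ ∃ g, IsPrinc φ g ∧ HasLaplaceTransform o δ f g ω

/-- The inverse Laplace transform `F^o_δ(φ ⊗ ω)`. -/
def inverseLaplace {V : Type*} [NormedAddCommGroup V] [NormedSpace ℝ V]
    [FiniteDimensional ℝ V] [MeasurableSpace V] [BorelSpace V] {r : ℕ}
    [Fact (Module.finrank ℝ V = r)] {Δ : Set V} (o : Orientation ℝ V (Fin r))
    (δ : Set (StrongDual ℝ V)) (φ : ℤ → dualReg Δ → ℝ) (ω : ⋀[ℝ]^r V) : reg Δ → ℝ :=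
  Classical.epsilon (IsInverseLaplace o δ φ ω)

/-! ### Residue along a hyperplane -/

/-- The system `Δ₀ = Δ ∩ V₀` of the subspace `V₀`. -/
def restrictSystem {V : Type*} [NormedAddCommGroup V] [NormedSpace ℝ V] (Δ : Set V)
    (V₀ : Submodule ℝ V) : Set V₀ :=
  {α | (α : V) ∈ Δ}

/-- `ρ = Res_{t=∞} (f(t) dt)` for a rational function `f`: minus the coefficient of `1/t` in the
expansion of `f` at infinity, `f(t) = p(t) - ρ/t + o(1/t)` with `p` a polynomial. -/
def HasResidueAtInfinity (f : ℝ → ℝ) (ρ : ℝ) : Prop :=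
  ∃ p : Polynomial ℝ,
    Tendsto (fun t => t * (f t - p.eval t)) (Bornology.cobounded ℝ) (𝓝 (-ρ))

/-- `ψ(z) = -Res_{t=∞} (φ(z + t z₀) dt)` for `z ∈ V*`, as a function of the image of `z` in
`V₀*`, at `Δ₀`-regular points. For such `z`, the point `z + t z₀` is `Δ`-regular for all but
finitely many `t`. -/
def IsHyperplaneResidue {V : Type*} [NormedAddCommGroup V] [NormedSpace ℝ V] {Δ : Set V}
    (V₀ : Submodule ℝ V) (z₀ : StrongDual ℝ V) (φ : dualReg Δ → ℝ)
    (ψ : dualReg (restrictSystem Δ V₀) → ℝ) : Prop :=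
  ∀ (z : StrongDual ℝ V) (hz : z.comp V₀.subtypeL ∈ dualReg (restrictSystem Δ V₀)),
    HasResidueAtInfinity (fun t => Function.extend Subtype.val φ 0 (z + t • z₀))
      (-ψ ⟨z.comp V₀.subtypeL, hz⟩)

/-- The scalar part of `Res_{V/V₀}` on `R̂_Δ`, for the equation `z₀` of `V₀`: the residue of the
component of degree `j - 1` is the component of degree `j` of the residue. -/
def hyperplaneResidue {V : Type*} [NormedAddCommGroup V] [NormedSpace ℝ V] {Δ : Set V}
    (V₀ : Submodule ℝ V) (z₀ : StrongDual ℝ V) (φ : ℤ → dualReg Δ → ℝ) :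
    ℤ → dualReg (restrictSystem Δ V₀) → ℝ :=
  fun j => Classical.epsilon (IsHyperplaneResidue V₀ z₀ (φ (j - 1)))

/-- `ω₀ = int(z₀) ω`, where `ω ∈ ⋀^{n+1} V` and `ω₀ ∈ ⋀^n V₀`. -/
def IsContraction {V : Type*} [NormedAddCommGroup V] [NormedSpace ℝ V] {n : ℕ}
    {V₀ : Submodule ℝ V} (z₀ : StrongDual ℝ V) (ω : ⋀[ℝ]^(n + 1) V) (ω₀ : ⋀[ℝ]^n V₀) : Prop :=
  ExteriorAlgebra.map V₀.subtype (ω₀ : ExteriorAlgebra ℝ V₀) =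
    CliffordAlgebra.contractLeft (Q := (0 : QuadraticForm ℝ V)) (z₀ : Module.Dual ℝ V)
      (ω : ExteriorAlgebra ℝ V)

/-! ### The jump across a wall -/

/-- `z` is an equation of `V₀` such that `o = z ∧ o₀`: for some positive forms `μ` on `V` and `μ₀`
on `V₀`, one has `μ = z ∧ μ₀`, i.e. `μ(v, w₁, …, w_n) = z(v) μ₀(w₁, …, w_n)` for `v ∈ V` and
`w₁, …, w_n ∈ V₀`. -/
def IsOrientedEquation {V : Type*} [NormedAddCommGroup V] [NormedSpace ℝ V] {n : ℕ}
    {V₀ : Submodule ℝ V} (o : Orientation ℝ V (Fin (n + 1))) (o₀ : Orientation ℝ V₀ (Fin n))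
    (z : StrongDual ℝ V) : Prop :=
  LinearMap.ker (z : V →ₗ[ℝ] ℝ) = V₀ ∧
    ∃ (μ : V [⋀^Fin (n + 1)]→ₗ[ℝ] ℝ) (μ₀ : V₀ [⋀^Fin n]→ₗ[ℝ] ℝ),
      IsPositive o μ ∧ IsPositive o₀ μ₀ ∧
      ∀ (v : V) (w : Fin n → V₀),
        μ (Fin.cons v fun i => (w i : V) : Fin (n + 1) → V) = z v * μ₀ w

/-- `U₊` and `U₋` are chambers of `V` on the positive and on the negative side of `V₀ = {z = 0}`
which are adjacent to the subset `U` of `V₀`: their closures share a point of `U` which lies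
on no other wall. -/
def IsAdjacent {V : Type*} [NormedAddCommGroup V] [NormedSpace ℝ V] (Δ : Set V)
    (V₀ : Submodule ℝ V) (z : StrongDual ℝ V) (U : Set V₀) (Up Um : Set V) : Prop :=
  IsComponent (reg Δ) Up ∧ IsComponent (reg Δ) Um ∧
    Up ⊆ {h | 0 < z h} ∧ Um ⊆ {h | z h < 0} ∧
    ∃ h ∈ U, (∀ W, IsWall Δ W → W ≠ V₀ → (h : V) ∉ W) ∧
      (h : V) ∈ closure Up ∧ (h : V) ∈ closure Um

/-- `g = Jump_{o/o₀}(f)`, where `z` is an equation of `V₀` with `o = z ∧ o₀`. On each component `U`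
of the regular set of `V₀`, the function `g` is the restriction of `f⁺ - f⁻`, where `f⁺` and `f⁻`
are the polynomials which give `f` on chambers of `V` adjacent to `U` on both sides of `V₀`.
If `U` has several adjacent pairs of chambers, then they all have to give `g` on the whole
of `U`. -/
def IsJump {V : Type*} [NormedAddCommGroup V] [NormedSpace ℝ V] {Δ : Set V}
    {V₀ : Submodule ℝ V} (z : StrongDual ℝ V) (f : reg Δ → ℝ)
    (g : reg (restrictSystem Δ V₀) → ℝ) : Prop :=
  f ∈ locPoly Δ ∧ g ∈ locPoly (restrictSystem Δ V₀) ∧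
    ∀ U, IsComponent (reg (restrictSystem Δ V₀)) U →
      (∃ Up Um, IsAdjacent Δ V₀ z U Up Um) ∧
      ∀ Up Um, IsAdjacent Δ V₀ z U Up Um →
        ∀ fp ∈ sym V, ∀ fm ∈ sym V,
          (∀ h : reg Δ, h.1 ∈ Up → f h = fp h.1) →
          (∀ h : reg Δ, h.1 ∈ Um → f h = fm h.1) →
          ∀ h : reg (restrictSystem Δ V₀), h.1 ∈ U → g h = fp (h.1 : V) - fm (h.1 : V)

end

end HyperplaneLaplace

open HyperplaneLaplace

namespace HyperplaneLaplace

noncomputable section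

/-! ### Finite families of proper subspaces -/

section Subspaces

variable {E : Type*} [NormedAddCommGroup E] [NormedSpace ℝ E] [FiniteDimensional ℝ E]

/-! All the operations involved are linear, and modulo `NG` everything reduces to the fractions 1/∏
b_i^(m_i+1) with b a basis contained in Δ. Since Δ = -Δ and each element of Δ has constant sign on
δ, the b_i may be taken positive on δ. For these fractions every object is explicit.

Inverse Laplace transform: a product of Gamma integrals shows that it is the function ∏ x_i^m_i/m_i!
on the cone of b, divided by the volume of b (`laplace_coneFun`).

Residue: if two of the b_i lie off V₀, the fraction is O(t⁻²) along z₀ and the residue is 0. If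
exactly one, b_i₀, lies off V₀, there is a 1/t term only when m_i₀ = 0, and the residue is then
1/z₀(b_i₀) times the fraction of the remaining vectors, which form a basis of V₀
(`isHyperplaneResidue_simple`, `isHyperplaneResidue_simple_zero`).

Jump: the function on the cone is a product of functions of single coordinates, and x^m/m! on the
half-line jumps at 0 only when m = 0. It can therefore jump across V₀ only if V₀ is the hyperplane
of a facet, that is, if exactly one b_i₀ lies off V₀, and only when m_i₀ = 0
(`hasPointwiseJump_coneFun`, `hasPointwiseJump_coneFun_zero`). The two dichotomies agree, and the
constants match because vol(b) = |z(b_i₀)| vol₀(b₀) (`exists_jump_of_mem_simpleG`).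

To pass from these fractions to φ, the residue must commute with principal parts. It raises degrees
by one, so truncation at -r becomes truncation at -(r-1), and it sends `NG` for Δ into `NG` for Δ₀
(`exists_isHyperplaneResidue_mem_NG`).

Well-definedness rests on injectivity of the Laplace transform, obtained from uniqueness of
characteristic functions by analytic continuation (`ae_eq_zero_of_laplace_eq_zero`). It also gives G
∩ NG = 0: an element of G is a Laplace transform, while an element of NG is killed by finitely many
finite differences in y. Each difference multiplies the original function by some exp(-s⟨a,h⟩) - 1,
which is nonzero almost everywhere (`ae_eq_zero_of_laplace_isAnnihilated`). -/

theorem isOpen_avoid {S : Set (Submodule ℝ E)} (hS : S.Finite) :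
    IsOpen {x : E | ∀ W ∈ S, x ∉ W} := by
  have : {x : E | ∀ W ∈ S, x ∉ W} = ⋂ W ∈ S, (W : Set E)ᶜ := by ext; simp
  rw [this]
  exact hS.isOpen_biInter fun W _ => W.closed_of_finiteDimensional.isOpen_compl

theorem dense_avoid {S : Set (Submodule ℝ E)} (hS : S.Finite) (hT : ∀ W ∈ S, W ≠ ⊤) :
    Dense {x : E | ∀ W ∈ S, x ∉ W} := by
  have : {x : E | ∀ W ∈ S, x ∉ W} = ⋂ W ∈ S, (W : Set E)ᶜ := by ext; simp
  rw [this]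
  have : CompleteSpace E := FiniteDimensional.complete ℝ E
  refine dense_biInter_of_isOpen (fun W _ => W.closed_of_finiteDimensional.isOpen_compl)
    hS.countable fun W hW => ?_
  rw [← interior_eq_empty_iff_dense_compl]
  by_contra h
  exact hT W hW (W.eq_top_of_nonempty_interior' (Set.nonempty_iff_ne_empty.2 h))

theorem measure_compl_avoid [MeasurableSpace E] [BorelSpace E] (μ : Measure E)
    [μ.IsAddHaarMeasure] {S : Set (Submodule ℝ E)} (hS : S.Finite) (hT : ∀ W ∈ S, W ≠ ⊤) :
    μ {x : E | ∀ W ∈ S, x ∉ W}ᶜ = 0 := by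
  have : {x : E | ∀ W ∈ S, x ∉ W}ᶜ = ⋃ W ∈ S, (W : Set E) := by ext; simp
  rw [this, measure_biUnion_null_iff hS.countable]
  exact fun W hW => Measure.addHaar_submodule μ W (hT W hW)

end Subspaces

variable {V : Type*} [NormedAddCommGroup V] [NormedSpace ℝ V]

/-! ### Walls and regular sets -/

theorem finite_isWall {Δ : Set V} (hfin : Δ.Finite) : {W | IsWall Δ W}.Finite := by
  have h : {κ : Finset V | (κ : Set V) ⊆ Δ}.Finite := by
    refine (hfin.finite_subsets.preimage (f := fun κ : Finset V => (κ : Set V))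
      (Finset.coe_injective.injOn)).subset ?_
    intro κ hκ; exact hκ
  refine (h.image fun κ : Finset V => Submodule.span ℝ (κ : Set V)).subset ?_
  rintro W ⟨κ, h1, -, -, h2⟩
  exact ⟨κ, h1, h2⟩

theorem IsWall.ne_top {Δ : Set V} {W : Submodule ℝ V} (hW : IsWall Δ W) : W ≠ ⊤ := by
  obtain ⟨κ, -, -, h1, h2⟩ := hW
  rintro rfl
  have := finrank_span_finset_le_card (R := ℝ) κ
  rw [Set.finrank, h2, finrank_top] at this
  omega

theorem IsWall.finrank_eq {Δ : Set V} {W : Submodule ℝ V} (hW : IsWall Δ W) :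
    Module.finrank ℝ W + 1 = Module.finrank ℝ V := by
  obtain ⟨κ, -, h0, h1, rfl⟩ := hW
  have h := finrank_span_set_eq_card (R := ℝ) (s := (κ : Set V)) h0
  rw [h, Finset.toFinset_coe, h1]

theorem dualReg_eq (Δ : Set V) : dualReg Δ = {y : StrongDual ℝ V | ∀ W ∈
    (fun α : V => (LinearMap.ker (ContinuousLinearMap.apply ℝ ℝ α).toLinearMap :
      Submodule ℝ (StrongDual ℝ V))) '' Δ, y ∉ W} := by
  ext y; simp [dualReg]

section FiniteDim

variable [FiniteDimensional ℝ V]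

theorem IsWall.eq_of_le {Δ : Set V} {W W' : Submodule ℝ V} (hW : IsWall Δ W) (hW' : IsWall Δ W')
    (h : W ≤ W') : W = W' :=
  Submodule.eq_of_le_of_finrank_eq h (by have := hW.finrank_eq; have := hW'.finrank_eq; omega)

theorem isOpen_reg {Δ : Set V} (hfin : Δ.Finite) : IsOpen (reg Δ) :=
  isOpen_avoid (finite_isWall hfin)

theorem measure_compl_reg [MeasurableSpace V] [BorelSpace V] (μ : Measure V)
    [μ.IsAddHaarMeasure] {Δ : Set V} (hfin : Δ.Finite) : μ (reg Δ)ᶜ = 0 :=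
  measure_compl_avoid μ (finite_isWall hfin) fun _ hW => IsWall.ne_top hW

theorem isOpen_dualReg {Δ : Set V} (hfin : Δ.Finite) : IsOpen (dualReg Δ) := by
  rw [dualReg_eq]; exact isOpen_avoid (hfin.image _)

theorem dense_dualReg {Δ : Set V} (hfin : Δ.Finite) (hzero : (0 : V) ∉ Δ) :
    Dense (dualReg Δ) := by
  rw [dualReg_eq]
  refine dense_avoid (hfin.image _) ?_
  rintro _ ⟨α, hα, rfl⟩ h
  have hne : α ≠ 0 := fun h => hzero (h ▸ hα)
  obtain ⟨y, hy⟩ := SeparatingDual.exists_ne_zero (R := ℝ) hne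
  have : y ∈ (⊤ : Submodule ℝ (StrongDual ℝ V)) := trivial
  rw [← h] at this
  exact hy (by simpa using this)

end FiniteDim

/-! ### Components -/

theorem IsComponent.subset {X : Type*} [TopologicalSpace X] {S U : Set X}
    (h : IsComponent S U) : U ⊆ S := by
  obtain ⟨x, -, rfl⟩ := h; exact connectedComponentIn_subset S x

theorem IsComponent.isPreconnected {X : Type*} [TopologicalSpace X] {S U : Set X}
    (h : IsComponent S U) : IsPreconnected U := by
  obtain ⟨x, -, rfl⟩ := h; exact isPreconnected_connectedComponentIn

theorem IsComponent.nonempty {X : Type*} [TopologicalSpace X] {S U : Set X}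
    (h : IsComponent S U) : U.Nonempty := by
  obtain ⟨x, hx, rfl⟩ := h; exact ⟨x, mem_connectedComponentIn hx⟩

theorem IsComponent.isOpen {X : Type*} [TopologicalSpace X] [LocallyConnectedSpace X] {S U : Set X}
    (hS : IsOpen S) (h : IsComponent S U) : IsOpen U := by
  obtain ⟨x, -, rfl⟩ := h; exact hS.connectedComponentIn

theorem IsComponent.subset_of_isPreconnected {X : Type*} [TopologicalSpace X] {S U T : Set X}
    (h : IsComponent S U) (hT : IsPreconnected T) (hTS : T ⊆ S) (hne : (T ∩ U).Nonempty) :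
    T ⊆ U := by
  obtain ⟨x, -, rfl⟩ := h
  obtain ⟨y, hyT, hyU⟩ := hne
  rw [connectedComponentIn_eq hyU]
  exact hT.subset_connectedComponentIn hyT hTS

theorem pos_or_neg_of_isPreconnected {X : Type*} [TopologicalSpace X] {U : Set X}
    (hU : IsPreconnected U) {f : X → ℝ} (hf : Continuous f) (h0 : ∀ x ∈ U, f x ≠ 0) :
    (∀ x ∈ U, 0 < f x) ∨ (∀ x ∈ U, f x < 0) := by
  refine (hU.subset_or_subset (u := {x | 0 < f x}) (v := {x | f x < 0})
    (isOpen_lt continuous_const hf) (isOpen_lt hf continuous_const) ?_ ?_)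
  · rw [Set.disjoint_left]; intro x (h1 : 0 < f x) (h2 : f x < 0); exact lt_asymm h1 h2
  · intro x hx; exact (h0 x hx).lt_or_gt.symm

/-! ### Polynomial functions -/

section Polynomials

variable {E : Type*} [NormedAddCommGroup E] [NormedSpace ℝ E]

theorem adjoin_continuous {S : Set (E → ℝ)} (hS : ∀ f ∈ S, ∃ L : StrongDual ℝ E, f = L)
    {f : E → ℝ} (hf : f ∈ Algebra.adjoin ℝ S) : Continuous f := by
  induction hf using Algebra.adjoin_induction with
  | mem f hf => obtain ⟨L, rfl⟩ := hS f hf; exact L.continuous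
  | algebraMap r => exact continuous_const
  | add f g _ _ h1 h2 => exact h1.add h2
  | mul f g _ _ h1 h2 => exact h1.mul h2

/-- The degree bound `N` does not depend on the base point `x`; this uniformity later makes a fixed
number of finite differences in the direction `v` suffice. The strict bound on `degree` covers the
zero polynomial. -/
theorem adjoin_eval_line {S : Set (E → ℝ)} (hS : ∀ f ∈ S, ∃ L : StrongDual ℝ E, f = L)
    {f : E → ℝ} (hf : f ∈ Algebra.adjoin ℝ S) (v : E) :
    ∃ N : ℕ, ∀ x, ∃ p : Polynomial ℝ, p.degree < N ∧ ∀ t : ℝ, f (x + t • v) = p.eval t := by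
  induction hf using Algebra.adjoin_induction with
  | mem f hf =>
    obtain ⟨L, rfl⟩ := hS f hf
    refine ⟨2, fun x => ⟨Polynomial.C (L v) * Polynomial.X + Polynomial.C (L x), ?_, fun t => ?_⟩⟩
    · exact lt_of_le_of_lt Polynomial.degree_linear_le (by norm_num)
    · simp; ring
  | algebraMap r =>
    refine ⟨1, fun x => ⟨Polynomial.C r, ?_, fun t => by simp⟩⟩
    exact lt_of_le_of_lt Polynomial.degree_C_le (by norm_num)
  | add f g _ _ h1 h2 =>
    obtain ⟨N, hN⟩ := h1
    obtain ⟨M, hM⟩ := h2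
    refine ⟨max N M, fun x => ?_⟩
    obtain ⟨p, hp, hp'⟩ := hN x
    obtain ⟨q, hq, hq'⟩ := hM x
    refine ⟨p + q, (Polynomial.degree_add_le _ _).trans_lt (max_lt ?_ ?_), fun t => by simp [hp', hq']⟩
    · exact hp.trans_le (by exact_mod_cast le_max_left _ _)
    · exact hq.trans_le (by exact_mod_cast le_max_right _ _)
  | mul f g _ _ h1 h2 =>
    obtain ⟨N, hN⟩ := h1
    obtain ⟨M, hM⟩ := h2
    refine ⟨N + M, fun x => ?_⟩
    obtain ⟨p, hp, hp'⟩ := hN x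
    obtain ⟨q, hq, hq'⟩ := hM x
    refine ⟨p * q, ?_, fun t => by simp [hp', hq']⟩
    rw [← Polynomial.mem_degreeLT] at hp hq ⊢
    by_cases hq0 : q = 0
    · simp [hq0]
    · rw [Polynomial.mem_degreeLT] at hp hq ⊢
      calc (p * q).degree = p.degree + q.degree := Polynomial.degree_mul
        _ < N + q.degree := by
            rw [Polynomial.degree_eq_natDegree hq0]
            exact WithBot.add_lt_add_right (by simp) hp
        _ ≤ ((N + M : ℕ) : WithBot ℕ) := by push_cast; gcongr

/-- Identity theorem by restriction to the line from `x₀` through `x`: a polynomial in one variable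
that vanishes near 0 is zero, so it also vanishes at parameter 1. -/
theorem adjoin_eq_zero {S : Set (E → ℝ)} (hS : ∀ f ∈ S, ∃ L : StrongDual ℝ E, f = L)
    {f : E → ℝ} (hf : f ∈ Algebra.adjoin ℝ S) {x₀ : E} (h0 : ∀ᶠ x in 𝓝 x₀, f x = 0) (x : E) :
    f x = 0 := by
  obtain ⟨N, hN⟩ := adjoin_eval_line hS hf (x - x₀)
  obtain ⟨p, -, hp⟩ := hN x₀
  have hc : Tendsto (fun t : ℝ => x₀ + t • (x - x₀)) (𝓝 0) (𝓝 x₀) := by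
    have : Continuous (fun t : ℝ => x₀ + t • (x - x₀)) := by fun_prop
    simpa using this.tendsto 0
  have hp0 : p = 0 := by
    refine p.eq_zero_of_infinite_isRoot ?_
    refine infinite_of_mem_nhds (0 : ℝ) ?_
    filter_upwards [hc.eventually h0] with t ht
    rw [hp] at ht
    exact ht
  have := hp 1
  simpa [hp0] using this

theorem sym_generators : ∀ f ∈ Set.range (fun (y : StrongDual ℝ E) (v : E) => y v),
    ∃ L : StrongDual ℝ E, f = L := by
  rintro _ ⟨y, rfl⟩; exact ⟨y, rfl⟩

theorem symDual_generators : ∀ f ∈ Set.range (fun (v : E) (y : StrongDual ℝ E) => y v),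
    ∃ L : StrongDual ℝ (StrongDual ℝ E), f = L := by
  rintro _ ⟨v, rfl⟩; exact ⟨ContinuousLinearMap.apply ℝ ℝ v, rfl⟩

theorem continuous_of_mem_sym {f : E → ℝ} (hf : f ∈ sym E) : Continuous f :=
  adjoin_continuous sym_generators hf

theorem eq_zero_of_mem_sym {f : E → ℝ} (hf : f ∈ sym E) {x₀ : E}
    (h0 : ∀ᶠ x in 𝓝 x₀, f x = 0) (x : E) : f x = 0 :=
  adjoin_eq_zero sym_generators hf h0 x

theorem continuous_of_mem_symDual {f : StrongDual ℝ E → ℝ} (hf : f ∈ symDual E) : Continuous f :=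
  adjoin_continuous symDual_generators hf

theorem apply_mem_sym (y : StrongDual ℝ E) : (fun v => y v) ∈ sym E :=
  Algebra.subset_adjoin ⟨y, rfl⟩

theorem apply_mem_symDual (v : E) : (fun y : StrongDual ℝ E => y v) ∈ symDual E :=
  Algebra.subset_adjoin ⟨v, rfl⟩

end Polynomials

/-! ### Partial fractions -/

/-- The span of the simple fractions `1 / ∏_{α ∈ σ} α ^ n_α`, with `σ ⊆ Δ` a basis and all `n_α`
positive. -/
def simpleG (Δ : Set V) (r : ℕ) : Submodule ℝ (dualReg Δ → ℝ) :=
  Submodule.span ℝ {φ | ∃ (b : Module.Basis (Fin r) ℝ V) (m : Fin r → ℕ), (∀ i, b i ∈ Δ) ∧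
    φ = fun y => (∏ i, y.1 (b i) ^ (m i + 1))⁻¹}

theorem simpleG_le_G (Δ : Set V) (r : ℕ) : simpleG Δ r ≤ G Δ := by
  classical
  refine Submodule.span_le.2 ?_
  rintro _ ⟨b, m, hb, rfl⟩
  refine Submodule.subset_span ⟨Finset.univ.image b,
    fun v => if h : ∃ i, b i = v then m h.choose + 1 else 1, ?_, ?_, ?_, ?_⟩
  · intro v hv
    obtain ⟨i, rfl⟩ : ∃ i, b i = v := by simpa using hv
    exact hb i
  · rw [Finset.coe_image, Finset.coe_univ, Set.image_univ, b.span_eq]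
  · intro α _
    dsimp only
    split_ifs <;> omega
  · funext y
    rw [Finset.prod_image b.injective.injOn, one_div]
    refine congrArg _ (Finset.prod_congr rfl fun i _ => ?_)
    have h : ∃ j, b j = b i := ⟨i, rfl⟩
    dsimp only
    rw [dif_pos h, b.injective h.choose_spec]

/-- One power is moved from α to β: the new product is the old one times β/α. This is the elementary
move of the partial fraction expansion. -/
theorem prod_pow_shift {V : Type*} {κ : Finset V} [DecidableEq V] {α β : V} (hα : α ∈ κ)
    (hβ : β ∈ κ) (hne : α ≠ β) (m : V → ℕ) (hm : 0 < m α) (y : V → ℝ) :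
    (∏ γ ∈ κ, y γ ^ (if γ = β then m γ + 1 else if γ = α then m γ - 1 else m γ)) * y α =
      (∏ γ ∈ κ, y γ ^ m γ) * y β := by
  have hα' : α ∈ κ.erase β := Finset.mem_erase.2 ⟨hne, hα⟩
  rw [← Finset.mul_prod_erase κ _ hβ, ← Finset.mul_prod_erase κ _ hβ,
    ← Finset.mul_prod_erase _ _ hα', ← Finset.mul_prod_erase _ _ hα']
  rw [if_pos rfl, if_neg hne, if_pos rfl]
  have : ∏ γ ∈ (κ.erase β).erase α,
      y γ ^ (if γ = β then m γ + 1 else if γ = α then m γ - 1 else m γ) =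
      ∏ γ ∈ (κ.erase β).erase α, y γ ^ m γ := by
    refine Finset.prod_congr rfl fun γ hγ => ?_
    simp only [Finset.mem_erase] at hγ
    rw [if_neg hγ.2.1, if_neg hγ.1]
  rw [this]
  obtain ⟨k, hk⟩ : ∃ k, m α = k + 1 := ⟨m α - 1, by omega⟩
  rw [hk, Nat.add_sub_cancel]
  ring

theorem prod_pow_erase {V : Type*} {κ : Finset V} [DecidableEq V] {α : V} (m : V → ℕ) (hm : m α = 0)
    (y : V → ℝ) : ∏ γ ∈ κ.erase α, y γ ^ m γ = ∏ γ ∈ κ, y γ ^ m γ := by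
  by_cases h : α ∈ κ
  · rw [← Finset.mul_prod_erase κ _ h, hm, pow_zero, one_mul]
  · rw [Finset.erase_eq_of_notMem h]

theorem prod_pow_filter {V : Type*} (κ : Finset V) (m : V → ℕ) (y : V → ℝ) :
    ∏ γ ∈ κ with m γ ≠ 0, y γ ^ m γ = ∏ γ ∈ κ, y γ ^ m γ :=
  Finset.prod_filter_of_ne fun α _ h h0 => by simp [h0] at h

theorem prod_ne_zero_of_dualReg {Δ : Set V} {κ : Finset V} (hκ : (κ : Set V) ⊆ Δ) (m : V → ℕ)
    (y : dualReg Δ) : ∏ γ ∈ κ, y.1 γ ^ m γ ≠ 0 :=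
  Finset.prod_ne_zero_iff.2 fun γ hγ => pow_ne_zero _ (y.2 γ (hκ hγ))

theorem exists_basis_image_eq {r : ℕ} (hr : Module.finrank ℝ V = r) {κ : Finset V}
    [DecidableEq V] (hi : LinearIndepOn ℝ id (κ : Set V))
    (hs : Submodule.span ℝ (κ : Set V) = ⊤) :
    ∃ b : Module.Basis (Fin r) ℝ V, Finset.univ.image b = κ := by
  have hs' : ⊤ ≤ Submodule.span ℝ (Set.range fun x : (κ : Set V) => id (x : V)) := by
    simp [hs]
  let b₀ : Module.Basis (κ : Set V) ℝ V := Module.Basis.mk hi hs'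
  have hc : Fintype.card (κ : Set V) = r := by
    rw [← hr, Module.finrank_eq_card_basis b₀]
  let e : (κ : Set V) ≃ Fin r := Fintype.equivFinOfCardEq hc
  have hb : ∀ i, b₀.reindex e i = (e.symm i : V) := fun i => by
    simp [b₀]
  refine ⟨b₀.reindex e, ?_⟩
  ext v
  simp only [Finset.mem_image, Finset.mem_univ, true_and, hb]
  constructor
  · rintro ⟨i, rfl⟩
    exact (e.symm i).2
  · intro hv
    exact ⟨e ⟨v, hv⟩, by simp⟩

theorem one_div_prod_mem_simpleG_of_linearIndepOn {Δ : Set V} {r : ℕ}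
    (hr : Module.finrank ℝ V = r) {κ : Finset V} (hκ : (κ : Set V) ⊆ Δ)
    (hs : Submodule.span ℝ (κ : Set V) = ⊤) (hi : LinearIndepOn ℝ id (κ : Set V)) (m : V → ℕ)
    (hm : ∀ α ∈ κ, 0 < m α) :
    (fun y : dualReg Δ => 1 / ∏ α ∈ κ, y.1 α ^ m α) ∈ simpleG Δ r := by
  classical
  obtain ⟨b, rfl⟩ := exists_basis_image_eq hr hi hs
  have hb : ∀ i, b i ∈ Finset.univ.image b := fun i => Finset.mem_image_of_mem _ (Finset.mem_univ i)
  refine Submodule.subset_span ⟨b, fun i => m (b i) - 1, fun i => hκ (hb i), ?_⟩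
  funext y
  rw [one_div, Finset.prod_image b.injective.injOn]
  refine congrArg _ (Finset.prod_congr rfl fun i _ => ?_)
  rw [Nat.sub_add_cancel (hm _ (hb i))]

/-- A relation β = ∑ c_α α gives 1/D = ∑ c_α · α/(βD), where each term trades one power of α for one
of β. Repeating this exhausts the exponents off β, so some vector eventually leaves the denominator;
the outer induction is on the number of vectors. -/
theorem one_div_prod_mem_simpleG {Δ : Set V} {r : ℕ}
    (hr : Module.finrank ℝ V = r) {κ : Finset V} (hκ : (κ : Set V) ⊆ Δ)
    (hs : Submodule.span ℝ (κ : Set V) = ⊤) (m : V → ℕ) (hm : ∀ α ∈ κ, 0 < m α) :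
    (fun y : dualReg Δ => 1 / ∏ α ∈ κ, y.1 α ^ m α) ∈ simpleG Δ r := by
  classical
  induction hk : κ.card using Nat.strong_induction_on generalizing κ m with
  | _ k ihk =>
  by_cases hi : LinearIndepOn ℝ id (κ : Set V)
  · exact one_div_prod_mem_simpleG_of_linearIndepOn hr hκ hs hi m hm
  obtain ⟨β, hβ, hβs⟩ : ∃ β ∈ κ, β ∈ Submodule.span ℝ ((κ.erase β : Finset V) : Set V) := by
    by_contra! h
    refine hi (linearIndepOn_iff_notMem_span.2 fun β hβ => ?_)
    simpa using h β hβ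
  obtain ⟨c, -, hc⟩ := Submodule.mem_span_finset.1 hβs
  -- β and the relation `c` stay fixed here. Each move lowers the total exponent of the vectors
  -- other than β.
  induction hM : ∑ α ∈ κ.erase β, m α using Nat.strong_induction_on generalizing m with
  | _ M ihM =>
  let m' : V → V → ℕ := fun α γ => if γ = β then m γ + 1 else if γ = α then m γ - 1 else m γ
  have key : (fun y : dualReg Δ => 1 / ∏ α ∈ κ, y.1 α ^ m α) =
      ∑ α ∈ κ.erase β, c α • fun y : dualReg Δ => 1 / ∏ γ ∈ κ, y.1 γ ^ m' α γ := by
    funext y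
    have hP := prod_ne_zero_of_dualReg hκ m y
    have hyβ : y.1 β ≠ 0 := y.2 β (hκ hβ)
    have hterm : ∀ α ∈ κ.erase β, c α * (1 / ∏ γ ∈ κ, y.1 γ ^ m' α γ) =
        (c α * y.1 α) / ((∏ γ ∈ κ, y.1 γ ^ m γ) * y.1 β) := by
      intro α hα
      rw [Finset.mem_erase] at hα
      have h1 := prod_ne_zero_of_dualReg hκ (m' α) y
      have h2 : y.1 α ≠ 0 := y.2 α (hκ hα.2)
      have h3 : (∏ γ ∈ κ, y.1 γ ^ m' α γ) * y.1 α = (∏ γ ∈ κ, y.1 γ ^ m γ) * y.1 β :=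
        prod_pow_shift hα.2 hβ hα.1 m (hm α hα.2) (fun γ => y.1 γ)
      rw [← h3]
      field_simp
    simp only [Finset.sum_apply, Pi.smul_apply, smul_eq_mul]
    rw [Finset.sum_congr rfl hterm, ← Finset.sum_div]
    have : ∑ α ∈ κ.erase β, c α * y.1 α = y.1 β := by
      conv_rhs => rw [← hc]
      simp
    rw [this]
    field_simp
  rw [key]
  refine Submodule.sum_mem _ fun α hα => ?_
  by_cases hcα : c α = 0
  · rw [hcα, zero_smul]; exact Submodule.zero_mem _
  refine Submodule.smul_mem _ _ ?_
  have hα' := Finset.mem_erase.1 hα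
  have hmα := hm α hα'.2
  -- The exponent of α drops to 0, so α is discarded. The remaining vectors still generate: since
  -- c_α ≠ 0, the relation expresses α through β and the others.
  by_cases h1 : m α = 1
  · have hm0 : m' α α = 0 := by simp [m', hα'.1, h1]
    have : (fun y : dualReg Δ => 1 / ∏ γ ∈ κ, y.1 γ ^ m' α γ) =
        fun y : dualReg Δ => 1 / ∏ γ ∈ κ.erase α, y.1 γ ^ m' α γ := by
      funext y
      rw [prod_pow_erase (m' α) hm0 (fun γ => y.1 γ)]
    rw [this]
    refine ihk _ ?_ ?_ ?_ (m' α) ?_ rfl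
    · rw [← hk]; exact Finset.card_erase_lt_of_mem hα'.2
    · exact (Finset.coe_subset.2 (Finset.erase_subset _ _)).trans hκ
    · rw [eq_top_iff, ← hs, Submodule.span_le]
      intro γ hγ
      have hsub : ∀ γ ∈ κ, γ ≠ α → γ ∈ Submodule.span ℝ ((κ.erase α : Finset V) : Set V) :=
        fun γ hγ hne => Submodule.subset_span (by
          rw [Finset.mem_coe, Finset.mem_erase]; exact ⟨hne, hγ⟩)
      by_cases hγα : γ = α
      · subst hγα
        rw [← Finset.add_sum_erase _ _ hα] at hc
        refine (Submodule.smul_mem_iff _ hcα).1 ?_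
        rw [eq_sub_of_add_eq hc]
        refine (Submodule.sub_mem _ (hsub β hβ (Ne.symm hα'.1)) ?_)
        refine Submodule.sum_mem _ fun x hx => Submodule.smul_mem _ _ ?_
        simp only [Finset.mem_erase] at hx
        exact hsub x hx.2.2 hx.1
      · exact hsub γ hγ hγα
    · intro γ hγ
      rw [Finset.mem_erase] at hγ
      have := hm γ hγ.2
      simp only [m', if_neg hγ.1]
      split_ifs <;> omega
  · refine ihM _ ?_ (m' α) ?_ rfl
    · rw [← hM]
      refine Finset.sum_lt_sum (fun γ hγ => ?_) ⟨α, hα, ?_⟩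
      · rw [Finset.mem_erase] at hγ
        simp only [m', if_neg hγ.1]
        split_ifs <;> omega
      · simp only [m', if_neg hα'.1, if_pos]; omega
    · intro γ hγ
      have := hm γ hγ
      simp only [m']
      split_ifs with h1 h2
      · omega
      · subst h2; omega
      · omega

theorem G_le_simpleG {Δ : Set V} {r : ℕ} (hr : Module.finrank ℝ V = r) : G Δ ≤ simpleG Δ r := by
  refine Submodule.span_le.2 ?_
  rintro _ ⟨κ, m, hκ, hs, hm, rfl⟩
  exact one_div_prod_mem_simpleG hr hκ hs m hm

/-- By linearity the numerator is a product of vectors. While the denominator generates V, one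
numerator factor is a combination of denominator vectors and cancels a power of one of them in each
term. Once the denominator stops generating, the term lies in `NG`. -/
theorem div_prod_mem_simpleG_sup_NG {Δ : Set V} {r : ℕ} (hr : Module.finrank ℝ V = r)
    {ψ : StrongDual ℝ V → ℝ} (hψ : ψ ∈ symDual V) {κ : Finset V} (hκ : (κ : Set V) ⊆ Δ)
    (m : V → ℕ) : (fun y : dualReg Δ => ψ y.1 / ∏ α ∈ κ, y.1 α ^ m α) ∈ simpleG Δ r ⊔ NG Δ := by
  classical
  have hψ' : ψ ∈ Subalgebra.toSubmodule (symDual V) := hψ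
  rw [symDual, Algebra.adjoin_eq_span] at hψ'
  induction hψ' using Submodule.span_induction generalizing κ m with
  | zero => convert Submodule.zero_mem _ using 1; funext y; simp
  | add f g hf hg h1 h2 =>
    rw [← Algebra.adjoin_eq_span] at hf hg
    convert Submodule.add_mem _ (h1 hf hκ m) (h2 hg hκ m) using 1
    funext y; simp [add_div]
  | smul c f hf h1 =>
    rw [← Algebra.adjoin_eq_span] at hf
    convert Submodule.smul_mem _ c (h1 hf hκ m) using 1
    funext y; simp [mul_div_assoc]
  | mem f hf =>
    -- Vectors with exponent 0 are removed, so that the test whether κ generates concerns only the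
    -- vectors that really occur in the denominator.
    have hpos : (fun y : dualReg Δ => f y.1 / ∏ α ∈ κ, y.1 α ^ m α) =
        fun y : dualReg Δ => f y.1 / ∏ α ∈ κ with m α ≠ 0, y.1 α ^ m α := by
      funext y
      rw [prod_pow_filter κ m (fun γ => y.1 γ)]
    have hκ' : ((κ.filter fun α => m α ≠ 0 : Finset V) : Set V) ⊆ Δ :=
      (Finset.coe_subset.2 (Finset.filter_subset _ _)).trans hκ
    rw [hpos]
    by_cases hs : Submodule.span ℝ ((κ.filter fun α => m α ≠ 0 : Finset V) : Set V) = ⊤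
    · induction hf using Submonoid.closure_induction_left generalizing κ m with
      | one =>
        exact Submodule.mem_sup_left (one_div_prod_mem_simpleG hr hκ' hs m
          (fun α hα => Nat.pos_of_ne_zero (Finset.mem_filter.1 hα).2))
      | mul_left x hx f hf ih =>
        obtain ⟨v, rfl⟩ := hx
        set κ' := κ.filter fun α => m α ≠ 0
        have hv : v ∈ Submodule.span ℝ (κ' : Set V) := by rw [hs]; trivial
        have hfm : f ∈ symDual V := by
          have : f ∈ Subalgebra.toSubmodule (symDual V) := by
            rw [symDual, Algebra.adjoin_eq_span]; exact Submodule.subset_span hf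
          exact this
        obtain ⟨c, -, hc⟩ := Submodule.mem_span_finset.1 hv
        have key : (fun y : dualReg Δ => ((fun y : StrongDual ℝ V => y v) * f) y.1 /
            ∏ α ∈ κ', y.1 α ^ m α) = ∑ α ∈ κ', c α • fun y : dualReg Δ =>
              f y.1 / ∏ γ ∈ κ', y.1 γ ^ (Function.update m α (m α - 1) γ) := by
          funext y
          have hterm : ∀ α ∈ κ', c α *
              (f y.1 / ∏ γ ∈ κ', y.1 γ ^ (Function.update m α (m α - 1) γ)) =
              (c α * y.1 α) * (f y.1 / ∏ γ ∈ κ', y.1 γ ^ m γ) := by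
            intro α hα
            have h2 : y.1 α ≠ 0 := y.2 α (hκ' hα)
            have h1 := prod_ne_zero_of_dualReg hκ' m y
            have h3 := prod_ne_zero_of_dualReg hκ' (Function.update m α (m α - 1)) y
            have : ∏ γ ∈ κ', y.1 γ ^ m γ =
                y.1 α * ∏ γ ∈ κ', y.1 γ ^ (Function.update m α (m α - 1) γ) := by
              rw [← Finset.mul_prod_erase κ' _ hα, ← Finset.mul_prod_erase κ' _ hα]
              rw [Function.update_self, ← mul_assoc, ← pow_succ',
                Nat.sub_add_cancel (Nat.pos_of_ne_zero (Finset.mem_filter.1 hα).2)]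
              congr 1
              refine Finset.prod_congr rfl fun γ hγ => ?_
              rw [Function.update_of_ne (Finset.mem_erase.1 hγ).1]
            rw [this]
            field_simp
          simp only [Finset.sum_apply, Pi.smul_apply, smul_eq_mul, Pi.mul_apply]
          rw [Finset.sum_congr rfl hterm, ← Finset.sum_mul]
          have : ∑ α ∈ κ', c α * y.1 α = y.1 v := by
            conv_rhs => rw [← hc]
            simp
          rw [this, mul_div_assoc]
        rw [key]
        refine Submodule.sum_mem _ fun α hα => Submodule.smul_mem _ _ ?_
        have hpos' : (fun y : dualReg Δ =>
            f y.1 / ∏ γ ∈ κ', y.1 γ ^ (Function.update m α (m α - 1) γ)) =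
            fun y : dualReg Δ => f y.1 / ∏ γ ∈ κ' with (Function.update m α (m α - 1) γ) ≠ 0,
              y.1 γ ^ (Function.update m α (m α - 1) γ) := by
          funext y
          rw [prod_pow_filter κ' _ (fun γ => y.1 γ)]
        have hκ'' : ((κ'.filter fun γ => (Function.update m α (m α - 1) γ) ≠ 0 : Finset V) :
            Set V) ⊆ Δ := (Finset.coe_subset.2 (Finset.filter_subset _ _)).trans hκ'
        by_cases hs' : Submodule.span ℝ ((κ'.filter fun γ =>
            (Function.update m α (m α - 1) γ) ≠ 0 : Finset V) : Set V) = ⊤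
        · rw [hpos']
          exact ih hfm hκ' _ hpos' hκ'' hs'
        · rw [hpos']
          exact Submodule.mem_sup_right (Submodule.subset_span ⟨f, _, _, hfm, hκ'', hs', rfl⟩)
    · exact Submodule.mem_sup_right (Submodule.subset_span ⟨f, _, m, hψ, hκ', hs, rfl⟩)

end

end HyperplaneLaplace

namespace HyperplaneLaplace

noncomputable section

/-! ### Injectivity of the Laplace transform -/

section Injectivity

open ProbabilityTheory

variable {E : Type*} [NormedAddCommGroup E] [NormedSpace ℝ E] [MeasurableSpace E]

/-- The complex moment generating functions are analytic on the strip |Re z| < ε and agree on a real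
interval, hence on the whole strip. Their values at `I` are the characteristic functions. -/
theorem charFunDual_eq_of_mgf_eq {ν ν' : Measure E} [IsFiniteMeasure ν] [IsFiniteMeasure ν']
    (L : StrongDual ℝ E) {ε : ℝ} (hε : 0 < ε)
    (hi : ∀ t : ℝ, |t| < ε → Integrable (fun h => Real.exp (t * L h)) ν)
    (hi' : ∀ t : ℝ, |t| < ε → Integrable (fun h => Real.exp (t * L h)) ν')
    (he : ∀ t : ℝ, |t| < ε → mgf L ν t = mgf L ν' t) :
    charFunDual ν L = charFunDual ν' L := by
  have hsub : ∀ (ν : Measure E), (∀ t : ℝ, |t| < ε → Integrable (fun h => Real.exp (t * L h)) ν) →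
      {z : ℂ | z.re ∈ Set.Ioo (-ε) ε} ⊆ {z : ℂ | z.re ∈ interior (integrableExpSet L ν)} := by
    intro ν h z hz
    refine interior_maximal ?_ isOpen_Ioo hz
    intro t ht
    exact h t (abs_lt.2 ht)
  have hX : AnalyticOnNhd ℂ (complexMGF L ν) {z : ℂ | z.re ∈ Set.Ioo (-ε) ε} :=
    analyticOnNhd_complexMGF.mono (hsub ν hi)
  have hY : AnalyticOnNhd ℂ (complexMGF L ν') {z : ℂ | z.re ∈ Set.Ioo (-ε) ε} :=
    analyticOnNhd_complexMGF.mono (hsub ν' hi')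
  have hpre : IsPreconnected {z : ℂ | z.re ∈ Set.Ioo (-ε) ε} :=
    ((convex_Ioo (-ε) ε).linear_preimage Complex.reLm).isPreconnected
  have heq : Set.EqOn (complexMGF L ν) (complexMGF L ν') {z : ℂ | z.re ∈ Set.Ioo (-ε) ε} := by
    refine hX.eqOn_of_preconnected_of_frequently_eq hY hpre (z₀ := ((0 : ℝ) : ℂ)) (by simp [hε]) ?_
    have h_real : ∃ᶠ x : ℝ in 𝓝[≠] 0, complexMGF L ν x = complexMGF L ν' x := by
      refine Eventually.frequently ?_
      have : Set.Ioo (-ε) ε ∈ 𝓝[≠] (0 : ℝ) :=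
        mem_nhdsWithin_of_mem_nhds (Ioo_mem_nhds (by linarith) hε)
      filter_upwards [this] with x hx
      rw [complexMGF_ofReal, complexMGF_ofReal, he x (abs_lt.2 hx)]
    have hmap : Tendsto (fun x : ℝ => (x : ℂ)) (𝓝[≠] 0) (𝓝[≠] ((0 : ℝ) : ℂ)) := by
      refine tendsto_nhdsWithin_iff.2 ⟨?_, ?_⟩
      · exact (Complex.continuous_ofReal.tendsto 0).mono_left nhdsWithin_le_nhds
      · filter_upwards [self_mem_nhdsWithin] with x hx
        simpa using hx
    exact hmap.frequently h_real
  have h1 := heq (show Complex.I ∈ {z : ℂ | z.re ∈ Set.Ioo (-ε) ε} by simp [hε])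
  simp only [complexMGF] at h1
  simp only [charFunDual_apply]
  simpa [mul_comm] using h1

/-- After tilting by exp(-y₀), the positive and negative parts of the function are densities of two
finite measures. The vanishing transform says that their moment generating functions agree near 0 in
every direction, so the measures coincide. -/
theorem ae_eq_zero_of_laplace_eq_zero [FiniteDimensional ℝ E] [BorelSpace E] {μ : Measure E} {f : E → ℝ} {O : Set (StrongDual ℝ E)}
    {y₀ : StrongDual ℝ E} (hO : O ∈ 𝓝 y₀)
    (h : ∀ y ∈ O, Integrable (fun h => Real.exp (-y h) * f h) μ ∧
      ∫ h, Real.exp (-y h) * f h ∂μ = 0) : f =ᵐ[μ] 0 := by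
  set F : E → ℝ := fun h => Real.exp (-y₀ h) * f h with hF
  have hFi : Integrable F μ := (h y₀ (mem_of_mem_nhds hO)).1
  -- `ENNReal.ofReal` truncates at 0, so these are the positive and the negative part of `F` times
  -- μ.
  let ν := μ.withDensity fun h => ENNReal.ofReal (F h)
  let ν' := μ.withDensity fun h => ENNReal.ofReal (-F h)
  have : IsFiniteMeasure ν := isFiniteMeasure_withDensity_ofReal hFi.2
  have : IsFiniteMeasure ν' := isFiniteMeasure_withDensity_ofReal hFi.neg.2
  have hint : ∀ (L : StrongDual ℝ E) (t : ℝ), y₀ - t • L ∈ O →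
      Integrable (fun h => Real.exp (t * L h) * F h) μ ∧
        ∫ h, Real.exp (t * L h) * F h ∂μ = 0 := by
    intro L t ht
    have := h _ ht
    have he : (fun h => Real.exp (-(y₀ - t • L) h) * f h) =
        fun h => Real.exp (t * L h) * F h := by
      funext x
      simp only [hF]
      rw [← mul_assoc, ← Real.exp_add]
      congr 2
      simp
      ring
    rwa [he] at this
  have hdens : ∀ (F : E → ℝ) (L : StrongDual ℝ E) (t : ℝ), Integrable F μ →
      Integrable (fun h => Real.exp (t * L h) * F h) μ →
      Integrable (fun h => Real.exp (t * L h)) (μ.withDensity fun h => ENNReal.ofReal (F h)) ∧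
      ∫ h, Real.exp (t * L h) ∂(μ.withDensity fun h => ENNReal.ofReal (F h)) =
        ∫ h, max (Real.exp (t * L h) * F h) 0 ∂μ := by
    intro F L t hF hi
    have hm : AEMeasurable (fun h => ENNReal.ofReal (F h)) μ :=
      hF.1.aemeasurable.ennreal_ofReal
    have he : (fun h => (ENNReal.ofReal (F h)).toReal • Real.exp (t * L h)) =
        fun h => max (Real.exp (t * L h) * F h) 0 := by
      funext x
      rw [ENNReal.toReal_ofReal', smul_eq_mul, max_mul_of_nonneg _ _ (Real.exp_pos _).le, zero_mul,
        mul_comm]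
    constructor
    · rw [integrable_withDensity_iff_integrable_smul₀' hm (by simp), he]
      exact hi.pos_part
    · rw [integral_withDensity_eq_integral_toReal_smul₀ hm (by simp), he]
  have hνν' : ν = ν' := by
    refine Measure.ext_of_charFunDual (funext fun L => ?_)
    have hc : Tendsto (fun t : ℝ => y₀ - t • L) (𝓝 0) (𝓝 y₀) := by
      have : Continuous (fun t : ℝ => y₀ - t • L) := by fun_prop
      simpa using this.tendsto 0
    obtain ⟨ε, hε, hεO⟩ := Metric.mem_nhds_iff.1 (hc hO)
    have hεO' : ∀ t : ℝ, |t| < ε → y₀ - t • L ∈ O := fun t ht => hεO (by simpa using ht)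
    have hneg : ∀ t : ℝ, |t| < ε → Integrable (fun h => Real.exp (t * L h) * -F h) μ := by
      intro t ht
      simpa using (hint L t (hεO' t ht)).1.neg
    refine charFunDual_eq_of_mgf_eq L hε (fun t ht => ?_) (fun t ht => ?_) fun t ht => ?_
    · exact (hdens F L t hFi (hint L t (hεO' t ht)).1).1
    · exact (hdens (fun h => -F h) L t hFi.neg (hneg t ht)).1
    · have h1 := hint L t (hεO' t ht)
      have h2 := (hdens F L t hFi h1.1).2
      have h3 := (hdens (fun h => -F h) L t hFi.neg (hneg t ht)).2
      simp only [mgf]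
      refine h2.trans (Eq.trans ?_ h3.symm)
      rw [← sub_eq_zero, ← integral_sub h1.1.pos_part (hneg t ht).pos_part]
      refine Eq.trans ?_ h1.2
      refine integral_congr_ae (Eventually.of_forall fun x => ?_)
      simp only [mul_neg]
      rcases le_total 0 (Real.exp (t * L x) * F x) with h0 | h0
      · rw [max_eq_left h0, max_eq_right (by linarith), sub_zero]
      · rw [max_eq_right h0, max_eq_left (by linarith)]; ring
  replace hνν' := (withDensity_eq_iff hFi.1.aemeasurable.ennreal_ofReal
    hFi.neg.1.aemeasurable.ennreal_ofReal
    (by rw [← lt_top_iff_ne_top]; exact hFi.lintegral_lt_top)).1 hνν'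
  filter_upwards [hνν'] with x hx
  simp only [Pi.neg_apply] at hx
  have hx0 : F x = 0 := by
    rcases le_total (F x) 0 with h0 | h0
    · rw [ENNReal.ofReal_of_nonpos h0, eq_comm, ENNReal.ofReal_eq_zero] at hx; linarith
    · rw [ENNReal.ofReal_of_nonpos (p := -F x) (by linarith), ENNReal.ofReal_eq_zero] at hx; linarith
  simpa [hF, (Real.exp_pos _).ne'] using hx0

end Injectivity

/-! ### Functions annihilated by finite differences -/

section Differences

variable {X : Type*} [AddCommGroup X] [Module ℝ X]

/-- Successive finite differences along the directions in the list, with arbitrary step sizes,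
annihilate the function. -/
def IsAnnihilated : List X → (X → ℝ) → Prop
  | [], ν => ν = 0
  | a :: l, ν => ∀ s : ℝ, IsAnnihilated l fun y => ν (y + s • a) - ν y

theorem IsAnnihilated.add {l : List X} {ν ν' : X → ℝ} (h : IsAnnihilated l ν)
    (h' : IsAnnihilated l ν') : IsAnnihilated l (ν + ν') := by
  induction l generalizing ν ν' with
  | nil => simp only [IsAnnihilated] at *; simp [h, h']
  | cons a l ih =>
    intro s
    convert ih (h s) (h' s) using 1
    funext y; simp; ring

theorem IsAnnihilated.smul {l : List X} {ν : X → ℝ} (h : IsAnnihilated l ν) (c : ℝ) :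
    IsAnnihilated l (c • ν) := by
  induction l generalizing ν with
  | nil => simp only [IsAnnihilated] at *; simp [h]
  | cons a l ih =>
    intro s
    convert ih (h s) using 1
    funext y; simp; ring

/-- Translations commute, so a difference in a new direction may be taken first. This lets a list be
enlarged and gives two functions a common annihilating list. -/
theorem IsAnnihilated.diff {l : List X} {ν : X → ℝ} (h : IsAnnihilated l ν) (b : X) :
    IsAnnihilated l fun y => ν (y + b) - ν y := by
  induction l generalizing ν with
  | nil => simp only [IsAnnihilated] at *; subst h; funext y; simp
  | cons a l ih =>
    intro s
    convert ih (h s) using 1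
    funext y
    rw [add_right_comm y b (s • a)]
    ring

theorem IsAnnihilated.append_left {l : List X} {ν : X → ℝ} (h : IsAnnihilated l ν)
    (l' : List X) : IsAnnihilated (l' ++ l) ν := by
  induction l' generalizing ν with
  | nil => exact h
  | cons a l' ih => exact fun s => ih (h.diff _)

theorem IsAnnihilated.zero (l : List X) : IsAnnihilated l (0 : X → ℝ) := by
  simpa using IsAnnihilated.append_left (l := []) (ν := (0 : X → ℝ)) rfl l

theorem IsAnnihilated.append_right {l : List X} {ν : X → ℝ} (h : IsAnnihilated l ν)
    (l' : List X) : IsAnnihilated (l ++ l') ν := by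
  induction l generalizing ν with
  | nil => simp only [IsAnnihilated] at h; subst h; exact IsAnnihilated.zero l'
  | cons a l ih => exact fun s => ih (h s)

/-- Each difference lowers the degree along `a`, because a Taylor shift preserves degree and leading
coefficient. -/
theorem isAnnihilated_replicate {N : ℕ} {a : X} {ν : X → ℝ}
    (h : ∀ y, ∃ p : Polynomial ℝ, p.degree < N ∧ ∀ t : ℝ, ν (y + t • a) = p.eval t) :
    IsAnnihilated (List.replicate N a) ν := by
  induction N generalizing ν with
  | zero =>
    funext y
    obtain ⟨p, hp, hp'⟩ := h y
    have hp0 : p = 0 := Polynomial.degree_eq_bot.1 (Nat.WithBot.lt_zero_iff.1 (by simpa using hp))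
    simpa [hp0] using hp' 0
  | succ N ih =>
    intro s
    refine ih fun y => ?_
    obtain ⟨p, hp, hp'⟩ := h y
    refine ⟨Polynomial.taylor s p - p, ?_, fun t => ?_⟩
    · by_cases hp0 : p = 0
      · simp [hp0]
      · have h1 : (Polynomial.taylor s p - p).degree < p.degree := by
          rw [← Polynomial.degree_taylor p s]
          refine Polynomial.degree_sub_lt_left (Polynomial.degree_taylor p s) ?_ ?_
          · rw [Ne, Polynomial.taylor_eq_zero]; exact hp0
          · exact Polynomial.leadingCoeff_taylor s p
        rw [Polynomial.degree_eq_natDegree hp0] at h1 hp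
        refine h1.trans_le ?_
        norm_cast at hp ⊢
        omega
    · rw [Polynomial.eval_sub, Polynomial.taylor_eval, ← hp', ← hp', add_assoc, ← add_smul]

end Differences

/-! ### Laplace transforms killed by finite differences -/

section Annihilation

variable {E : Type*} [NormedAddCommGroup E] [NormedSpace ℝ E] [FiniteDimensional ℝ E]
  [MeasurableSpace E] [BorelSpace E]

/-- Replacing the transform by its difference with step `s • a` replaces `f` by (exp(-s⟨a,h⟩) - 1)
f. For s ≠ 0 this factor vanishes only on the kernel of `a`, a null set, so induction on the list
reduces to injectivity. -/
theorem ae_eq_zero_of_laplace_isAnnihilated {μ : Measure E} [μ.IsAddHaarMeasure] {f : E → ℝ}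
    {ν : StrongDual ℝ E → ℝ} {O : Set (StrongDual ℝ E)} {y₀ : StrongDual ℝ E} (hO : O ∈ 𝓝 y₀)
    {l : List (StrongDual ℝ E)} (hl : ∀ a ∈ l, a ≠ 0) (hν : IsAnnihilated l ν)
    (h : ∀ y ∈ O, Integrable (fun h => Real.exp (-y h) * f h) μ ∧
      ∫ h, Real.exp (-y h) * f h ∂μ = ν y) : f =ᵐ[μ] 0 := by
  induction l generalizing f ν O with
  | nil =>
    refine ae_eq_zero_of_laplace_eq_zero hO fun y hy => ?_
    simp only [IsAnnihilated] at hν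
    have := h y hy
    rwa [hν] at this
  | cons a l ih =>
    -- The step must be nonzero, yet small enough that `y + s • a` stays in `O` for all `y` near
    -- `y₀`.
    have hc : Tendsto (fun p : ℝ × StrongDual ℝ E => p.2 + p.1 • a) (𝓝 0 ×ˢ 𝓝 y₀) (𝓝 y₀) := by
      have : Continuous (fun p : ℝ × StrongDual ℝ E => p.2 + p.1 • a) := by fun_prop
      have := this.tendsto (0, y₀)
      rw [nhds_prod_eq] at this
      simpa using this
    obtain ⟨A, hA, B, hB, hAB⟩ := Filter.mem_prod_iff.1 (hc hO)
    obtain ⟨s, hs, hs0⟩ : ∃ s ∈ A, s ≠ 0 := by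
      obtain ⟨ε, hε, h⟩ := Metric.mem_nhds_iff.1 hA
      refine ⟨ε / 2, h ?_, by positivity⟩
      simp [abs_of_pos hε, hε]
    have hmem : ∀ y ∈ B, y + s • a ∈ O := fun y hy => hAB (Set.mk_mem_prod hs hy)
    have h0 := ih (f := fun h => (Real.exp (-(s * a h)) - 1) * f h) (inter_mem hO hB)
      (fun a' ha' => hl a' (List.mem_cons_of_mem _ ha')) (hν s) ?_
    · have hk : ∀ᵐ x ∂μ, a x ≠ 0 := by
        have hk : (LinearMap.ker a.toLinearMap) ≠ ⊤ := by
          intro hk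
          refine hl a List.mem_cons_self ?_
          ext x
          have : x ∈ LinearMap.ker a.toLinearMap := by rw [hk]; trivial
          simpa using this
        have := Measure.addHaar_submodule μ _ hk
        rw [ae_iff]
        convert this using 2
        ext x; simp
      filter_upwards [h0, hk] with x hx hax
      rcases mul_eq_zero.1 hx with h1 | h1
      · exfalso
        have : Real.exp (-(s * a x)) = 1 := by linarith
        rw [Real.exp_eq_one_iff] at this
        have : s * a x = 0 := by linarith
        exact (mul_ne_zero hs0 hax) this
      · exact h1
    · intro y hy
      have h1 := h _ (hmem y hy.2)
      have h2 := h y hy.1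
      have he : (fun h => Real.exp (-y h) * ((Real.exp (-(s * a h)) - 1) * f h)) =
          fun h => Real.exp (-(y + s • a) h) * f h - Real.exp (-y h) * f h := by
        funext x
        have : -(y + s • a) x = -y x + -(s * a x) := by simp; ring
        rw [this, Real.exp_add]
        ring
      rw [he]
      exact ⟨h1.1.sub h2.1, by rw [integral_sub h1.1 h2.1, h1.2, h2.2]⟩

end Annihilation

variable {V : Type*} [NormedAddCommGroup V] [NormedSpace ℝ V] [FiniteDimensional ℝ V]

theorem exists_annihilator_of_ne_top {W : Submodule ℝ V} (hW : W ≠ ⊤) :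
    ∃ a : StrongDual ℝ V, a ≠ 0 ∧ ∀ w ∈ W, a w = 0 := by
  obtain ⟨f, hf, hf'⟩ := W.exists_le_ker_of_lt_top (lt_top_iff_ne_top.2 hW)
  refine ⟨LinearMap.toContinuousLinearMap f, ?_, fun w hw => hf' hw⟩
  simpa using hf

/-- A set κ that does not generate is killed by some nonzero `a`. Along `a` the denominator is
constant and the function is polynomial of bounded degree. -/
theorem exists_isAnnihilated_of_mem_NG {Δ : Set V} {g : dualReg Δ → ℝ} (hg : g ∈ NG Δ) :
    ∃ (ν : StrongDual ℝ V → ℝ) (l : List (StrongDual ℝ V)), (∀ a ∈ l, a ≠ 0) ∧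
      IsAnnihilated l ν ∧ ∀ y : dualReg Δ, g y = ν y.1 := by
  induction hg using Submodule.span_induction with
  | zero => exact ⟨0, [], by simp, rfl, fun _ => rfl⟩
  | add g g' _ _ h h' =>
    obtain ⟨ν, l, h1, h2, h3⟩ := h
    obtain ⟨ν', l', h1', h2', h3'⟩ := h'
    refine ⟨ν + ν', l ++ l', ?_, (h2.append_right l').add (h2'.append_left l), fun y => by
      simp [h3, h3']⟩
    intro a ha
    rcases List.mem_append.1 ha with ha | ha
    · exact h1 a ha
    · exact h1' a ha
  | smul c g _ h =>
    obtain ⟨ν, l, h1, h2, h3⟩ := h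
    exact ⟨c • ν, l, h1, h2.smul c, fun y => by simp [h3]⟩
  | mem g hg =>
    obtain ⟨ψ, κ, m, hψ, -, hs, rfl⟩ := hg
    obtain ⟨a, ha, ha'⟩ := exists_annihilator_of_ne_top hs
    obtain ⟨N, hN⟩ := adjoin_eval_line symDual_generators hψ a
    -- The fraction is extended to all of V* with x/0 = 0. The denominator is constant along `a`
    -- even where it is zero, so the restriction to each such line is polynomial without exception.
    refine ⟨fun y => ψ y / ∏ α ∈ κ, y α ^ m α, List.replicate N a, ?_, ?_, fun _ => rfl⟩
    · intro b hb
      rw [List.eq_of_mem_replicate hb]; exact ha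
    · refine isAnnihilated_replicate fun y => ?_
      obtain ⟨p, hp, hp'⟩ := hN y
      refine ⟨(∏ α ∈ κ, y α ^ m α)⁻¹ • p, ?_, fun t => ?_⟩
      · exact (Polynomial.degree_smul_le _ _).trans_lt hp
      · have : ∀ α ∈ κ, (y + t • a) α ^ m α = y α ^ m α := fun α hα => by
          simp [ha' α (Submodule.subset_span hα)]
        rw [hp', Finset.prod_congr rfl this]
        simp [div_eq_inv_mul]

end

end HyperplaneLaplace

namespace HyperplaneLaplace

noncomputable section

variable {V : Type*} [NormedAddCommGroup V] [NormedSpace ℝ V]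

/-! ### Polynomials on simplicial cones -/

/-- The polynomial `∏_i x_i ^ m_i / m_i!` in the coordinates of the basis `b`. -/
def conePoly {r : ℕ} (b : Module.Basis (Fin r) ℝ V) (m : Fin r → ℕ) (h : V) : ℝ :=
  ∏ i, (b.repr h i ^ m i / (m i).factorial)

open Classical in
/-- The restriction of `conePoly b m` to the cone generated by the basis `b`, extended by zero. -/
def coneFun {r : ℕ} (b : Module.Basis (Fin r) ℝ V) (m : Fin r → ℕ) (h : V) : ℝ :=
  if ∀ i, 0 ≤ b.repr h i then conePoly b m h else 0

theorem cone_image_basis [DecidableEq V] {r : ℕ} (b : Module.Basis (Fin r) ℝ V) :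
    cone (Finset.univ.image b) = {h | ∀ i, 0 ≤ b.repr h i} := by
  ext h
  constructor
  · rintro ⟨c, hc, rfl⟩ i
    rw [Finset.sum_image b.injective.injOn, b.repr_sum_self]
    exact hc _ (Finset.mem_image_of_mem _ (Finset.mem_univ i))
  · intro hh
    refine ⟨fun v => if hv : ∃ i, b i = v then b.repr h hv.choose else 0, ?_, ?_⟩
    · intro α _
      dsimp only
      split_ifs with hv
      · exact hh _
      · exact le_rfl
    · rw [Finset.sum_image b.injective.injOn]
      conv_lhs => rw [← b.sum_repr h]
      refine Finset.sum_congr rfl fun i _ => ?_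
      have hv : ∃ j, b j = b i := ⟨i, rfl⟩
      dsimp only
      rw [dif_pos hv, b.injective hv.choose_spec]

theorem coneFun_eq_indicator [DecidableEq V] {r : ℕ} (b : Module.Basis (Fin r) ℝ V)
    (m : Fin r → ℕ) (h : V) :
    coneFun b m h = (cone (Finset.univ.image b)).indicator (conePoly b m) h := by
  rw [coneFun, cone_image_basis, Set.indicator_apply]
  rfl

theorem isWall_ker_coord {Δ : Set V} {r : ℕ} (b : Module.Basis (Fin r) ℝ V)
    (hb : ∀ i, b i ∈ Δ) (i : Fin r) : IsWall Δ (LinearMap.ker (b.coord i)) := by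
  classical
  have hcoe : (((Finset.univ.erase i).image b : Finset V) : Set V) ⊆ Set.range b := by
    intro v hv
    obtain ⟨j, -, rfl⟩ := Finset.mem_image.1 (Finset.mem_coe.1 hv)
    exact ⟨j, rfl⟩
  refine ⟨(Finset.univ.erase i).image b, ?_, ?_, ?_, ?_⟩
  · intro v hv
    obtain ⟨j, rfl⟩ := hcoe hv
    exact hb j
  · exact b.linearIndependent.linearIndepOn_id.mono hcoe
  · rw [Finset.card_image_of_injective _ b.injective, Finset.card_erase_add_one (Finset.mem_univ i),
      Module.finrank_eq_card_basis b, Finset.card_univ]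
  · refine le_antisymm (Submodule.span_le.2 ?_) fun h hh => ?_
    · intro v hv
      obtain ⟨j, hj, rfl⟩ := Finset.mem_image.1 (Finset.mem_coe.1 hv)
      have hne : j ≠ i := (Finset.mem_erase.1 hj).1
      simp [hne]
    · rw [LinearMap.mem_ker, Module.Basis.coord_apply] at hh
      rw [← b.sum_repr h, ← Finset.add_sum_erase _ _ (Finset.mem_univ i), hh, zero_smul, zero_add]
      exact Submodule.sum_mem _ fun j hj => Submodule.smul_mem _ _
        (Submodule.subset_span (Finset.mem_coe.2 (Finset.mem_image_of_mem _ hj)))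

/-- The facets of the cone of a basis in Δ span walls. Hence the indicator of such a cone can change
only across walls. -/
theorem repr_ne_zero_of_mem_reg {Δ : Set V} {r : ℕ} (b : Module.Basis (Fin r) ℝ V)
    (hb : ∀ i, b i ∈ Δ) {h : V} (hh : h ∈ reg Δ) (i : Fin r) : b.repr h i ≠ 0 := by
  intro h0
  exact hh _ (isWall_ker_coord b hb i) (by simpa using h0)

section FiniteDim

variable [FiniteDimensional ℝ V]

theorem continuous_repr {r : ℕ} (b : Module.Basis (Fin r) ℝ V) (i : Fin r) :
    Continuous fun h => b.repr h i :=
  (b.coord i).continuous_of_finiteDimensional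

theorem conePoly_mem_sym {r : ℕ} (b : Module.Basis (Fin r) ℝ V) (m : Fin r → ℕ) :
    conePoly b m ∈ sym V := by
  have : conePoly b m = ∏ i, (((m i).factorial : ℝ)⁻¹ • (fun h : V => b.repr h i) ^ m i) := by
    funext h
    rw [Finset.prod_apply]
    refine Finset.prod_congr rfl fun i _ => ?_
    simp [div_eq_inv_mul]
  rw [this]
  refine Subalgebra.prod_mem _ fun i _ => Subalgebra.smul_mem _ (Subalgebra.pow_mem _ ?_ _) _
  exact apply_mem_sym (LinearMap.toContinuousLinearMap (b.coord i))

theorem coneFun_mem_locPolyCone {Δ : Set V} {δ : Set (StrongDual ℝ V)} {r : ℕ}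
    (b : Module.Basis (Fin r) ℝ V) (hb : ∀ i, b i ∈ Δ) (hpos : ∀ i, ∀ y ∈ δ, 0 < y (b i))
    (m : Fin r → ℕ) : (fun h : reg Δ => coneFun b m h.1) ∈ locPolyCone Δ δ := by
  classical
  have hcoe : ((Finset.univ.image b : Finset V) : Set V) = Set.range b := by simp
  refine Submodule.subset_span ⟨conePoly b m, Finset.univ.image b, conePoly_mem_sym b m, ?_, ?_, ?_,
    ?_, ?_⟩
  · rw [hcoe]; rintro _ ⟨i, rfl⟩; exact hb i
  · rw [hcoe]; exact b.linearIndependent.linearIndepOn_id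
  · rw [hcoe, b.span_eq]
  · rw [cone_image_basis]
    intro h hh y hy
    rw [← b.sum_repr h, map_sum]
    refine Finset.sum_nonneg fun i _ => ?_
    rw [map_smul, smul_eq_mul]
    exact mul_nonneg (hh i) (hpos i y hy).le
  · funext h
    exact coneFun_eq_indicator b m h.1

/-- On a component of `reg Δ` each coordinate with respect to a basis in Δ has constant sign, so the
component lies inside the cone or is disjoint from it. -/
theorem locPolyCone_subset_locPoly {Δ : Set V} {δ : Set (StrongDual ℝ V)} {f : reg Δ → ℝ}
    (hf : f ∈ locPolyCone Δ δ) : f ∈ locPoly Δ := by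
  classical
  induction hf using Submodule.span_induction with
  | zero => exact fun U _ => ⟨0, Subalgebra.zero_mem _, fun _ _ => rfl⟩
  | add f g _ _ hf hg =>
    intro U hU
    obtain ⟨p, hp, hp'⟩ := hf U hU
    obtain ⟨q, hq, hq'⟩ := hg U hU
    exact ⟨p + q, Subalgebra.add_mem _ hp hq, fun h hh => by simp [hp' h hh, hq' h hh]⟩
  | smul c f _ hf =>
    intro U hU
    obtain ⟨p, hp, hp'⟩ := hf U hU
    exact ⟨c • p, Subalgebra.smul_mem _ hp c, fun h hh => by simp [hp' h hh]⟩
  | mem f hf =>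
    obtain ⟨p, σ, hp, hσ, hi, hs, -, rfl⟩ := hf
    intro U hU
    obtain ⟨b, rfl⟩ := exists_basis_image_eq rfl hi hs
    have hb : ∀ i, b i ∈ Δ := fun i => hσ (by simp)
    rw [cone_image_basis]
    by_cases hall : ∀ i, ∀ h ∈ U, 0 < b.repr h i
    · refine ⟨p, hp, fun h hh => ?_⟩
      dsimp only
      rw [Set.indicator_of_mem]
      exact fun i => (hall i h.1 hh).le
    · push Not at hall
      obtain ⟨i, h₀, hh₀, hneg⟩ := hall
      refine ⟨0, Subalgebra.zero_mem _, fun h hh => ?_⟩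
      rcases pos_or_neg_of_isPreconnected hU.isPreconnected (continuous_repr b i)
        (fun x hx => repr_ne_zero_of_mem_reg b hb (hU.subset hx) i) with h1 | h1
      · exact absurd (h1 h₀ hh₀) (not_lt.2 hneg)
      · dsimp only
        rw [Set.indicator_of_notMem]
        · rfl
        · exact fun h2 => absurd (h1 h.1 hh) (not_lt.2 (h2 i))

end FiniteDim

/-! ### The Laplace transform of a polynomial on a simplicial cone -/

theorem laplace_monomial_Ici {a : ℝ} (ha : 0 < a) (k : ℕ) :
    Integrable ((Set.Ici (0 : ℝ)).indicator fun t => Real.exp (-(a * t)) * (t ^ k / k.factorial)) ∧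
    ∫ t, (Set.Ici (0 : ℝ)).indicator
      (fun t => Real.exp (-(a * t)) * (t ^ k / k.factorial)) t = (a ^ (k + 1))⁻¹ := by
  have hk : (-1 : ℝ) < k := by have := k.cast_nonneg (α := ℝ); linarith
  have h1 := integrableOn_rpow_mul_exp_neg_mul_rpow (p := 1) hk one_pos ha
  have h2 := Real.integral_rpow_mul_exp_neg_mul_Ioi (a := k + 1) (by linarith) ha
  have he : Set.EqOn (fun x : ℝ => x ^ (k : ℝ) * Real.exp (-a * x ^ (1 : ℝ)) * (k.factorial : ℝ)⁻¹)
      (fun t => Real.exp (-(a * t)) * (t ^ k / k.factorial)) (Set.Ioi 0) := by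
    intro t _
    simp only [Real.rpow_one, Real.rpow_natCast]
    rw [neg_mul]
    ring
  have he' : Set.EqOn (fun x : ℝ => x ^ ((k : ℝ) + 1 - 1) * Real.exp (-(a * x)) * (k.factorial : ℝ)⁻¹)
      (fun t => Real.exp (-(a * t)) * (t ^ k / k.factorial)) (Set.Ioi 0) := by
    intro t _
    simp only [add_sub_cancel_right, Real.rpow_natCast]
    ring
  constructor
  · rw [integrable_indicator_iff measurableSet_Ici, integrableOn_Ici_iff_integrableOn_Ioi]
    exact IntegrableOn.congr_fun (h1.mul_const _) he measurableSet_Ioi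
  · rw [integral_indicator measurableSet_Ici, integral_Ici_eq_integral_Ioi,
      ← setIntegral_congr_fun measurableSet_Ioi he', integral_mul_const, h2, Real.Gamma_nat_eq_factorial]
    have : (k.factorial : ℝ) ≠ 0 := by positivity
    rw [mul_assoc, mul_inv_cancel₀ this, mul_one, one_div, Real.inv_rpow ha.le]
    norm_cast

section Laplace

variable [FiniteDimensional ℝ V] [MeasurableSpace V] [BorelSpace V]

/-- In the coordinates of `b` the integrand is a product of functions of one variable, and Fubini
reduces the integral to Gamma integrals. The volume factor compares `μ` with the Haar measure
normalised by `b`; the factorials in `conePoly` remove the Gamma values. -/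
theorem laplace_coneFun (μ : Measure V) [μ.IsAddHaarMeasure] {r : ℕ}
    (b : Module.Basis (Fin r) ℝ V) (m : Fin r → ℕ) {y : StrongDual ℝ V}
    (hy : ∀ i, 0 < y (b i)) :
    Integrable (fun h => Real.exp (-y h) * coneFun b m h) μ ∧
    ∫ h, Real.exp (-y h) * coneFun b m h ∂μ =
      (μ (parallelepiped b)).toReal * (∏ i, y (b i) ^ (m i + 1))⁻¹ := by
  have hμ : μ = μ (parallelepiped b) • b.addHaar := by
    have := Measure.addHaarMeasure_unique μ b.parallelepiped
    rwa [Module.Basis.coe_parallelepiped, ← Module.Basis.addHaar] at this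
  let g : Fin r → ℝ → ℝ := fun i => (Set.Ici (0 : ℝ)).indicator
    fun t => Real.exp (-(y (b i) * t)) * (t ^ m i / (m i).factorial)
  let e : V ≃L[ℝ] (Fin r → ℝ) := b.equivFun.toContinuousLinearEquiv
  have hmap : Measure.map e b.addHaar = volume := by
    have h1 := Module.Basis.map_addHaar b e
    have h2 : b.map e.toLinearEquiv = Pi.basisFun ℝ (Fin r) := by
      refine Module.Basis.eq_of_apply_eq fun i => ?_
      ext j
      simp [e, Pi.single_apply, eq_comm]
    rw [h1, h2, Module.Basis.addHaar, Module.Basis.parallelepiped_basisFun]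
    exact addHaarMeasure_eq_volume_pi (Fin r)
  have hmp : MeasurePreserving e b.addHaar volume := ⟨e.continuous.measurable, hmap⟩
  have hemb : MeasurableEmbedding e := e.toHomeomorph.measurableEmbedding
  have heq : (fun h => Real.exp (-y h) * coneFun b m h) = (fun x => ∏ i, g i (x i)) ∘ e := by
    funext h
    have hyh : y h = ∑ i, y (b i) * b.repr h i := by
      conv_lhs => rw [← b.sum_repr h]
      rw [map_sum]
      refine Finset.sum_congr rfl fun i _ => ?_
      rw [map_smul, smul_eq_mul, mul_comm]
    simp only [Function.comp, g, e]
    by_cases hh : ∀ i, 0 ≤ b.repr h i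
    · rw [coneFun, if_pos hh, hyh, ← Finset.sum_neg_distrib, Real.exp_sum, conePoly,
        ← Finset.prod_mul_distrib]
      refine Finset.prod_congr rfl fun i _ => ?_
      have : b.equivFun.toContinuousLinearEquiv h i ∈ Set.Ici (0 : ℝ) := hh i
      rw [Set.indicator_of_mem this]
      rfl
    · rw [coneFun, if_neg hh, mul_zero]
      push Not at hh
      obtain ⟨i, hi⟩ := hh
      refine (Finset.prod_eq_zero (Finset.mem_univ i) ?_).symm
      have : b.equivFun.toContinuousLinearEquiv h i ∉ Set.Ici (0 : ℝ) := not_le.2 hi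
      rw [Set.indicator_of_notMem this]
  have hint : Integrable (fun x : Fin r → ℝ => ∏ i, g i (x i)) :=
    Integrable.fintype_prod_dep fun i => (laplace_monomial_Ici (hy i) (m i)).1
  have hval : ∫ x : Fin r → ℝ, ∏ i, g i (x i) = (∏ i, y (b i) ^ (m i + 1))⁻¹ := by
    rw [integral_fintype_prod_volume_eq_prod, ← Finset.prod_inv_distrib]
    exact Finset.prod_congr rfl fun i _ => (laplace_monomial_Ici (hy i) (m i)).2
  have hfin : μ (parallelepiped b) ≠ ⊤ := by
    rw [← Module.Basis.coe_parallelepiped]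
    exact (b.parallelepiped.isCompact.measure_lt_top).ne
  rw [heq]
  constructor
  · rw [hμ]
    exact ((hmp.integrable_comp_emb hemb).2 hint).smul_measure hfin
  · conv_lhs => rw [hμ]
    rw [integral_smul_measure, smul_eq_mul, ← hval]
    congr 1
    exact hmp.integral_comp hemb (fun x => ∏ i, g i (x i))

end Laplace

/-- `G_Δ` is spanned by the simple fractions of bases which are positive on a given chamber. -/
theorem simpleG_le_span_pos {Δ : Set V} (hsymm : ∀ α ∈ Δ, -α ∈ Δ) {δ : Set (StrongDual ℝ V)}
    (hδ : IsComponent (dualReg Δ) δ) (r : ℕ) :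
    simpleG Δ r ≤ Submodule.span ℝ {φ | ∃ (b : Module.Basis (Fin r) ℝ V) (m : Fin r → ℕ),
      (∀ i, b i ∈ Δ) ∧ (∀ i, ∀ y ∈ δ, 0 < y (b i)) ∧
      φ = fun y : dualReg Δ => (∏ i, y.1 (b i) ^ (m i + 1))⁻¹} := by
  refine Submodule.span_le.2 ?_
  rintro _ ⟨b, m, hb, rfl⟩
  -- Regularity and connectedness of δ give each `b i` a constant sign there; by symmetry of Δ the
  -- vector may be replaced by its negative.
  have hsign : ∀ i, ∃ ε : ℝˣ, (ε : ℝ) • b i ∈ Δ ∧ ∀ y ∈ δ, 0 < y ((ε : ℝ) • b i) := by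
    intro i
    rcases pos_or_neg_of_isPreconnected hδ.isPreconnected (f := fun y : StrongDual ℝ V => y (b i))
      (by fun_prop) (fun y hy => hδ.subset hy _ (hb i)) with h | h
    · exact ⟨1, by simpa using hb i, by simpa using h⟩
    · exact ⟨-1, by simpa using hsymm _ (hb i), by simpa using h⟩
  choose ε hε hεpos using hsign
  have hb' : ∀ i, b.unitsSMul ε i = (ε i : ℝ) • b i := fun i => by
    rw [Module.Basis.unitsSMul_apply]; rfl
  have key : (fun y : dualReg Δ => (∏ i, y.1 (b i) ^ (m i + 1))⁻¹) =
      (∏ i, (ε i : ℝ) ^ (m i + 1)) • fun y : dualReg Δ =>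
        (∏ i, y.1 (b.unitsSMul ε i) ^ (m i + 1))⁻¹ := by
    funext y
    simp only [hb', map_smul, smul_eq_mul, mul_pow, Finset.prod_mul_distrib, Pi.smul_apply]
    rw [mul_inv, ← mul_assoc, mul_inv_cancel₀, one_mul]
    exact Finset.prod_ne_zero_iff.2 fun i _ => pow_ne_zero _ (ε i).ne_zero
  rw [key]
  refine Submodule.smul_mem _ _ (Submodule.subset_span ⟨b.unitsSMul ε, m, ?_, ?_, rfl⟩)
  · intro i; rw [hb']; exact hε i
  · intro i; rw [hb']; exact hεpos i

theorem extend_add {X : Type*} {S : Set X} (f g : S → ℝ) (x : X) :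
    Function.extend Subtype.val (f + g) 0 x =
      Function.extend Subtype.val f 0 x + Function.extend Subtype.val g 0 x := by
  have := congrFun (Function.extend_add (Subtype.val : S → X) f g 0 0) x
  simpa using this

theorem extend_smul {X : Type*} {S : Set X} (c : ℝ) (f : S → ℝ) (x : X) :
    Function.extend Subtype.val (c • f) 0 x = c * Function.extend Subtype.val f 0 x := by
  have := congrFun (Function.extend_smul c (Subtype.val : S → X) f 0) x
  simpa using this

theorem extend_zero {X : Type*} {S : Set X} (x : X) :
    Function.extend (Subtype.val : S → X) (0 : S → ℝ) 0 x = 0 := by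
  classical
  rw [Function.extend_def]
  split_ifs <;> rfl

theorem extend_of_mem {X : Type*} {S : Set X} (f : S → ℝ) {x : X} (hx : x ∈ S) :
    Function.extend Subtype.val f 0 x = f ⟨x, hx⟩ :=
  Subtype.val_injective.extend_apply f 0 ⟨x, hx⟩

/-! ### Scalar Laplace transforms and the directness of G + NG -/

section Laplace

variable [MeasurableSpace V]

/-- `∫ e^{-⟨y,h⟩} f(h) dμ(h)` converges and equals `g(y)` for all `y ∈ δ`. -/
def HasScalarLaplace (μ : Measure V) {Δ : Set V} (δ : Set (StrongDual ℝ V))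
    (f : reg Δ → ℝ) (g : dualReg Δ → ℝ) : Prop :=
  ∀ y : dualReg Δ, y.1 ∈ δ →
    Integrable (fun h => Real.exp (-y.1 h) * Function.extend Subtype.val f 0 h) μ ∧
    ∫ h, Real.exp (-y.1 h) * Function.extend Subtype.val f 0 h ∂μ = g y

theorem HasScalarLaplace.zero (μ : Measure V) {Δ : Set V} (δ : Set (StrongDual ℝ V)) :
    HasScalarLaplace μ δ (0 : reg Δ → ℝ) 0 := by
  intro y _
  simp [extend_zero]

theorem HasScalarLaplace.add {μ : Measure V} {Δ : Set V} {δ : Set (StrongDual ℝ V)}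
    {f f' : reg Δ → ℝ} {g g' : dualReg Δ → ℝ} (h : HasScalarLaplace μ δ f g)
    (h' : HasScalarLaplace μ δ f' g') : HasScalarLaplace μ δ (f + f') (g + g') := by
  intro y hy
  simp only [extend_add, mul_add]
  exact ⟨(h y hy).1.add (h' y hy).1,
    by rw [integral_add (h y hy).1 (h' y hy).1, (h y hy).2, (h' y hy).2]; rfl⟩

theorem HasScalarLaplace.smul {μ : Measure V} {Δ : Set V} {δ : Set (StrongDual ℝ V)}
    {f : reg Δ → ℝ} {g : dualReg Δ → ℝ} (h : HasScalarLaplace μ δ f g) (c : ℝ) :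
    HasScalarLaplace μ δ (c • f) (c • g) := by
  intro y hy
  simp only [extend_smul, mul_left_comm _ c]
  exact ⟨(h y hy).1.const_mul c, by rw [integral_const_mul, (h y hy).2]; rfl⟩

theorem toReal_parallelepiped_pos (μ : Measure V) [μ.IsAddHaarMeasure] {r : ℕ}
    (b : Module.Basis (Fin r) ℝ V) : 0 < (μ (parallelepiped b)).toReal := by
  rw [← Module.Basis.coe_parallelepiped]
  refine ENNReal.toReal_pos ?_ (b.parallelepiped.isCompact.measure_lt_top).ne
  exact (Measure.measure_pos_of_nonempty_interior μ b.parallelepiped.interior_nonempty).ne'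

variable [FiniteDimensional ℝ V] [BorelSpace V]

/-- The walls have measure zero, so the value 0 given there by `Function.extend` does not affect
integrals. -/
theorem extend_ae_eq (μ : Measure V) [μ.IsAddHaarMeasure] {Δ : Set V} (hfin : Δ.Finite)
    (F : V → ℝ) : Function.extend Subtype.val (fun h : reg Δ => F h.1) 0 =ᵐ[μ] F := by
  have h0 : ∀ᵐ h ∂μ, h ∈ reg Δ := by
    rw [ae_iff]; exact measure_compl_reg μ hfin
  filter_upwards [h0] with h hh
  rw [extend_of_mem _ hh]

theorem hasScalarLaplace_coneFun (μ : Measure V) [μ.IsAddHaarMeasure] {Δ : Set V}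
    (hfin : Δ.Finite) {δ : Set (StrongDual ℝ V)} {r : ℕ} (b : Module.Basis (Fin r) ℝ V)
    (hpos : ∀ i, ∀ y ∈ δ, 0 < y (b i)) (m : Fin r → ℕ) :
    HasScalarLaplace μ δ (fun h : reg Δ => coneFun b m h.1)
      ((μ (parallelepiped b)).toReal • fun y => (∏ i, y.1 (b i) ^ (m i + 1))⁻¹) := by
  intro y hy
  have h1 := laplace_coneFun μ b m fun i => hpos i y.1 hy
  have h2 : (fun h => Real.exp (-y.1 h) *
      Function.extend Subtype.val (fun h : reg Δ => coneFun b m h.1) 0 h) =ᵐ[μ]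
      fun h => Real.exp (-y.1 h) * coneFun b m h := by
    filter_upwards [extend_ae_eq μ hfin (coneFun b m)] with h hh
    rw [hh]
  exact ⟨h1.1.congr h2.symm, by rw [integral_congr_ae h2, h1.2]; rfl⟩

theorem exists_hasScalarLaplace (μ : Measure V) [μ.IsAddHaarMeasure] {Δ : Set V}
    (hfin : Δ.Finite) (hsymm : ∀ α ∈ Δ, -α ∈ Δ) {δ : Set (StrongDual ℝ V)}
    (hδ : IsComponent (dualReg Δ) δ) {r : ℕ} {g : dualReg Δ → ℝ} (hg : g ∈ simpleG Δ r) :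
    ∃ f ∈ locPolyCone Δ δ, HasScalarLaplace μ δ f g := by
  have hg' := simpleG_le_span_pos hsymm hδ r hg
  clear hg
  induction hg' using Submodule.span_induction with
  | zero => exact ⟨0, Submodule.zero_mem _, HasScalarLaplace.zero μ δ⟩
  | add g g' _ _ h h' =>
    obtain ⟨f, hf, hL⟩ := h
    obtain ⟨f', hf', hL'⟩ := h'
    exact ⟨f + f', Submodule.add_mem _ hf hf', hL.add hL'⟩
  | smul c g _ h =>
    obtain ⟨f, hf, hL⟩ := h
    exact ⟨c • f, Submodule.smul_mem _ c hf, hL.smul c⟩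
  | mem g hg =>
    obtain ⟨b, m, hb, hpos, rfl⟩ := hg
    refine ⟨((μ (parallelepiped b)).toReal)⁻¹ • _,
      Submodule.smul_mem _ _ (coneFun_mem_locPolyCone b hb hpos m), ?_⟩
    have := (hasScalarLaplace_coneFun μ hfin b hpos m).smul ((μ (parallelepiped b)).toReal)⁻¹
    rwa [smul_smul, inv_mul_cancel₀ (toReal_parallelepiped_pos μ b).ne', one_smul] at this

/-- The sum `G_Δ + NG_Δ` is direct. -/
theorem eq_zero_of_mem_G_of_mem_NG {Δ : Set V} (hfin : Δ.Finite) (hsymm : ∀ α ∈ Δ, -α ∈ Δ)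
    {g : dualReg Δ → ℝ} (hg : g ∈ G Δ) (hg' : g ∈ NG Δ) : g = 0 := by
  funext y
  let μ : Measure V := Measure.addHaar
  have hδ : IsComponent (dualReg Δ) (connectedComponentIn (dualReg Δ) y.1) := ⟨y.1, y.2, rfl⟩
  have hyδ : y.1 ∈ connectedComponentIn (dualReg Δ) y.1 := mem_connectedComponentIn y.2
  -- On the chamber of `y`, membership in G makes `g` a Laplace transform, while membership in NG
  -- makes it annihilated by differences. Hence `f` vanishes almost everywhere, and so does the
  -- integral giving `g y`.
  obtain ⟨f, -, hL⟩ := exists_hasScalarLaplace μ hfin hsymm hδ (G_le_simpleG rfl hg)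
  obtain ⟨ν, l, hl, hν, hgν⟩ := exists_isAnnihilated_of_mem_NG hg'
  have hO := (hδ.isOpen (isOpen_dualReg hfin)).mem_nhds hyδ
  have h0 : Function.extend Subtype.val f 0 =ᵐ[μ] 0 := by
    refine ae_eq_zero_of_laplace_isAnnihilated hO hl hν fun y' hy' => ?_
    have := hL ⟨y', hδ.subset hy'⟩ hy'
    rwa [hgν] at this
  rw [← (hL y hyδ).2]
  have : (fun h => Real.exp (-y.1 h) * Function.extend Subtype.val f 0 h) =ᵐ[μ] 0 := by
    filter_upwards [h0] with h hh
    simp [hh]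
  rw [integral_congr_ae this]
  simp

/-- Injectivity gives vanishing almost everywhere only. Since the function is a continuous
polynomial on each open chamber, it then vanishes at every regular point. -/
theorem eq_zero_of_hasScalarLaplace_zero {μ : Measure V} [μ.IsAddHaarMeasure] {Δ : Set V}
    (hfin : Δ.Finite) {δ : Set (StrongDual ℝ V)} (hδ : IsComponent (dualReg Δ) δ)
    {f : reg Δ → ℝ} (hf : f ∈ locPolyCone Δ δ) (hL : HasScalarLaplace μ δ f 0) : f = 0 := by
  obtain ⟨y, hy⟩ := hδ.nonempty
  have h0 : Function.extend Subtype.val f 0 =ᵐ[μ] 0 :=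
    ae_eq_zero_of_laplace_eq_zero ((hδ.isOpen (isOpen_dualReg hfin)).mem_nhds hy)
      fun y' hy' => hL ⟨y', hδ.subset hy'⟩ hy'
  funext h
  have hU : IsComponent (reg Δ) (connectedComponentIn (reg Δ) h.1) := ⟨h.1, h.2, rfl⟩
  obtain ⟨p, hp, hfp⟩ := locPolyCone_subset_locPoly hf _ hU
  have hUo := hU.isOpen (isOpen_reg hfin)
  have hhU : h.1 ∈ connectedComponentIn (reg Δ) h.1 := mem_connectedComponentIn h.2
  rw [hfp h hhU]
  by_contra hne
  have hopen : IsOpen (connectedComponentIn (reg Δ) h.1 ∩ {x | p x ≠ 0}) :=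
    hUo.inter (isOpen_ne_fun (continuous_of_mem_sym hp) continuous_const)
  refine (hopen.measure_pos μ ⟨h.1, hhU, hne⟩).ne' ?_
  refine measure_mono_null ?_ (ae_iff.1 h0)
  rintro x ⟨hxU, hx⟩
  simp only [Set.mem_ofPred_eq, Pi.zero_apply]
  rw [extend_of_mem _ (hU.subset hxU), hfp ⟨x, hU.subset hxU⟩ hxU]
  exact hx

end Laplace

end

end HyperplaneLaplace

namespace HyperplaneLaplace

noncomputable section

/-! ### Residues at infinity of functions of one variable -/

section OneVariable

open Polynomial Bornology

theorem tendsto_add_const_cobounded_real (s : ℝ) :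
    Tendsto (fun t : ℝ => t + s) (cobounded ℝ) (cobounded ℝ) := by
  rw [← tendsto_norm_atTop_iff_cobounded]
  have h : Tendsto (fun t : ℝ => ‖t‖ - ‖s‖) (cobounded ℝ) atTop :=
    tendsto_atTop_add_const_right _ _ tendsto_norm_cobounded_atTop
  refine tendsto_atTop_mono (fun t => ?_) h
  have := norm_sub_norm_le t (-s)
  rwa [norm_neg, sub_neg_eq_add] at this

theorem tendsto_const_mul_cobounded_real {c : ℝ} (hc : c ≠ 0) :
    Tendsto (fun t : ℝ => c * t) (cobounded ℝ) (cobounded ℝ) := by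
  rw [← tendsto_norm_atTop_iff_cobounded]
  simp only [norm_mul]
  exact tendsto_norm_cobounded_atTop.const_mul_atTop (norm_pos_iff.2 hc)

theorem eventually_eval_ne_zero {D : ℝ[X]} (hD : D ≠ 0) :
    ∀ᶠ t in cobounded ℝ, D.eval t ≠ 0 :=
  (eventually_cofinite_not_isRoot hD).filter_mono (Bornology.le_cofinite ℝ)

/-- Substitute t⁻¹ for t: the reflected polynomials are continuous at 0, where their values are the
coefficients of degree `M`. -/
theorem tendsto_eval_div_eval {A B : ℝ[X]} {M : ℕ} (hA : A.natDegree ≤ M) (hB : B.natDegree ≤ M)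
    (h0 : B.coeff M ≠ 0) :
    Tendsto (fun t => A.eval t / B.eval t) (cobounded ℝ) (𝓝 (A.coeff M / B.coeff M)) := by
  have hlim : ∀ P : ℝ[X], Tendsto (fun t : ℝ => (P.reflect M).eval t⁻¹) (cobounded ℝ)
      (𝓝 (P.coeff M)) := by
    intro P
    have h1 : Tendsto (fun t : ℝ => (P.reflect M).eval t) (𝓝 0) (𝓝 ((P.reflect M).eval 0)) :=
      (P.reflect M).continuous.tendsto 0
    rw [← coeff_zero_eq_eval_zero, coeff_reflect, revAt_zero] at h1
    exact h1.comp tendsto_inv₀_cobounded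
  refine ((hlim A).div (hlim B) h0).congr' ?_
  filter_upwards [eventually_ne_cobounded (0 : ℝ)] with t ht
  have hrefl : ∀ P : ℝ[X], P.natDegree ≤ M → P.eval t = (P.reflect M).eval t⁻¹ * t ^ M := by
    intro P hP
    have : Invertible t := invertibleOfNonzero ht
    have := eval₂_reflect_mul_pow (RingHom.id ℝ) t M P hP
    rw [invOf_eq_inv] at this
    exact this.symm
  rw [Pi.div_apply, hrefl A hA, hrefl B hB, mul_div_mul_right _ _ (pow_ne_zero M ht)]

theorem HasResidueAtInfinity.congr' {f g : ℝ → ℝ} {ρ : ℝ} (h : HasResidueAtInfinity f ρ)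
    (hfg : f =ᶠ[cobounded ℝ] g) : HasResidueAtInfinity g ρ := by
  obtain ⟨p, hp⟩ := h
  refine ⟨p, hp.congr' ?_⟩
  filter_upwards [hfg] with t ht
  rw [ht]

/-- Two polynomial parts `p`, `q` would make X(q - p) converge at infinity, which forces q = p. -/
theorem HasResidueAtInfinity.unique {f : ℝ → ℝ} {ρ ρ' : ℝ} (h : HasResidueAtInfinity f ρ)
    (h' : HasResidueAtInfinity f ρ') : ρ = ρ' := by
  obtain ⟨p, hp⟩ := h
  obtain ⟨q, hq⟩ := h'
  have h1 := (hp.sub hq).mono_left (IsOrderBornology.atTop_le_cobounded (α := ℝ))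
  have h2 : (fun t : ℝ => t * (f t - p.eval t) - t * (f t - q.eval t)) =
      fun t => (X * (q - p)).eval t := by
    funext t; simp; ring
  rw [h2] at h1
  have h3 := (tendsto_nhds_iff _).1 h1
  have h4 : q - p = 0 := by
    by_contra hne
    have := h3.2
    rw [degree_mul, degree_X, degree_eq_natDegree hne] at this
    norm_cast at this
    omega
  rw [h4] at h3
  have := h3.1
  simp at this
  linarith

theorem HasResidueAtInfinity.zero : HasResidueAtInfinity (fun _ => 0) 0 :=
  ⟨0, by simp⟩

theorem HasResidueAtInfinity.add {f f' : ℝ → ℝ} {ρ ρ' : ℝ} (h : HasResidueAtInfinity f ρ)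
    (h' : HasResidueAtInfinity f' ρ') : HasResidueAtInfinity (fun t => f t + f' t) (ρ + ρ') := by
  obtain ⟨p, hp⟩ := h
  obtain ⟨q, hq⟩ := h'
  refine ⟨p + q, ?_⟩
  rw [neg_add]
  refine (hp.add hq).congr fun t => ?_
  rw [eval_add]; ring

theorem HasResidueAtInfinity.const_mul {f : ℝ → ℝ} {ρ : ℝ} (h : HasResidueAtInfinity f ρ)
    (c : ℝ) : HasResidueAtInfinity (fun t => c * f t) (c * ρ) := by
  obtain ⟨p, hp⟩ := h
  refine ⟨C c * p, ?_⟩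
  rw [← mul_neg]
  refine (hp.const_mul c).congr fun t => ?_
  rw [eval_mul, eval_C]; ring

/-- Translation invariance is why the residue along `z₀` depends only on the restriction of a
functional to V₀: two extensions differ by a multiple of `z₀`. -/
theorem HasResidueAtInfinity.comp_add {f : ℝ → ℝ} {ρ : ℝ} (h : HasResidueAtInfinity f ρ)
    (s : ℝ) : HasResidueAtInfinity (fun t => f (t + s)) ρ := by
  obtain ⟨p, hp⟩ := h
  refine ⟨p.comp (X + C s), ?_⟩
  have h1 := hp.comp (tendsto_add_const_cobounded_real s)
  have h2 : Tendsto (fun t : ℝ => (X : ℝ[X]).eval t / (X + C s).eval t) (cobounded ℝ) (𝓝 1) := by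
    have := tendsto_eval_div_eval (A := X) (B := X + C s) (M := 1) natDegree_X_le
      (natDegree_X_add_C s).le (by simp)
    simpa using this
  have h3 := h2.mul h1
  rw [one_mul] at h3
  refine h3.congr' ?_
  filter_upwards [eventually_ne_cobounded (-s)] with t ht
  have : t + s ≠ 0 := fun h => ht (by linarith)
  simp only [Function.comp, eval_X, eval_add, eval_C, eval_comp]
  field_simp

/-- The factor c⁻¹ comes from `dt`; it is the source of the degree shift by one under the residue.
-/
theorem HasResidueAtInfinity.comp_mul {f : ℝ → ℝ} {ρ c : ℝ} (h : HasResidueAtInfinity f ρ)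
    (hc : c ≠ 0) : HasResidueAtInfinity (fun t => f (c * t)) (c⁻¹ * ρ) := by
  obtain ⟨p, hp⟩ := h
  refine ⟨p.comp (C c * X), ?_⟩
  have h1 := (hp.comp (tendsto_const_mul_cobounded_real hc)).const_mul c⁻¹
  rw [← mul_neg]
  refine h1.congr fun t => ?_
  simp only [Function.comp, eval_X, eval_mul, eval_C, eval_comp]
  field_simp

/-- Euclidean division separates the polynomial part `N /ₘ D`; the remainder over `D` behaves like
its coefficient of degree deg D - 1 divided by t. -/
theorem hasResidueAtInfinity_div {N D : ℝ[X]} (hD : D.Monic) :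
    HasResidueAtInfinity (fun t => N.eval t / D.eval t) (-(N %ₘ D).coeff (D.natDegree - 1)) := by
  refine ⟨N /ₘ D, ?_⟩
  rw [neg_neg]
  set R := N %ₘ D
  have hR : R.degree < D.degree := degree_modByMonic_lt N hD
  have hXR : (X * R).natDegree ≤ D.natDegree := by
    by_cases hR0 : R = 0
    · simp [hR0]
    · rw [natDegree_X_mul hR0]
      exact natDegree_lt_natDegree hR0 hR
  have hcoeff : (X * R).coeff D.natDegree / D.coeff D.natDegree = R.coeff (D.natDegree - 1) := by
    rw [hD.coeff_natDegree, div_one]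
    -- In degree 0 the truncated subtraction gives index 0, which is harmless: then D = 1 and the
    -- remainder is 0.
    rcases Nat.eq_zero_or_pos D.natDegree with h | h
    · have : R = 0 := by
        rw [Polynomial.Monic.natDegree_eq_zero hD] at h
        simp [R, h]
      simp [this]
    · obtain ⟨k, hk⟩ := Nat.exists_eq_add_of_lt h
      rw [hk]
      simp
  have h1 := tendsto_eval_div_eval hXR le_rfl (by rw [hD.coeff_natDegree]; exact one_ne_zero)
  rw [hcoeff] at h1
  refine h1.congr' ?_
  filter_upwards [eventually_eval_ne_zero hD.ne_zero] with t ht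
  have h2 : N.eval t = R.eval t + D.eval t * (N /ₘ D).eval t := by
    conv_lhs => rw [← modByMonic_add_div N D]
    simp [R]
  rw [h2, eval_mul, eval_X]
  field_simp
  ring

/-- The coefficient of `X` in degree `D.natDegree` encodes that only a denominator of degree 1 has a
nonzero residue. -/
theorem hasResidueAtInfinity_inv {D : ℝ[X]} (hD : 1 ≤ D.natDegree) :
    HasResidueAtInfinity (fun t => (D.eval t)⁻¹)
      (-((X : ℝ[X]).coeff D.natDegree / D.leadingCoeff)) := by
  refine ⟨0, ?_⟩
  rw [neg_neg]
  have hD0 : D ≠ 0 := by rintro rfl; simp at hD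
  have h1 := tendsto_eval_div_eval (A := X) (natDegree_X_le.trans hD) le_rfl
    (leadingCoeff_ne_zero.2 hD0)
  refine h1.congr fun t => ?_
  rw [eval_zero, sub_zero, eval_X, div_eq_mul_inv]

end OneVariable

end

end HyperplaneLaplace

namespace HyperplaneLaplace

noncomputable section

variable {V : Type*} [NormedAddCommGroup V] [NormedSpace ℝ V]

/-! ### Residues along a hyperplane -/

/-- An element of Δ in V₀ is constant and nonzero along the line, and any other one vanishes for a
single value of t. -/
theorem eventually_mem_dualReg {Δ : Set V} (hfin : Δ.Finite) {V₀ : Submodule ℝ V}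
    {z₀ : StrongDual ℝ V} (hz₀ : LinearMap.ker (z₀ : V →ₗ[ℝ] ℝ) = V₀) {z : StrongDual ℝ V}
    (hz : z.comp V₀.subtypeL ∈ dualReg (restrictSystem Δ V₀)) :
    ∀ᶠ t in Bornology.cobounded ℝ, z + t • z₀ ∈ dualReg Δ := by
  have : ∀ α ∈ Δ, ∀ᶠ t in Bornology.cobounded ℝ, (z + t • z₀) α ≠ 0 := by
    intro α hα
    by_cases h : α ∈ V₀
    · have hzα : z α ≠ 0 := hz ⟨α, h⟩ hα
      have h0 : z₀ α = 0 := by rw [← hz₀] at h; exact h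
      exact Eventually.of_forall fun t => by simpa [h0] using hzα
    · have h0 : z₀ α ≠ 0 := fun h0 => h (by rw [← hz₀]; exact h0)
      filter_upwards [Bornology.eventually_ne_cobounded (-(z α) / z₀ α)] with t ht h1
      refine ht ?_
      rw [eq_div_iff h0]
      simp at h1
      linarith
  exact (Filter.eventually_all_finite hfin).2 this

theorem IsHyperplaneResidue.unique [FiniteDimensional ℝ V] {Δ : Set V} {V₀ : Submodule ℝ V}
    {z₀ : StrongDual ℝ V} {φ : dualReg Δ → ℝ} {ψ ψ' : dualReg (restrictSystem Δ V₀) → ℝ}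
    (h : IsHyperplaneResidue V₀ z₀ φ ψ) (h' : IsHyperplaneResidue V₀ z₀ φ ψ') : ψ = ψ' := by
  funext y
  obtain ⟨g, hg, -⟩ := exists_extension_norm_eq V₀ y.1
  have hgy : g.comp V₀.subtypeL = y.1 := by ext x; exact hg x
  have hmem : g.comp V₀.subtypeL ∈ dualReg (restrictSystem Δ V₀) := by rw [hgy]; exact y.2
  have := (h g hmem).unique (h' g hmem)
  have hy : (⟨g.comp V₀.subtypeL, hmem⟩ : dualReg (restrictSystem Δ V₀)) = y := Subtype.ext hgy
  rw [hy] at this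
  linarith

theorem IsHyperplaneResidue.zero {Δ : Set V} (V₀ : Submodule ℝ V) (z₀ : StrongDual ℝ V) :
    IsHyperplaneResidue V₀ z₀ (0 : dualReg Δ → ℝ) 0 := by
  intro z hz
  simpa [extend_zero] using HasResidueAtInfinity.zero

theorem IsHyperplaneResidue.add {Δ : Set V} {V₀ : Submodule ℝ V} {z₀ : StrongDual ℝ V}
    {φ φ' : dualReg Δ → ℝ} {ψ ψ' : dualReg (restrictSystem Δ V₀) → ℝ}
    (h : IsHyperplaneResidue V₀ z₀ φ ψ) (h' : IsHyperplaneResidue V₀ z₀ φ' ψ') :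
    IsHyperplaneResidue V₀ z₀ (φ + φ') (ψ + ψ') := by
  intro z hz
  have := (h z hz).add (h' z hz)
  simpa only [extend_add, Pi.add_apply, neg_add] using this

theorem IsHyperplaneResidue.smul {Δ : Set V} {V₀ : Submodule ℝ V} {z₀ : StrongDual ℝ V}
    {φ : dualReg Δ → ℝ} {ψ : dualReg (restrictSystem Δ V₀) → ℝ}
    (h : IsHyperplaneResidue V₀ z₀ φ ψ) (c : ℝ) :
    IsHyperplaneResidue V₀ z₀ (c • φ) (c • ψ) := by
  intro z hz
  have := (h z hz).const_mul c
  simpa only [extend_smul, Pi.smul_apply, smul_eq_mul, mul_neg] using this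

theorem IsHyperplaneResidue.sum {ι : Type*} {Δ : Set V} {V₀ : Submodule ℝ V}
    {z₀ : StrongDual ℝ V} (s : Finset ι) {φ : ι → dualReg Δ → ℝ}
    {ψ : ι → dualReg (restrictSystem Δ V₀) → ℝ}
    (h : ∀ i ∈ s, IsHyperplaneResidue V₀ z₀ (φ i) (ψ i)) :
    IsHyperplaneResidue V₀ z₀ (∑ i ∈ s, φ i) (∑ i ∈ s, ψ i) := by
  classical
  induction s using Finset.induction_on with
  | empty => exact IsHyperplaneResidue.zero V₀ z₀
  | insert a s ha ih =>
    rw [Finset.sum_insert ha, Finset.sum_insert ha]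
    exact (h a (Finset.mem_insert_self a s)).add
      (ih fun i hi => h i (Finset.mem_insert_of_mem hi))

/-- It suffices to compute the residue at one preimage of each point of `V₀*`. -/
theorem isHyperplaneResidue_of_section {Δ : Set V} {V₀ : Submodule ℝ V}
    {z₀ : StrongDual ℝ V} (hz₀ : LinearMap.ker (z₀ : V →ₗ[ℝ] ℝ) = V₀)
    {φ : dualReg Δ → ℝ} {ψ : dualReg (restrictSystem Δ V₀) → ℝ} (P : V →L[ℝ] V₀)
    (hP : ∀ v : V₀, P v = v)
    (h : ∀ y : dualReg (restrictSystem Δ V₀), HasResidueAtInfinity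
      (fun t => Function.extend Subtype.val φ 0 (y.1.comp P + t • z₀)) (-ψ y)) :
    IsHyperplaneResidue V₀ z₀ φ ψ := by
  intro z hz
  -- Two functionals with the same restriction to V₀ differ by a multiple of `z₀`, which a shift of
  -- t absorbs.
  obtain ⟨c, hc⟩ : ∃ c : ℝ, z = (z.comp V₀.subtypeL).comp P + c • z₀ := by
    have hle : LinearMap.ker (z₀ : V →ₗ[ℝ] ℝ) ≤
        LinearMap.ker ((z - (z.comp V₀.subtypeL).comp P : StrongDual ℝ V) : V →ₗ[ℝ] ℝ) := by
      rw [hz₀]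
      intro v hv
      have := hP ⟨v, hv⟩
      simp only at this
      simp [this]
    by_cases htop : ∃ v, z₀ v ≠ 0
    · obtain ⟨v, hv⟩ := htop
      refine ⟨(z - (z.comp V₀.subtypeL).comp P) v / z₀ v, ?_⟩
      ext x
      have hx : x - (z₀ x / z₀ v) • v ∈ LinearMap.ker (z₀ : V →ₗ[ℝ] ℝ) := by
        rw [LinearMap.mem_ker]
        simp [hv]
      have := hle hx
      rw [LinearMap.mem_ker] at this
      change (z - (z.comp V₀.subtypeL).comp P) (x - (z₀ x / z₀ v) • v) = 0 at this
      rw [map_sub, map_smul, smul_eq_mul, sub_eq_zero] at this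
      change z x - (z.comp V₀.subtypeL).comp P x = _ at this
      change z x = (z.comp V₀.subtypeL).comp P x +
        (z - (z.comp V₀.subtypeL).comp P) v / z₀ v * z₀ x
      rw [sub_eq_iff_eq_add] at this
      rw [this]
      ring
    · push Not at htop
      refine ⟨0, ?_⟩
      ext x
      have : x ∈ LinearMap.ker (z₀ : V →ₗ[ℝ] ℝ) := htop x
      have := hle this
      rw [LinearMap.mem_ker] at this
      change z x - (z.comp V₀.subtypeL).comp P x = 0 at this
      simpa [sub_eq_zero] using this
  have h1 := (h ⟨_, hz⟩).comp_add c
  refine h1.congr' (Eventually.of_forall fun t => ?_)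
  conv_rhs => rw [hc]
  dsimp only
  rw [add_smul, add_comm (t • z₀), add_assoc]

theorem exists_projection [FiniteDimensional ℝ V] (V₀ : Submodule ℝ V) :
    ∃ P : V →L[ℝ] V₀, ∀ v : V₀, P v = v := by
  obtain ⟨P, hP⟩ := LinearMap.exists_leftInverse_of_injective V₀.subtype V₀.ker_subtype
  exact ⟨LinearMap.toContinuousLinearMap P, fun v => LinearMap.congr_fun hP v⟩

theorem comp_mem_symDual {V₀ : Submodule ℝ V} (P : V →L[ℝ] V₀) {ψ : StrongDual ℝ V → ℝ}
    (hψ : ψ ∈ symDual V) : (fun y : StrongDual ℝ V₀ => ψ (y.comp P)) ∈ symDual V₀ := by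
  induction hψ using Algebra.adjoin_induction with
  | mem f hf =>
    obtain ⟨v, rfl⟩ := hf
    exact apply_mem_symDual (P v)
  | algebraMap r => exact (symDual V₀).algebraMap_mem r
  | add f g _ _ h1 h2 => exact (symDual V₀).add_mem h1 h2
  | mul f g _ _ h1 h2 => exact (symDual V₀).mul_mem h1 h2

/-- Evaluation of a polynomial function on `V*`. -/
def evalSym (y : StrongDual ℝ V) : symDual V →+* ℝ :=
  (Pi.evalRingHom (fun _ : StrongDual ℝ V => ℝ) y).comp (symDual V).toSubring.subtype

theorem evalSym_apply (y : StrongDual ℝ V) (ψ : symDual V) : evalSym y ψ = ψ.1 y := rfl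

/-- Keeping the coefficients in `symDual V`, instead of specialising y, is what later shows that the
numerator of the residue is polynomial in y. -/
theorem exists_polynomial_along (z₀ : StrongDual ℝ V) {ψ : StrongDual ℝ V → ℝ}
    (hψ : ψ ∈ symDual V) : ∃ N : Polynomial (symDual V), ∀ (y : StrongDual ℝ V) (t : ℝ),
      ψ (y + t • z₀) = (N.map (evalSym y)).eval t := by
  induction hψ using Algebra.adjoin_induction with
  | mem f hf =>
    obtain ⟨v, rfl⟩ := hf
    refine ⟨Polynomial.C ⟨_, apply_mem_symDual v⟩ +
      Polynomial.C (algebraMap ℝ (symDual V) (z₀ v)) * Polynomial.X, fun y t => ?_⟩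
    simp only [Polynomial.map_add, Polynomial.map_mul, Polynomial.map_C, Polynomial.map_X,
      Polynomial.eval_add, Polynomial.eval_mul, Polynomial.eval_C, Polynomial.eval_X, evalSym_apply]
    change y v + t * z₀ v = y v + z₀ v * t
    ring
  | algebraMap r =>
    refine ⟨Polynomial.C (algebraMap ℝ (symDual V) r), fun y t => ?_⟩
    rw [Polynomial.map_C, Polynomial.eval_C]
    rfl
  | add f g _ _ h1 h2 =>
    obtain ⟨N, hN⟩ := h1
    obtain ⟨N', hN'⟩ := h2
    exact ⟨N + N', fun y t => by simp [hN, hN']⟩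
  | mul f g _ _ h1 h2 =>
    obtain ⟨N, hN⟩ := h1
    obtain ⟨N', hN'⟩ := h2
    exact ⟨N * N', fun y t => by simp [hN, hN']⟩

open Classical in
/-- The elements of a finite set which lie in the subspace `V₀`. -/
def restrictFinset (κ : Finset V) (V₀ : Submodule ℝ V) : Finset V₀ := κ.subtype (· ∈ V₀)

theorem mem_restrictFinset {κ : Finset V} {V₀ : Submodule ℝ V} {β : V₀} :
    β ∈ restrictFinset κ V₀ ↔ (β : V) ∈ κ := by
  classical
  exact Finset.mem_subtype

/-- Only the factors off V₀ depend on t. Divided by z₀(α) they become monic in t, so division with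
remainder works over the ring `symDual V`, and the residue is a coefficient of the remainder. The
factors in V₀ survive as the denominator. If all of κ lies in V₀ there is no pole and the numerator
is 0. -/
theorem exists_isHyperplaneResidue_fraction [FiniteDimensional ℝ V] {Δ : Set V}
    (hfin : Δ.Finite) {V₀ : Submodule ℝ V} {z₀ : StrongDual ℝ V}
    (hz₀ : LinearMap.ker (z₀ : V →ₗ[ℝ] ℝ) = V₀) {ψ : StrongDual ℝ V → ℝ} (hψ : ψ ∈ symDual V)
    (κ : Finset V) (m : V → ℕ) :
    ∃ Q ∈ symDual V₀, (((κ : Set V) ⊆ V₀) → Q = 0) ∧ IsHyperplaneResidue V₀ z₀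
      (fun y : dualReg Δ => ψ y.1 / ∏ α ∈ κ, y.1 α ^ m α)
      (fun y : dualReg (restrictSystem Δ V₀) =>
        Q y.1 / ∏ β ∈ restrictFinset κ V₀, y.1 β ^ m β) := by
  classical
  obtain ⟨P, hP⟩ := exists_projection V₀
  obtain ⟨N, hN⟩ := exists_polynomial_along z₀ hψ
  let D : Polynomial (symDual V) := ∏ α ∈ κ with α ∉ V₀,
    (Polynomial.X + Polynomial.C ((z₀ α)⁻¹ • ⟨_, apply_mem_symDual α⟩)) ^ m α
  have hD : D.Monic := Polynomial.monic_prod_of_monic _ _ fun α _ =>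
    (Polynomial.monic_X_add_C _).pow _
  let c : ℝ := ∏ α ∈ κ with α ∉ V₀, z₀ α ^ m α
  let q : symDual V := (N %ₘ D).coeff (D.natDegree - 1)
  refine ⟨c⁻¹ • fun y : StrongDual ℝ V₀ => q.1 (y.comp P),
    (symDual V₀).smul_mem (comp_mem_symDual P q.2) _, fun hκV => ?_,
    isHyperplaneResidue_of_section hz₀ P hP fun y => ?_⟩
  · have h1 : D = 1 := by
      refine Finset.prod_eq_one fun α hα => ?_
      exact absurd (hκV (Finset.mem_filter.1 hα).1) (Finset.mem_filter.1 hα).2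
    have hq : q = 0 := by simp [q, h1]
    funext y
    simp [hq]
  · set z : StrongDual ℝ V := y.1.comp P with hz
    have hzP : ∀ β : V₀, z β = y.1 β := fun β => by simp [hz, hP β]
    have hzy : z.comp V₀.subtypeL = y.1 := by ext β; exact hzP β
    have hmem : z.comp V₀.subtypeL ∈ dualReg (restrictSystem Δ V₀) := by rw [hzy]; exact y.2
    have h1 := (hasResidueAtInfinity_div (N := N.map (evalSym z)) (hD.map (evalSym z))).const_mul
      (c⁻¹ / ∏ β ∈ restrictFinset κ V₀, y.1 β ^ m β)
    rw [← Polynomial.map_modByMonic _ hD, hD.natDegree_map, Polynomial.coeff_map] at h1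
    have h2 : -((c⁻¹ • fun y : StrongDual ℝ V₀ => q.1 (y.comp P)) y.1 /
        ∏ β ∈ restrictFinset κ V₀, y.1 β ^ m β) =
        c⁻¹ / (∏ β ∈ restrictFinset κ V₀, y.1 β ^ m β) *
          -(evalSym z) ((N %ₘ D).coeff (D.natDegree - 1)) := by
      rw [evalSym_apply, Pi.smul_apply, smul_eq_mul]
      ring
    rw [h2]
    refine h1.congr' ?_
    filter_upwards [eventually_mem_dualReg hfin hz₀ hmem] with t ht
    rw [extend_of_mem _ ht, ← hN]
    have hsplit : ∏ α ∈ κ, (z + t • z₀) α ^ m α =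
        (∏ β ∈ restrictFinset κ V₀, y.1 β ^ m β) *
          (c * (D.map (evalSym z)).eval t) := by
      rw [← Finset.prod_filter_mul_prod_filter_not κ (· ∈ V₀)]
      congr 1
      · rw [restrictFinset, ← Finset.prod_subtype_eq_prod_filter]
        refine Finset.prod_congr rfl fun β _ => ?_
        have : z₀ β.1 = 0 := hz₀.ge β.2
        have hβ : z β.1 = y.1 β := hzP β
        simp [this, hβ]
      · rw [Polynomial.map_prod, Polynomial.eval_prod, ← Finset.prod_mul_distrib]
        refine Finset.prod_congr rfl fun α hα => ?_
        have h0 : z₀ α ≠ 0 := fun h0 => (Finset.mem_filter.1 hα).2 (by rw [← hz₀]; exact h0)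
        rw [Polynomial.map_pow, Polynomial.eval_pow, ← mul_pow]
        congr 1
        rw [Polynomial.map_add, Polynomial.map_X, Polynomial.map_C, Polynomial.eval_add,
          Polynomial.eval_X, Polynomial.eval_C, evalSym_apply]
        change z α + t * z₀ α = z₀ α * (t + (z₀ α)⁻¹ * z α)
        field_simp
        ring
    rw [hsplit]
    field_simp

theorem smul_mem_dualReg {Δ : Set V} {y : StrongDual ℝ V} {c : ℝ} (hc : c ≠ 0) :
    c • y ∈ dualReg Δ ↔ y ∈ dualReg Δ := by
  simp [dualReg, hc]

theorem finite_restrictSystem {Δ : Set V} (hfin : Δ.Finite) (V₀ : Submodule ℝ V) :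
    (restrictSystem Δ V₀).Finite :=
  hfin.preimage Subtype.val_injective.injOn

theorem zero_notMem_restrictSystem {Δ : Set V} (hzero : (0 : V) ∉ Δ) (V₀ : Submodule ℝ V) :
    (0 : V₀) ∉ restrictSystem Δ V₀ := hzero

theorem neg_mem_restrictSystem {Δ : Set V} (hsymm : ∀ α ∈ Δ, -α ∈ Δ) (V₀ : Submodule ℝ V) :
    ∀ α ∈ restrictSystem Δ V₀, -α ∈ restrictSystem Δ V₀ := fun α hα => hsymm α hα

/-! ### Homogeneity of residues -/

/-- Scaling y by c amounts to scaling t by c, and `dt` contributes the extra factor of c. -/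
theorem IsHyperplaneResidue.homogeneous [FiniteDimensional ℝ V] {Δ : Set V} {V₀ : Submodule ℝ V}
    {z₀ : StrongDual ℝ V} {φ : dualReg Δ → ℝ} {ψ : dualReg (restrictSystem Δ V₀) → ℝ}
    (h : IsHyperplaneResidue V₀ z₀ φ ψ) {c : ℝ} (hc : c ≠ 0) {k : ℤ}
    (hφ : ∀ (y : dualReg Δ) (hy : c • y.1 ∈ dualReg Δ), φ ⟨c • y.1, hy⟩ = c ^ k * φ y)
    (y : dualReg (restrictSystem Δ V₀)) (hy : c • y.1 ∈ dualReg (restrictSystem Δ V₀)) :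
    ψ ⟨c • y.1, hy⟩ = c ^ (k + 1) * ψ y := by
  obtain ⟨P, hP⟩ := exists_projection V₀
  set g : StrongDual ℝ V := y.1.comp P with hg
  have hgy : g.comp V₀.subtypeL = y.1 := by
    ext x
    simp [hg, hP x]
  have hgc : (c • g).comp V₀.subtypeL = c • y.1 := by rw [ContinuousLinearMap.smul_comp, hgy]
  have h1 := h g (by rw [hgy]; exact y.2)
  have h2 := h (c • g) (by rw [hgc]; exact hy)
  have e1 : (⟨g.comp V₀.subtypeL, by rw [hgy]; exact y.2⟩ :
      dualReg (restrictSystem Δ V₀)) = y := Subtype.ext hgy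
  have e2 : (⟨(c • g).comp V₀.subtypeL, by rw [hgc]; exact hy⟩ :
      dualReg (restrictSystem Δ V₀)) = ⟨c • y.1, hy⟩ := Subtype.ext hgc
  rw [e1] at h1
  rw [e2] at h2
  have h3 := (h1.comp_mul (inv_ne_zero hc)).const_mul (c ^ k)
  have h4 : (fun t => c ^ k * Function.extend Subtype.val φ 0 (g + (c⁻¹ * t) • z₀)) =
      fun t => Function.extend Subtype.val φ 0 (c • g + t • z₀) := by
    funext t
    have hx : c • g + t • z₀ = c • (g + (c⁻¹ * t) • z₀) := by
      rw [smul_add, smul_smul, mul_inv_cancel_left₀ hc]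
    rw [hx]
    by_cases hmem : g + (c⁻¹ * t) • z₀ ∈ dualReg Δ
    · have hmem' := (smul_mem_dualReg hc).2 hmem
      rw [extend_of_mem _ hmem, extend_of_mem _ hmem', ← hφ ⟨_, hmem⟩ hmem']
    · have hmem' := mt (smul_mem_dualReg hc).1 hmem
      rw [Function.extend_apply', Function.extend_apply']
      · simp
      · rintro ⟨a, ha⟩; exact hmem' (ha ▸ a.2)
      · rintro ⟨a, ha⟩; exact hmem (ha ▸ a.2)
  rw [h4] at h3
  have := h2.unique h3
  rw [inv_inv] at this
  rw [zpow_add_one₀ hc]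
  linarith

/-- Homogeneity of residues is known only at regular points and for c ≠ 0. Continuity extends it to
all points and to c = 0, and the latter rules out negative degrees. -/
theorem homogeneous_of_dense {E : Type*} [NormedAddCommGroup E] [NormedSpace ℝ E] {Q : E → ℝ}
    (hQ : Continuous Q) {S : Set E} (hS : Dense S) {e : ℤ}
    (h : ∀ c : ℝ, c ≠ 0 → ∀ y ∈ S, Q (c • y) = c ^ e * Q y) :
    (e < 0 → Q = 0) ∧ (0 ≤ e → ∀ (c : ℝ) (y : E), Q (c • y) = c ^ e.toNat * Q y) := by
  have h1 : ∀ c : ℝ, c ≠ 0 → ∀ y, Q (c • y) = c ^ e * Q y := by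
    intro c hc
    have := Continuous.ext_on hS (f := fun y => Q (c • y)) (g := fun y => c ^ e * Q y)
      (by fun_prop) (by fun_prop) (fun y hy => h c hc y hy)
    exact fun y => congrFun this y
  have hdense : Dense {c : ℝ | c ≠ 0} := dense_compl_singleton 0
  constructor
  · intro he
    funext y
    have h2 := Continuous.ext_on hdense (f := fun c : ℝ => Q y)
      (g := fun c : ℝ => c ^ (-e).toNat * Q (c • y)) (by fun_prop) (by fun_prop) (fun c hc => by
        have hc : c ≠ 0 := hc
        dsimp only
        rw [h1 c hc, ← zpow_natCast, Int.toNat_of_nonneg (by omega), ← mul_assoc,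
          ← zpow_add₀ hc, neg_add_cancel, zpow_zero, one_mul])
    have := congrFun h2 0
    have hne : (-e).toNat ≠ 0 := by omega
    simpa [hne] using this
  · intro he c y
    have h2 := Continuous.ext_on hdense (f := fun c : ℝ => Q (c • y))
      (g := fun c : ℝ => c ^ e.toNat * Q y) (by fun_prop) (by fun_prop) (fun c hc => by
        have hc : c ≠ 0 := hc
        dsimp only
        rw [h1 c hc, ← zpow_natCast, Int.toNat_of_nonneg he])
    exact congrFun h2 c

/-! ### Residues of elements of R̂_Δ and of NG_Δ -/

section Residue

variable [FiniteDimensional ℝ V] {Δ : Set V} (hfin : Δ.Finite) {V₀ : Submodule ℝ V}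
  {z₀ : StrongDual ℝ V} (hz₀ : LinearMap.ker (z₀ : V →ₗ[ℝ] ℝ) = V₀)

include hfin hz₀

theorem exists_isHyperplaneResidue_of_mem_RHat {φ : ℤ → dualReg Δ → ℝ} (hφ : φ ∈ RHat Δ)
    (j : ℤ) : ∃ ψ, IsHyperplaneResidue V₀ z₀ (φ j) ψ := by
  obtain ⟨ψ, κ, m, hψ, hκ, hφψ⟩ := hφ
  by_cases h : 0 ≤ j + ∑ α ∈ κ, (m α : ℤ)
  · obtain ⟨Q, -, -, hQ⟩ := exists_isHyperplaneResidue_fraction (Δ := Δ) hfin hz₀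
      (hψ (j + ∑ α ∈ κ, (m α : ℤ)).toNat).1 κ m
    refine ⟨fun y => Q y.1 / ∏ β ∈ restrictFinset κ V₀, y.1 β ^ m β, ?_⟩
    convert hQ using 1
    funext y
    rw [hφψ, if_pos h]
  · refine ⟨0, ?_⟩
    convert IsHyperplaneResidue.zero (Δ := Δ) V₀ z₀ using 1
    funext y
    rw [hφψ, if_neg h]
    rfl

theorem isHyperplaneResidue_hyperplaneResidue {φ : ℤ → dualReg Δ → ℝ} (hφ : φ ∈ RHat Δ)
    (j : ℤ) : IsHyperplaneResidue V₀ z₀ (φ (j - 1)) (hyperplaneResidue V₀ z₀ φ j) :=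
  Classical.epsilon_spec (exists_isHyperplaneResidue_of_mem_RHat hfin hz₀ hφ (j - 1))

/-- All components share the denominator of φ restricted to V₀. Homogeneity fixes the degrees of the
numerators and kills those whose degree would be negative, so the numerators form a power series. -/
theorem hyperplaneResidue_mem_RHat (hzero : (0 : V) ∉ Δ) {φ : ℤ → dualReg Δ → ℝ}
    (hφ : φ ∈ RHat Δ) : hyperplaneResidue V₀ z₀ φ ∈ RHat (restrictSystem Δ V₀) := by
  have hspec := isHyperplaneResidue_hyperplaneResidue hfin hz₀ hφ
  obtain ⟨ψ, κ, m, hψ, hκ, hφψ⟩ := hφ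
  have hex : ∀ j : ℤ, ∃ Q ∈ symDual V₀, hyperplaneResidue V₀ z₀ φ j =
      fun y : dualReg (restrictSystem Δ V₀) =>
        Q y.1 / ∏ β ∈ restrictFinset κ V₀, y.1 β ^ m β := by
    intro j
    by_cases h : 0 ≤ (j - 1) + ∑ α ∈ κ, (m α : ℤ)
    · obtain ⟨Q, hQs, -, hQ⟩ := exists_isHyperplaneResidue_fraction (Δ := Δ) hfin hz₀
        (hψ ((j - 1) + ∑ α ∈ κ, (m α : ℤ)).toNat).1 κ m
      refine ⟨Q, hQs, (hspec j).unique ?_⟩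
      convert hQ using 1
      funext y
      rw [hφψ, if_pos h]
    · refine ⟨0, Subalgebra.zero_mem _, (hspec j).unique ?_⟩
      convert IsHyperplaneResidue.zero (Δ := Δ) V₀ z₀ using 1
      · funext y
        rw [hφψ, if_neg h]
        rfl
      · funext y
        simp
  choose Q hQs hQ using hex
  have hφhom : ∀ (j : ℤ) (c : ℝ), c ≠ 0 → ∀ (y : dualReg Δ) (hy : c • y.1 ∈ dualReg Δ),
      φ j ⟨c • y.1, hy⟩ = c ^ j * φ j y := by
    intro j c hc y hy
    rw [hφψ, hφψ]
    split_ifs with h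
    · have hprod : ∏ α ∈ κ, (c • y.1) α ^ m α =
          c ^ (∑ α ∈ κ, (m α : ℤ)) * ∏ α ∈ κ, y.1 α ^ m α := by
        have : c ^ (∑ α ∈ κ, (m α : ℤ)) = ∏ α ∈ κ, c ^ m α := by
          rw [← Nat.cast_sum, zpow_natCast, Finset.prod_pow_eq_pow_sum]
        rw [this, ← Finset.prod_mul_distrib]
        exact Finset.prod_congr rfl fun α _ => by simp [mul_pow]
      rw [hprod, (hψ _).2, ← zpow_natCast, Int.toNat_of_nonneg h, zpow_add₀ hc]
      have := zpow_ne_zero (∑ α ∈ κ, (m α : ℤ)) hc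
      field_simp
    · simp
  set D₀ : ℤ := ∑ β ∈ restrictFinset κ V₀, (m β : ℤ) with hD₀
  have hsub : ((restrictFinset κ V₀ : Finset V₀) : Set V₀) ⊆ restrictSystem Δ V₀ :=
    fun β hβ => hκ (mem_restrictFinset.1 hβ)
  have hQhom : ∀ j : ℤ, (j + D₀ < 0 → Q j = 0) ∧
      (0 ≤ j + D₀ → ∀ (c : ℝ) (y : StrongDual ℝ V₀), Q j (c • y) = c ^ (j + D₀).toNat * Q j y) := by
    intro j
    refine homogeneous_of_dense (continuous_of_mem_symDual (hQs j))
      (dense_dualReg (finite_restrictSystem hfin V₀) (zero_notMem_restrictSystem hzero V₀)) ?_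
    intro c hc y hy
    have hcy := (smul_mem_dualReg hc).2 hy
    have h1 := (hspec j).homogeneous hc (hφhom (j - 1) c hc) ⟨y, hy⟩ hcy
    rw [hQ j, sub_add_cancel] at h1
    dsimp only at h1
    have hprod : ∏ β ∈ restrictFinset κ V₀, (c • y) β ^ m β =
        c ^ D₀ * ∏ β ∈ restrictFinset κ V₀, y β ^ m β := by
      have : c ^ D₀ = ∏ β ∈ restrictFinset κ V₀, c ^ m β := by
        rw [hD₀, ← Nat.cast_sum, zpow_natCast, Finset.prod_pow_eq_pow_sum]
      rw [this, ← Finset.prod_mul_distrib]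
      exact Finset.prod_congr rfl fun α _ => by simp [mul_pow]
    have hne : ∏ β ∈ restrictFinset κ V₀, y β ^ m β ≠ 0 :=
      prod_ne_zero_of_dualReg hsub (fun β => m β) ⟨y, hy⟩
    have hne' := zpow_ne_zero D₀ hc
    rw [hprod] at h1
    rw [zpow_add₀ hc]
    field_simp at h1
    linarith
  -- The numerator of degree `d` belongs to the component of degree `d - D₀`. The condition in the
  -- `if` always holds.
  refine ⟨fun d => if 0 ≤ (d : ℤ) then Q (d - D₀) else 0, restrictFinset κ V₀, fun β => m β,
    fun d => ?_, hsub, fun j y => ?_⟩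
  · dsimp only
    rw [if_pos (Int.natCast_nonneg d)]
    refine ⟨hQs _, fun c y => ?_⟩
    have := (hQhom (d - D₀)).2 (by omega) c y
    simpa using this
  · rw [hQ j]
    dsimp only
    rw [← hD₀]
    split_ifs with h1 h2
    · rw [Int.toNat_of_nonneg h1, add_sub_cancel_right]
    · omega
    · rw [(hQhom j).1 (by omega)]
      simp

/-- If the part of κ in V₀ generates the hyperplane V₀, then κ, which does not generate V, lies
entirely in V₀ and the residue is 0. Otherwise the surviving denominator does not generate V₀. -/
theorem exists_isHyperplaneResidue_mem_NG {ν : dualReg Δ → ℝ} (hν : ν ∈ NG Δ) :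
    ∃ ν₀ ∈ NG (restrictSystem Δ V₀), IsHyperplaneResidue V₀ z₀ ν ν₀ := by
  induction hν using Submodule.span_induction with
  | zero => exact ⟨0, Submodule.zero_mem _, IsHyperplaneResidue.zero V₀ z₀⟩
  | add ν ν' _ _ h h' =>
    obtain ⟨ν₀, h1, h2⟩ := h
    obtain ⟨ν₀', h1', h2'⟩ := h'
    exact ⟨_, Submodule.add_mem _ h1 h1', h2.add h2'⟩
  | smul c ν _ h =>
    obtain ⟨ν₀, h1, h2⟩ := h
    exact ⟨_, Submodule.smul_mem _ c h1, h2.smul c⟩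
  | mem ν hν =>
    obtain ⟨ψ, κ, m, hψ, hκ, hs, rfl⟩ := hν
    obtain ⟨Q, hQs, hQ0, hQ⟩ := exists_isHyperplaneResidue_fraction (Δ := Δ) hfin hz₀ hψ κ m
    refine ⟨_, ?_, hQ⟩
    by_cases hs₀ : Submodule.span ℝ ((restrictFinset κ V₀ : Finset V₀) : Set V₀) = ⊤
    · have hle : V₀ ≤ Submodule.span ℝ (κ : Set V) := by
        have h1 := congrArg (Submodule.map V₀.subtype) hs₀
        rw [Submodule.map_span, Submodule.map_top, Submodule.range_subtype] at h1
        rw [← h1]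
        refine Submodule.span_mono ?_
        rintro _ ⟨β, hβ, rfl⟩
        exact mem_restrictFinset.1 hβ
      have hκV : (κ : Set V) ⊆ V₀ := by
        intro α hα
        by_contra hαV
        refine hs (eq_top_iff.2 fun x _ => ?_)
        have h0 : z₀ α ≠ 0 := fun h0 => hαV (by rw [← hz₀]; exact h0)
        have hx : x - (z₀ x / z₀ α) • α ∈ V₀ := by
          rw [← hz₀, LinearMap.mem_ker]
          simp [h0]
        have := Submodule.add_mem _ (hle hx)
          (Submodule.smul_mem _ (z₀ x / z₀ α) (Submodule.subset_span (s := (κ : Set V)) hα))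
        simpa using this
      rw [hQ0 hκV]
      convert Submodule.zero_mem _ using 1
      funext y
      simp
    · refine Submodule.subset_span ⟨Q, restrictFinset κ V₀, fun β => m β, hQs, fun β hβ => ?_,
        hs₀, rfl⟩
      exact hκ (mem_restrictFinset.1 hβ)

end Residue

/-! ### Truncations -/

theorem taylor_eq_sum {Δ : Set V} {φ : ℤ → dualReg Δ → ℝ} {B : ℤ} (hB : ∀ j < B, φ j = 0)
    (K : ℤ) : taylor K φ = ∑ j ∈ Finset.Icc B K, φ j := by
  refine finsum_mem_eq_sum_of_inter_support_eq _ ?_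
  ext j
  simp only [Set.mem_inter_iff, Set.mem_Iic, Function.mem_support, Finset.coe_Icc, Set.mem_Icc]
  constructor
  · rintro ⟨h1, h2⟩
    exact ⟨⟨not_lt.1 fun h => h2 (hB j h), h1⟩, h2⟩
  · rintro ⟨⟨-, h1⟩, h2⟩
    exact ⟨h1, h2⟩

theorem exists_bound_of_mem_RHat {Δ : Set V} {φ : ℤ → dualReg Δ → ℝ} (hφ : φ ∈ RHat Δ) :
    ∃ B : ℤ, ∀ j < B, φ j = 0 := by
  obtain ⟨ψ, κ, m, -, -, hφψ⟩ := hφ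
  refine ⟨-∑ α ∈ κ, (m α : ℤ), fun j hj => ?_⟩
  funext y
  rw [hφψ, if_neg (by omega)]
  rfl

theorem taylor_mem_simpleG_sup_NG {Δ : Set V} {r : ℕ} (hr : Module.finrank ℝ V = r)
    {φ : ℤ → dualReg Δ → ℝ} (hφ : φ ∈ RHat Δ) (K : ℤ) : taylor K φ ∈ simpleG Δ r ⊔ NG Δ := by
  obtain ⟨B, hB⟩ := exists_bound_of_mem_RHat hφ
  rw [taylor_eq_sum hB]
  obtain ⟨ψ, κ, m, hψ, hκ, hφψ⟩ := hφ
  refine Submodule.sum_mem _ fun j _ => ?_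
  by_cases h : 0 ≤ j + ∑ α ∈ κ, (m α : ℤ)
  · convert div_prod_mem_simpleG_sup_NG hr (hψ (j + ∑ α ∈ κ, (m α : ℤ)).toNat).1 hκ m using 1
    funext y
    rw [hφψ, if_pos h]
  · convert Submodule.zero_mem _ using 1
    funext y
    rw [hφψ, if_neg h]
    rfl

theorem isHyperplaneResidue_taylor [FiniteDimensional ℝ V] {Δ : Set V} (hfin : Δ.Finite)
    {V₀ : Submodule ℝ V} {z₀ : StrongDual ℝ V} (hz₀ : LinearMap.ker (z₀ : V →ₗ[ℝ] ℝ) = V₀)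
    {φ : ℤ → dualReg Δ → ℝ} (hφ : φ ∈ RHat Δ) (K : ℤ) :
    IsHyperplaneResidue V₀ z₀ (taylor (K - 1) φ) (taylor K (hyperplaneResidue V₀ z₀ φ)) := by
  obtain ⟨B, hB⟩ := exists_bound_of_mem_RHat hφ
  have hspec := isHyperplaneResidue_hyperplaneResidue hfin hz₀ hφ
  have hB' : ∀ j < B + 1, hyperplaneResidue V₀ z₀ φ j = 0 := by
    intro j hj
    refine (hspec j).unique ?_
    rw [hB (j - 1) (by omega)]
    exact IsHyperplaneResidue.zero V₀ z₀
  rw [taylor_eq_sum hB, taylor_eq_sum hB']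
  have : ∑ j ∈ Finset.Icc B (K - 1), φ j = ∑ j ∈ Finset.Icc (B + 1) K, φ (j - 1) := by
    refine Finset.sum_bij' (fun j _ => j + 1) (fun j _ => j - 1) ?_ ?_ ?_ ?_ ?_
    · intro j hj; simp only [Finset.mem_Icc] at *; omega
    · intro j hj; simp only [Finset.mem_Icc] at *; omega
    · intro j _; omega
    · intro j _; omega
    · intro j _; congr 1; omega
  rw [this]
  exact IsHyperplaneResidue.sum _ fun j _ => hspec j

/-! ### Residues of simple fractions -/

section SimpleResidue

open Polynomial

/-- If all vectors of a basis of `V` but one lie in the hyperplane `V₀`, they form a basis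
of `V₀`. -/
theorem exists_basis_hyperplane {n : ℕ} {V₀ : Submodule ℝ V} (hn : Module.finrank ℝ V₀ = n)
    (b : Module.Basis (Fin (n + 1)) ℝ V) (i₀ : Fin (n + 1))
    (hmem : ∀ j : Fin n, b (i₀.succAbove j) ∈ V₀) :
    ∃ b₀ : Module.Basis (Fin n) ℝ V₀, ∀ j, (b₀ j : V) = b (i₀.succAbove j) := by
  have hli : LinearIndependent ℝ fun j : Fin n => (⟨b (i₀.succAbove j), hmem j⟩ : V₀) := by
    refine LinearIndependent.of_comp V₀.subtype ?_
    exact b.linearIndependent.comp _ i₀.succAbove_right_injective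
  rcases Nat.eq_zero_or_pos n with h0 | h0
  · subst h0
    have : Module.Finite ℝ V := b.finiteDimensional_of_finite
    have : Subsingleton V₀ := Module.finrank_zero_iff.1 hn
    exact ⟨Module.Basis.empty V₀, fun j => j.elim0⟩
  · have : Nonempty (Fin n) := ⟨⟨0, h0⟩⟩
    refine ⟨basisOfLinearIndependentOfCardEqFinrank hli (by simp [hn]), fun j => ?_⟩
    rw [coe_basisOfLinearIndependentOfCardEqFinrank]

variable {Δ : Set V} (hfin : Δ.Finite) {V₀ : Submodule ℝ V} {z₀ : StrongDual ℝ V}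
  (hz₀ : LinearMap.ker (z₀ : V →ₗ[ℝ] ℝ) = V₀)

theorem apply_eq_zero_of_mem (hz₀ : LinearMap.ker (z₀ : V →ₗ[ℝ] ℝ) = V₀) {v : V} (hv : v ∈ V₀) :
    z₀ v = 0 := by
  rw [← hz₀] at hv; exact hv

theorem apply_ne_zero_of_notMem (hz₀ : LinearMap.ker (z₀ : V →ₗ[ℝ] ℝ) = V₀) {v : V}
    (hv : v ∉ V₀) : z₀ v ≠ 0 := fun h0 => hv (by rw [← hz₀]; exact h0)

include hfin hz₀

/-- Only the factor of `b i₀` depends on t, and (ct + d)^-(m+1) has a 1/t term only for m = 0, with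
coefficient 1/c. -/
theorem isHyperplaneResidue_simple {n : ℕ} (b : Module.Basis (Fin (n + 1)) ℝ V)
    (i₀ : Fin (n + 1)) (hi₀ : b i₀ ∉ V₀)
    (b₀ : Module.Basis (Fin n) ℝ V₀) (hb₀ : ∀ j, (b₀ j : V) = b (i₀.succAbove j))
    (m : Fin (n + 1) → ℕ) :
    IsHyperplaneResidue V₀ z₀ (fun y : dualReg Δ => (∏ i, y.1 (b i) ^ (m i + 1))⁻¹)
      ((if m i₀ = 0 then (z₀ (b i₀))⁻¹ else 0) •
        fun y : dualReg (restrictSystem Δ V₀) =>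
          (∏ j, y.1 (b₀ j) ^ (m (i₀.succAbove j) + 1))⁻¹) := by
  intro z hz
  have hc : z₀ (b i₀) ≠ 0 := apply_ne_zero_of_notMem hz₀ hi₀
  set K : ℝ := ∏ j, z (b₀ j : V) ^ (m (i₀.succAbove j) + 1) with hK
  let D : ℝ[X] := (C (z₀ (b i₀)) * X + C (z (b i₀))) ^ (m i₀ + 1)
  have hdeg : D.natDegree = m i₀ + 1 := by
    rw [natDegree_pow, natDegree_linear hc, mul_one]
  have hlead : D.leadingCoeff = z₀ (b i₀) ^ (m i₀ + 1) := by
    rw [leadingCoeff_pow, leadingCoeff_linear hc]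
  have h1 := (hasResidueAtInfinity_inv (D := D) (by omega)).const_mul K⁻¹
  rw [hdeg, hlead] at h1
  have h2 : K⁻¹ * -((X : ℝ[X]).coeff (m i₀ + 1) / z₀ (b i₀) ^ (m i₀ + 1)) =
      -((if m i₀ = 0 then (z₀ (b i₀))⁻¹ else 0) * K⁻¹) := by
    rw [coeff_X]
    by_cases h : m i₀ = 0
    · simp [h, mul_comm]
    · have : ¬ 1 = m i₀ + 1 := by omega
      simp [h]
  rw [h2] at h1
  refine h1.congr' ?_
  filter_upwards [eventually_mem_dualReg hfin hz₀ hz] with t ht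
  rw [extend_of_mem _ ht, Fin.prod_univ_succAbove _ i₀, mul_inv, mul_comm]
  congr 2
  · simp [D]; ring
  · rw [hK]
    refine Finset.prod_congr rfl fun j _ => ?_
    rw [← hb₀]
    simp [apply_eq_zero_of_mem hz₀ (b₀ j).2]

/-- With two factors depending on t the denominator has degree at least 2 in t, so there is no 1/t
term. -/
theorem isHyperplaneResidue_simple_zero {r : ℕ} (b : Module.Basis (Fin r) ℝ V)
    {i j : Fin r} (hij : i ≠ j) (hi : b i ∉ V₀) (hj : b j ∉ V₀) (hb : ∀ k, b k ∈ Δ)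
    (m : Fin r → ℕ) :
    IsHyperplaneResidue V₀ z₀ (fun y : dualReg Δ => (∏ i, y.1 (b i) ^ (m i + 1))⁻¹) 0 := by
  intro z hz
  let L : Fin r → ℝ[X] := fun k => C (z₀ (b k)) * X + C (z (b k))
  let D : ℝ[X] := ∏ k, L k ^ (m k + 1)
  -- A factor independent of t comes from an element of Δ in V₀, where the regular functional `z`
  -- does not vanish.
  have hL : ∀ k, L k ≠ 0 := by
    intro k h0
    have h1 : z₀ (b k) = 0 := by simpa [L] using congrArg (fun p => coeff p 1) h0
    have h2 : z (b k) = 0 := by simpa [L] using congrArg (fun p => coeff p 0) h0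
    have hk : b k ∈ V₀ := by rw [← hz₀]; exact h1
    exact hz ⟨b k, hk⟩ (hb k) h2
  have hD0 : D ≠ 0 := Finset.prod_ne_zero_iff.2 fun k _ => pow_ne_zero _ (hL k)
  have hdvd : L i * L j ∣ D := by
    have h1 : ∏ k ∈ {i, j}, L k ∣ ∏ k, L k :=
      Finset.prod_dvd_prod_of_subset _ _ _ (Finset.subset_univ _)
    rw [Finset.prod_pair hij] at h1
    exact h1.trans (Finset.prod_dvd_prod_of_dvd _ _ fun k _ => dvd_pow_self _ (Nat.succ_ne_zero _))
  have hdeg : 2 ≤ D.natDegree := by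
    refine le_trans ?_ (natDegree_le_of_dvd hdvd hD0)
    rw [natDegree_mul (hL i) (hL j), natDegree_linear (apply_ne_zero_of_notMem hz₀ hi),
      natDegree_linear (apply_ne_zero_of_notMem hz₀ hj)]
  have h1 := hasResidueAtInfinity_inv (D := D) (by omega)
  rw [coeff_X, if_neg (by omega), zero_div] at h1
  refine HasResidueAtInfinity.congr' h1 ?_
  filter_upwards [eventually_mem_dualReg hfin hz₀ hz] with t ht
  rw [extend_of_mem _ ht]
  simp only [D, L, eval_prod, eval_pow]
  refine congrArg _ (Finset.prod_congr rfl fun k _ => ?_)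
  simp
  ring

end SimpleResidue

/-! ### One-sided limits along a wall -/

/-- The function `t ^ k / k!` on the half-line `t ≥ 0`, extended by zero. -/
def halfMonomial (k : ℕ) (t : ℝ) : ℝ := if 0 ≤ t then t ^ k / k.factorial else 0

theorem coneFun_eq_prod {r : ℕ} (b : Module.Basis (Fin r) ℝ V) (m : Fin r → ℕ) (h : V) :
    coneFun b m h = ∏ i, halfMonomial (m i) (b.repr h i) := by
  by_cases hh : ∀ i, 0 ≤ b.repr h i
  · rw [coneFun, if_pos hh, conePoly]
    exact Finset.prod_congr rfl fun i _ => by rw [halfMonomial, if_pos (hh i)]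
  · rw [coneFun, if_neg hh]
    push Not at hh
    obtain ⟨i, hi⟩ := hh
    exact (Finset.prod_eq_zero (Finset.mem_univ i)
      (by rw [halfMonomial, if_neg (not_le.2 hi)])).symm

theorem continuousAt_halfMonomial (k : ℕ) {t : ℝ} (ht : t ≠ 0) :
    ContinuousAt (halfMonomial k) t := by
  rcases ht.lt_or_gt with h | h
  · refine (continuousAt_const (y := (0 : ℝ))).congr ?_
    filter_upwards [eventually_lt_nhds h] with s hs
    rw [halfMonomial, if_neg (not_le.2 hs)]
  · have : ContinuousAt (fun t : ℝ => t ^ k / k.factorial) t := by fun_prop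
    refine this.congr ?_
    filter_upwards [eventually_gt_nhds h] with s hs
    rw [halfMonomial, if_pos hs.le]

theorem tendsto_halfMonomial_pos (k : ℕ) :
    Tendsto (halfMonomial k) (𝓝[>] 0) (𝓝 (if k = 0 then 1 else 0)) := by
  have h1 : Tendsto (fun t : ℝ => t ^ k / k.factorial) (𝓝[>] 0) (𝓝 (if k = 0 then 1 else 0)) := by
    have : Continuous (fun t : ℝ => t ^ k / k.factorial) := by fun_prop
    have h2 := (this.tendsto 0).mono_left (nhdsWithin_le_nhds (s := Set.Ioi 0))
    convert h2 using 2
    by_cases hk : k = 0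
    · simp [hk]
    · simp [hk]
  refine h1.congr' ?_
  filter_upwards [self_mem_nhdsWithin] with t ht
  rw [halfMonomial, if_pos (Set.mem_Ioi.1 ht).le]

theorem tendsto_halfMonomial_neg (k : ℕ) :
    Tendsto (halfMonomial k) (𝓝[<] 0) (𝓝 0) := by
  refine tendsto_const_nhds.congr' ?_
  filter_upwards [self_mem_nhdsWithin] with t ht
  rw [halfMonomial, if_neg (not_le.2 ht)]

theorem tendsto_mul_const_nhdsGT {c : ℝ} (hc : 0 < c) :
    Tendsto (fun t : ℝ => t * c) (𝓝[>] 0) (𝓝[>] 0) := by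
  refine tendsto_nhdsWithin_iff.2 ⟨?_, ?_⟩
  · have : Continuous (fun t : ℝ => t * c) := by fun_prop
    simpa using (this.tendsto 0).mono_left nhdsWithin_le_nhds
  · filter_upwards [self_mem_nhdsWithin] with t ht
    exact mul_pos ht hc

theorem tendsto_mul_const_nhdsLT {c : ℝ} (hc : c < 0) :
    Tendsto (fun t : ℝ => t * c) (𝓝[>] 0) (𝓝[<] 0) := by
  refine tendsto_nhdsWithin_iff.2 ⟨?_, ?_⟩
  · have : Continuous (fun t : ℝ => t * c) := by fun_prop
    simpa using (this.tendsto 0).mono_left nhdsWithin_le_nhds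
  · filter_upwards [self_mem_nhdsWithin] with t ht
    exact mul_neg_of_pos_of_neg ht hc

/-- At every point of `V₀` which lies on no other wall, `f` has one-sided limits in the direction
`v`, and their difference is `f₀`. -/
def HasPointwiseJump {Δ : Set V} {V₀ : Submodule ℝ V} (v : V) (f : reg Δ → ℝ)
    (f₀ : reg (restrictSystem Δ V₀) → ℝ) : Prop :=
  ∀ h : reg (restrictSystem Δ V₀), (∀ W, IsWall Δ W → W ≠ V₀ → (h.1 : V) ∉ W) →
    ∃ A B : ℝ,
      Tendsto (fun t : ℝ => Function.extend Subtype.val f 0 ((h.1 : V) + t • v)) (𝓝[>] 0) (𝓝 A) ∧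
      Tendsto (fun t : ℝ => Function.extend Subtype.val f 0 ((h.1 : V) + t • -v)) (𝓝[>] 0) (𝓝 B) ∧
      A - B = f₀ h

theorem HasPointwiseJump.zero {Δ : Set V} {V₀ : Submodule ℝ V} (v : V) :
    HasPointwiseJump v (0 : reg Δ → ℝ) (0 : reg (restrictSystem Δ V₀) → ℝ) := by
  intro h _
  exact ⟨0, 0, by simp [extend_zero], by simp [extend_zero], by simp⟩

theorem HasPointwiseJump.add {Δ : Set V} {V₀ : Submodule ℝ V} {v : V} {f f' : reg Δ → ℝ}
    {f₀ f₀' : reg (restrictSystem Δ V₀) → ℝ} (h : HasPointwiseJump v f f₀)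
    (h' : HasPointwiseJump v f' f₀') : HasPointwiseJump v (f + f') (f₀ + f₀') := by
  intro x hx
  obtain ⟨A, B, h1, h2, h3⟩ := h x hx
  obtain ⟨A', B', h1', h2', h3'⟩ := h' x hx
  refine ⟨A + A', B + B', ?_, ?_, ?_⟩
  · simpa only [extend_add] using h1.add h1'
  · simpa only [extend_add] using h2.add h2'
  · rw [Pi.add_apply, ← h3, ← h3']; ring

theorem HasPointwiseJump.smul {Δ : Set V} {V₀ : Submodule ℝ V} {v : V} {f : reg Δ → ℝ}
    {f₀ : reg (restrictSystem Δ V₀) → ℝ} (h : HasPointwiseJump v f f₀) (c : ℝ) :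
    HasPointwiseJump v (c • f) (c • f₀) := by
  intro x hx
  obtain ⟨A, B, h1, h2, h3⟩ := h x hx
  refine ⟨c * A, c * B, ?_, ?_, ?_⟩
  · simpa only [extend_smul] using h1.const_mul c
  · simpa only [extend_smul] using h2.const_mul c
  · rw [Pi.smul_apply, ← h3, smul_eq_mul]; ring

section Jump

variable [FiniteDimensional ℝ V] {Δ : Set V} (hfin : Δ.Finite) {V₀ : Submodule ℝ V}
  {z : StrongDual ℝ V} (hz : LinearMap.ker (z : V →ₗ[ℝ] ℝ) = V₀)

theorem isOpen_avoid_other_walls (hfin : Δ.Finite) (V₀ : Submodule ℝ V) :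
    IsOpen {x : V | ∀ W, IsWall Δ W → W ≠ V₀ → x ∉ W} := by
  have := isOpen_avoid (S := {W | IsWall Δ W ∧ W ≠ V₀})
    ((finite_isWall hfin).subset fun W hW => hW.1)
  convert this using 1
  ext x
  simp

include hfin hz

theorem eventually_mem_reg {v : V} (hv : z v ≠ 0) {h : V₀}
    (hh : ∀ W, IsWall Δ W → W ≠ V₀ → (h : V) ∉ W) :
    ∀ᶠ t : ℝ in 𝓝[>] 0, (h : V) + t • v ∈ reg Δ := by
  have hc : Tendsto (fun t : ℝ => (h : V) + t • v) (𝓝[>] 0) (𝓝 (h : V)) := by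
    have : Continuous (fun t : ℝ => (h : V) + t • v) := by fun_prop
    simpa using (this.tendsto 0).mono_left (nhdsWithin_le_nhds (s := Set.Ioi 0))
  filter_upwards [hc.eventually ((isOpen_avoid_other_walls hfin V₀).mem_nhds hh),
    self_mem_nhdsWithin] with t ht ht0
  intro W hW
  by_cases hWV : W = V₀
  · intro hmem
    rw [hWV] at hmem
    have h0 : z h = 0 := apply_eq_zero_of_mem hz h.2
    have h1 := apply_eq_zero_of_mem hz hmem
    rw [map_add, map_smul, h0, zero_add, smul_eq_mul] at h1
    exact mul_ne_zero (ne_of_gt ht0) hv h1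
  · exact ht W hW hWV

/-- The coordinate along `b i₀` is z/z(b i₀), and the other coordinates are nonzero at regular
points of V₀, so only `halfMonomial (m i₀)` can jump. The sign of z(b i₀) tells on which side of V₀
the cone lies. -/
theorem hasPointwiseJump_coneFun {n : ℕ} {v : V} (hv : z v = 1)
    (b : Module.Basis (Fin (n + 1)) ℝ V)
    (hb : ∀ i, b i ∈ Δ) (i₀ : Fin (n + 1)) (hi₀ : b i₀ ∉ V₀)
    (b₀ : Module.Basis (Fin n) ℝ V₀) (hb₀ : ∀ j, (b₀ j : V) = b (i₀.succAbove j))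
    (m : Fin (n + 1) → ℕ) :
    HasPointwiseJump v (fun h : reg Δ => coneFun b m h.1)
      ((if m i₀ = 0 then (SignType.sign (z (b i₀)) : ℝ) else 0) •
        fun h : reg (restrictSystem Δ V₀) =>
          coneFun b₀ (fun j => m (i₀.succAbove j)) h.1) := by
  intro h hh
  have hc : z (b i₀) ≠ 0 := apply_ne_zero_of_notMem hz hi₀
  have hz0 : ∀ j, z (b (i₀.succAbove j)) = 0 := fun j => by
    rw [← hb₀]; exact apply_eq_zero_of_mem hz (b₀ j).2
  have hcoord : ∀ x, b.repr x i₀ = z x * (z (b i₀))⁻¹ := by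
    intro x
    conv_rhs => rw [← b.sum_repr x]
    rw [map_sum, Fin.sum_univ_succAbove _ i₀]
    simp [hz0, hc]
  have hcoord' : ∀ j, b.repr (h.1 : V) (i₀.succAbove j) = b₀.repr h.1 j := by
    intro j
    have hsum : (h.1 : V) = ∑ k, b₀.repr h.1 k • b (i₀.succAbove k) := by
      have := congrArg Subtype.val (b₀.sum_repr h.1)
      simp only [AddSubmonoidClass.coe_finsetSum, Submodule.coe_smul, hb₀] at this
      exact this.symm
    calc b.repr (h.1 : V) (i₀.succAbove j)
        = b.repr (∑ k, b₀.repr h.1 k • b (i₀.succAbove k)) (i₀.succAbove j) := by rw [← hsum]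
      _ = b₀.repr h.1 j := by
        simp [Finsupp.single_apply, i₀.succAbove_right_injective.eq_iff]
  have hne : ∀ j, b₀.repr h.1 j ≠ 0 := fun j =>
    repr_ne_zero_of_mem_reg b₀ (Δ := restrictSystem Δ V₀)
      (fun j => by change (b₀ j : V) ∈ Δ; rw [hb₀]; exact hb _) h.2 j
  have hlim : ∀ (u : V) (A : ℝ),
      Tendsto (fun t : ℝ => halfMonomial (m i₀) (t * (z u * (z (b i₀))⁻¹))) (𝓝[>] 0) (𝓝 A) →
      z u ≠ 0 → Tendsto (fun t : ℝ => Function.extend Subtype.val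
        (fun h : reg Δ => coneFun b m h.1) 0 ((h.1 : V) + t • u)) (𝓝[>] 0)
        (𝓝 (A * coneFun b₀ (fun j => m (i₀.succAbove j)) h.1)) := by
    intro u A hA hu
    have hrest : Tendsto (fun t : ℝ => ∏ j, halfMonomial (m (i₀.succAbove j))
        (b.repr ((h.1 : V) + t • u) (i₀.succAbove j))) (𝓝[>] 0)
        (𝓝 (coneFun b₀ (fun j => m (i₀.succAbove j)) h.1)) := by
      rw [coneFun_eq_prod]
      refine tendsto_finsetProd _ fun j _ => ?_
      have h1 : Tendsto (fun t : ℝ => b.repr ((h.1 : V) + t • u) (i₀.succAbove j)) (𝓝[>] 0)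
          (𝓝 (b₀.repr h.1 j)) := by
        have h2 : Continuous (fun t : ℝ => (h.1 : V) + t • u) := by fun_prop
        have h3 := ((continuous_repr b (i₀.succAbove j)).comp h2).tendsto 0
        simp only [Function.comp, zero_smul, add_zero] at h3
        rw [hcoord'] at h3
        exact h3.mono_left nhdsWithin_le_nhds
      exact (continuousAt_halfMonomial _ (hne j)).tendsto.comp h1
    refine (hA.mul hrest).congr' ?_
    filter_upwards [eventually_mem_reg hfin hz hu hh] with t ht
    rw [extend_of_mem _ ht, coneFun_eq_prod, Fin.prod_univ_succAbove _ i₀, hcoord]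
    have h0 : z (h.1 : V) = 0 := apply_eq_zero_of_mem hz h.1.2
    have key : z ((⟨(h.1 : V) + t • u, ht⟩ : reg Δ) : V) = t * z u := by
      rw [map_add, map_smul, h0, zero_add, smul_eq_mul]
    rw [key, mul_assoc]
  have hv' : z v ≠ 0 := by rw [hv]; exact one_ne_zero
  have hnv' : z (-v) ≠ 0 := by rw [map_neg, hv]; norm_num
  rcases hc.lt_or_gt with hneg | hpos
  · refine ⟨_, _, hlim v 0 ?_ hv', hlim (-v) (if m i₀ = 0 then 1 else 0) ?_ hnv', ?_⟩
    · refine (tendsto_halfMonomial_neg _).comp (tendsto_mul_const_nhdsLT ?_)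
      rw [hv, one_mul]; exact inv_lt_zero.2 hneg
    · refine (tendsto_halfMonomial_pos _).comp (tendsto_mul_const_nhdsGT ?_)
      rw [map_neg, hv, neg_one_mul]
      exact neg_pos.2 (inv_lt_zero.2 hneg)
    · rw [sign_neg hneg]
      split_ifs <;> simp
  · refine ⟨_, _, hlim v (if m i₀ = 0 then 1 else 0) ?_ hv', hlim (-v) 0 ?_ hnv', ?_⟩
    · refine (tendsto_halfMonomial_pos _).comp (tendsto_mul_const_nhdsGT ?_)
      rw [hv, one_mul]; exact inv_pos.2 hpos
    · refine (tendsto_halfMonomial_neg _).comp (tendsto_mul_const_nhdsLT ?_)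
      rw [map_neg, hv, neg_one_mul]
      exact neg_lt_zero.2 (inv_pos.2 hpos)
    · rw [sign_pos hpos]
      split_ifs <;> simp

/-- V₀ is not the hyperplane of a facet of the cone, so a point of V₀ on no other wall has all
coordinates nonzero, and the function is continuous there. -/
theorem hasPointwiseJump_coneFun_zero {r : ℕ} {v : V} (hv : z v = 1)
    (b : Module.Basis (Fin r) ℝ V) (hb : ∀ i, b i ∈ Δ) {i j : Fin r} (hij : i ≠ j)
    (hi : b i ∉ V₀) (hj : b j ∉ V₀) (m : Fin r → ℕ) :
    HasPointwiseJump v (fun h : reg Δ => coneFun b m h.1)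
      (0 : reg (restrictSystem Δ V₀) → ℝ) := by
  intro h hh
  have hne : ∀ k, b.repr (h.1 : V) k ≠ 0 := by
    intro k h0
    refine hh _ (isWall_ker_coord b hb k) ?_ (by simpa using h0)
    intro hk
    have hmem : ∀ l, l ≠ k → b l ∈ V₀ := by
      intro l hl
      rw [← hk]
      simp [hl]
    by_cases hik : i = k
    · exact hj (hmem j (hik ▸ hij.symm))
    · exact hi (hmem i hik)
  have hlim : ∀ u : V, z u ≠ 0 → Tendsto (fun t : ℝ => Function.extend Subtype.val
        (fun h : reg Δ => coneFun b m h.1) 0 ((h.1 : V) + t • u)) (𝓝[>] 0)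
        (𝓝 (coneFun b m h.1)) := by
    intro u hu
    have h1 : Tendsto (fun t : ℝ => coneFun b m ((h.1 : V) + t • u)) (𝓝[>] 0)
        (𝓝 (coneFun b m h.1)) := by
      simp only [coneFun_eq_prod]
      refine tendsto_finsetProd _ fun k _ => ?_
      have h2 : Continuous (fun t : ℝ => (h.1 : V) + t • u) := by fun_prop
      have h3 := ((continuous_repr b k).comp h2).tendsto 0
      simp only [Function.comp, zero_smul, add_zero] at h3
      exact (continuousAt_halfMonomial _ (hne k)).tendsto.comp (h3.mono_left nhdsWithin_le_nhds)
    refine h1.congr' ?_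
    filter_upwards [eventually_mem_reg hfin hz hu hh] with t ht
    rw [extend_of_mem _ ht]
  refine ⟨_, _, hlim v (by rw [hv]; exact one_ne_zero), hlim (-v) (by rw [map_neg, hv]; norm_num),
    ?_⟩
  simp

end Jump

/-! ### Chambers adjacent to a wall -/

theorem comp_subtype_mem_sym {f : V → ℝ} (hf : f ∈ sym V) (V₀ : Submodule ℝ V) :
    (fun v : V₀ => f v) ∈ sym V₀ := by
  induction hf using Algebra.adjoin_induction with
  | mem f hf =>
    obtain ⟨y, rfl⟩ := hf
    exact apply_mem_sym (y.comp V₀.subtypeL)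
  | algebraMap r => exact (sym V₀).algebraMap_mem r
  | add f g _ _ hf hg => exact (sym V₀).add_mem hf hg
  | mul f g _ _ hf hg => exact (sym V₀).mul_mem hf hg

theorem isPreconnected_ball_inter (h : V) (ε : ℝ) (z : StrongDual ℝ V) :
    IsPreconnected (Metric.ball h ε ∩ {x | 0 < z x}) :=
  ((convex_ball h ε).inter (convex_halfSpace_gt z.isBoundedLinearMap.toIsLinearMap 0)).isPreconnected

theorem eventually_mem_ball_inter {z : StrongDual ℝ V} {v : V} (hv : 0 < z v) {h : V} (hh : z h = 0) {h' : V} {ε : ℝ}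
    (hmem : h ∈ Metric.ball h' ε) :
    ∀ᶠ t : ℝ in 𝓝[>] 0, h + t • v ∈ Metric.ball h' ε ∩ {x | 0 < z x} := by
  have hc : Tendsto (fun t : ℝ => h + t • v) (𝓝[>] 0) (𝓝 h) := by
    have : Continuous (fun t : ℝ => h + t • v) := by fun_prop
    simpa using (this.tendsto 0).mono_left (nhdsWithin_le_nhds (s := Set.Ioi 0))
  filter_upwards [hc.eventually (Metric.isOpen_ball.mem_nhds hmem), self_mem_nhdsWithin]
    with t ht ht0
  refine ⟨ht, ?_⟩
  change 0 < z (h + t • v)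
  rw [map_add, map_smul, hh, zero_add]
  exact mul_pos ht0 hv

theorem tendsto_extend_of_ball_inter_subset {Δ : Set V} {U : Set V} (hU : U ⊆ reg Δ) {z : StrongDual ℝ V} {f : reg Δ → ℝ}
    {p : V → ℝ} (hp : p ∈ sym V) (hfp : ∀ h : reg Δ, h.1 ∈ U → f h = p h.1) {h' : V} {ε : ℝ}
    (hsub : Metric.ball h' ε ∩ {x | 0 < z x} ⊆ U) {v : V} (hv : 0 < z v) {h : V} (hh : z h = 0)
    (hmem : h ∈ Metric.ball h' ε) :
    Tendsto (fun t : ℝ => Function.extend Subtype.val f 0 (h + t • v)) (𝓝[>] 0) (𝓝 (p h)) := by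
  have hc : Continuous (fun t : ℝ => p (h + t • v)) :=
    (continuous_of_mem_sym hp).comp (by fun_prop)
  have h1 := (hc.tendsto 0).mono_left (nhdsWithin_le_nhds (s := Set.Ioi 0))
  rw [zero_smul, add_zero] at h1
  refine h1.congr' ?_
  filter_upwards [eventually_mem_ball_inter hv hh hmem] with t ht
  rw [extend_of_mem _ (hU (hsub ht)), hfp _ (hsub ht)]

section Adjacent

variable [FiniteDimensional ℝ V] {Δ : Set V} {V₀ : Submodule ℝ V} {z : StrongDual ℝ V}

theorem exists_ball_inter_subset_reg (hfin : Δ.Finite) (hz : LinearMap.ker (z : V →ₗ[ℝ] ℝ) = V₀)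
    {h : V} (hh : ∀ W, IsWall Δ W → W ≠ V₀ → h ∉ W) :
    ∃ ε > 0, Metric.ball h ε ∩ {x | 0 < z x} ⊆ reg Δ := by
  obtain ⟨ε, hε, hsub⟩ := Metric.isOpen_iff.1 (isOpen_avoid_other_walls hfin V₀) h hh
  refine ⟨ε, hε, fun x hx W hW hxW => ?_⟩
  by_cases hWV : W = V₀
  · rw [hWV] at hxW
    exact (ne_of_gt hx.2) (apply_eq_zero_of_mem hz hxW)
  · exact hsub hx.1 W hW hWV hxW

/-- A chamber on the positive side of a wall contains a half-ball around each generic point of the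
wall to which it is adjacent. -/
theorem IsComponent.exists_ball_inter_subset (hfin : Δ.Finite)
    (hz : LinearMap.ker (z : V →ₗ[ℝ] ℝ) = V₀) {U : Set V} (hU : IsComponent (reg Δ) U)
    (hUz : U ⊆ {x | 0 < z x}) {h : V} (hh : ∀ W, IsWall Δ W → W ≠ V₀ → h ∉ W)
    (hcl : h ∈ closure U) : ∃ ε > 0, Metric.ball h ε ∩ {x | 0 < z x} ⊆ U := by
  obtain ⟨ε, hε, hsub⟩ := exists_ball_inter_subset_reg hfin hz hh
  refine ⟨ε, hε, hU.subset_of_isPreconnected (isPreconnected_ball_inter h ε z) hsub ?_⟩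
  obtain ⟨x, hx, hxU⟩ := mem_closure_iff.1 hcl _ Metric.isOpen_ball (Metric.mem_ball_self hε)
  exact ⟨x, ⟨hx, hUz hxU⟩, hxU⟩

/-- On each side of a wall there is a chamber adjacent to a given generic point of the wall. -/
theorem exists_isComponent_mem_closure (hfin : Δ.Finite)
    (hz : LinearMap.ker (z : V →ₗ[ℝ] ℝ) = V₀) (hV₀ : IsWall Δ V₀) {v : V} (hv : 0 < z v) {h : V₀}
    (hh : ∀ W, IsWall Δ W → W ≠ V₀ → (h : V) ∉ W) :
    ∃ U, IsComponent (reg Δ) U ∧ U ⊆ {x | 0 < z x} ∧ (h : V) ∈ closure U := by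
  obtain ⟨ε, hε, hsub⟩ := exists_ball_inter_subset_reg hfin hz hh
  have hev := eventually_mem_ball_inter hv (apply_eq_zero_of_mem hz h.2) (Metric.mem_ball_self hε)
  obtain ⟨t, ht⟩ := hev.exists
  have hU : IsComponent (reg Δ) (connectedComponentIn (reg Δ) ((h : V) + t • v)) :=
    ⟨_, hsub ht, rfl⟩
  have hmem := mem_connectedComponentIn (hsub ht)
  have hball := hU.subset_of_isPreconnected (isPreconnected_ball_inter (h : V) ε z) hsub
    ⟨_, ht, hmem⟩
  refine ⟨_, hU, ?_, ?_⟩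
  · have hne : ∀ x ∈ connectedComponentIn (reg Δ) ((h : V) + t • v), z x ≠ 0 := fun x hx =>
      apply_ne_zero_of_notMem hz (hU.subset hx V₀ hV₀)
    rcases pos_or_neg_of_isPreconnected hU.isPreconnected z.continuous hne with hp | hn
    · exact hp
    · exact absurd ht.2 (lt_asymm (hn _ hmem))
  · have hc : Tendsto (fun t : ℝ => (h : V) + t • v) (𝓝[>] 0) (𝓝 (h : V)) := by
      have : Continuous (fun t : ℝ => (h : V) + t • v) := by fun_prop
      simpa using (this.tendsto 0).mono_left (nhdsWithin_le_nhds (s := Set.Ioi 0))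
    exact mem_closure_of_tendsto hc (hev.mono fun t ht => hball ht)

/-- The generic points of a wall meet every chamber of the wall. -/
theorem exists_mem_avoid_other_walls (hfin : Δ.Finite) (hV₀ : IsWall Δ V₀) {U : Set V₀}
    (hU : IsOpen U) (hne : U.Nonempty) :
    ∃ h ∈ U, ∀ W, IsWall Δ W → W ≠ V₀ → (h : V) ∉ W := by
  have hd := dense_avoid (E := V₀) (S := (fun W => W.comap V₀.subtype) '' {W | IsWall Δ W ∧ W ≠ V₀})
    (((finite_isWall hfin).subset fun W hW => hW.1).image _) ?_
  · obtain ⟨h, hU, hh⟩ := hd.inter_open_nonempty U hU hne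
    exact ⟨h, hU, fun W hW hne hmem => hh _ ⟨W, ⟨hW, hne⟩, rfl⟩ hmem⟩
  · rintro _ ⟨W, ⟨hW, hne⟩, rfl⟩ htop
    refine hne (hV₀.eq_of_le hW fun x hx => ?_).symm
    have h1 : W.comap V₀.subtype = ⊤ := htop
    have h2 : (⟨x, hx⟩ : V₀) ∈ W.comap V₀.subtype := by rw [h1]; trivial
    exact h2

/-- Near a common generic point both chambers contain half-balls, so the one-sided limits are the
values of `fp` and `fm`. This identifies fp - fm with the polynomial of `g` near that point of V₀,
hence everywhere on V₀. The negative side is handled as the positive side of `-z`. -/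
theorem HasPointwiseJump.isJump (hfin : Δ.Finite) (hz : LinearMap.ker (z : V →ₗ[ℝ] ℝ) = V₀)
    (hV₀ : IsWall Δ V₀) {v : V} (hv : z v = 1) {f : reg Δ → ℝ}
    {g : reg (restrictSystem Δ V₀) → ℝ} (hf : f ∈ locPoly Δ)
    (hg : g ∈ locPoly (restrictSystem Δ V₀)) (hfg : HasPointwiseJump v f g) : IsJump z f g := by
  have hnz : LinearMap.ker ((-z : StrongDual ℝ V) : V →ₗ[ℝ] ℝ) = V₀ := by
    rw [← hz]; ext x; simp
  have hv' : 0 < z v := by rw [hv]; exact one_pos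
  have hnv : 0 < (-z) (-v) := by simpa using hv'
  have hop := isOpen_reg (finite_restrictSystem hfin V₀)
  refine ⟨hf, hg, fun U hU => ⟨?_, ?_⟩⟩
  · obtain ⟨h, hhU, hh⟩ := exists_mem_avoid_other_walls hfin hV₀ (hU.isOpen hop) hU.nonempty
    obtain ⟨Up, h1, h2, h3⟩ := exists_isComponent_mem_closure hfin hz hV₀ hv' hh
    obtain ⟨Um, h1', h2', h3'⟩ := exists_isComponent_mem_closure hfin hnz hV₀ hnv hh
    refine ⟨Up, Um, h1, h1', h2, fun x hx => ?_, h, hhU, hh, h3, h3'⟩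
    simpa using h2' hx
  · rintro Up Um ⟨h1, h1', h2, h2', h₀, hhU, hh, h3, h3'⟩ fp hfp fm hfm hp hm h hhU'
    have h2'' : Um ⊆ {x | 0 < (-z) x} := fun x hx => by simpa using h2' hx
    obtain ⟨ε, hε, hsub⟩ := h1.exists_ball_inter_subset hfin hz h2 hh h3
    obtain ⟨ε', hε', hsub'⟩ := h1'.exists_ball_inter_subset hfin hnz h2'' hh h3'
    obtain ⟨q, hq, hgq⟩ := hg U hU
    have hmem : (fun x : V₀ => fp x) - (fun x : V₀ => fm x) - q ∈ sym V₀ :=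
      (sym V₀).sub_mem ((sym V₀).sub_mem (comp_subtype_mem_sym hfp V₀)
        (comp_subtype_mem_sym hfm V₀)) hq
    have hev : ∀ᶠ x : V₀ in 𝓝 h₀, ((fun x : V₀ => fp x) - (fun x : V₀ => fm x) - q) x = 0 := by
      have hcont : Continuous (Subtype.val : V₀ → V) := continuous_subtype_val
      filter_upwards [(hU.isOpen hop).mem_nhds hhU,
        hcont.continuousAt.preimage_mem_nhds (Metric.ball_mem_nhds (h₀ : V) hε),
        hcont.continuousAt.preimage_mem_nhds (Metric.ball_mem_nhds (h₀ : V) hε'),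
        hcont.continuousAt.preimage_mem_nhds ((isOpen_avoid_other_walls hfin V₀).mem_nhds hh)]
        with x hxU hxε hxε' hxW
      have hzx : z x = 0 := apply_eq_zero_of_mem hz x.2
      obtain ⟨A, B, hA, hB, hAB⟩ := hfg ⟨x, hU.subset hxU⟩ hxW
      have hA' := tendsto_extend_of_ball_inter_subset h1.subset hfp hp hsub hv' hzx hxε
      have hB' := tendsto_extend_of_ball_inter_subset h1'.subset hfm hm hsub' hnv
        (by simpa using hzx) hxε'
      rw [hgq _ hxU, tendsto_nhds_unique hA hA', tendsto_nhds_unique hB hB'] at hAB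
      change fp x - fm x - q x = 0
      rw [hAB, sub_self]
    have := eq_zero_of_mem_sym hmem hev h.1
    rw [hgq h hhU']
    exact (sub_eq_zero.1 this).symm

end Adjacent

/-! ### Top degree forms -/

theorem exists_eq_smul_of_ne_zero [FiniteDimensional ℝ V] {r : ℕ} (hr : Module.finrank ℝ V = r)
    {μ : V [⋀^Fin r]→ₗ[ℝ] ℝ} (hμ : μ ≠ 0) (ν : V [⋀^Fin r]→ₗ[ℝ] ℝ) : ∃ c : ℝ, ν = c • μ := by
  let b := Module.finBasisOfFinrankEq ℝ V hr
  have h0 : μ b ≠ 0 := (AlternatingMap.map_basis_ne_zero_iff b μ).2 hμ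
  refine ⟨ν b * (μ b)⁻¹, ?_⟩
  have h1 := ν.eq_smul_basis_det b
  have h2 := μ.eq_smul_basis_det b
  rw [h2, smul_smul]
  rw [h2] at h0
  simp only [AlternatingMap.smul_apply, Module.Basis.det_self, smul_eq_mul, mul_one] at h0 ⊢
  rw [inv_mul_cancel_right₀ h0]
  exact h1

theorem isPositive_smul_iff {r : ℕ} {o : Orientation ℝ V (Fin r)} {μ : V [⋀^Fin r]→ₗ[ℝ] ℝ}
    (hμ : IsPositive o μ) (c : ℝ) : IsPositive o (c • μ) ↔ 0 < c := by
  obtain ⟨h0, rfl⟩ := hμ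
  constructor
  · rintro ⟨h1, h2⟩
    have hc : c ≠ 0 := fun h => h1 (by rw [h, zero_smul])
    exact (sameRay_smul_left_iff_of_ne h0 hc).1 ((ray_eq_iff _ _).1 h2)
  · intro hc
    exact ⟨smul_ne_zero hc.ne' h0, (ray_eq_iff _ _).2 (sameRay_smul_left_iff_of_ne h0 hc.ne' |>.2 hc)⟩

/-! ### Measures attached to top degree forms -/

section Measure

variable [FiniteDimensional ℝ V] [MeasurableSpace V] [BorelSpace V] {r : ℕ}
  [hr : Fact (Module.finrank ℝ V = r)]

theorem measure_smul (c : ℝ) (μ : V [⋀^Fin r]→ₗ[ℝ] ℝ) :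
    (c • μ).measure = ‖c‖₊ • μ.measure := by
  rw [AlternatingMap.measure, AlternatingMap.measure, smul_smul, AlternatingMap.smul_apply,
    smul_eq_mul, nnnorm_mul]

theorem isAddHaarMeasure_measure {μ : V [⋀^Fin r]→ₗ[ℝ] ℝ} (hμ : μ ≠ 0) :
    μ.measure.IsAddHaarMeasure := by
  rw [AlternatingMap.measure]
  refine Measure.IsAddHaarMeasure.nnreal_smul _ ?_
  rw [nnnorm_ne_zero_iff]
  exact (AlternatingMap.map_basis_ne_zero_iff _ μ).2 hμ

theorem toReal_measure_parallelepiped (μ : V [⋀^Fin r]→ₗ[ℝ] ℝ) (v : Fin r → V) :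
    (μ.measure (parallelepiped v)).toReal = |μ v| := by
  rw [AlternatingMap.measure_parallelepiped, ENNReal.toReal_ofReal (abs_nonneg _)]

theorem orientedIntegral_smul {o : Orientation ℝ V (Fin r)} {μ : V [⋀^Fin r]→ₗ[ℝ] ℝ}
    (hμ : IsPositive o μ) (F : V → ℝ) (c : ℝ) :
    orientedIntegral o F (c • μ) = c * ∫ h, F h ∂μ.measure := by
  have h1 : ∫ h, F h ∂(c • μ).measure = |c| * ∫ h, F h ∂μ.measure := by
    rw [measure_smul, integral_smul_nnreal_measure, NNReal.smul_def, smul_eq_mul, coe_nnnorm,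
      Real.norm_eq_abs]
  unfold orientedIntegral
  rw [h1]
  split_ifs with h
  · rw [abs_of_pos ((isPositive_smul_iff hμ c).1 h)]
  -- This case includes c = 0, where both sides vanish.
  · rw [isPositive_smul_iff hμ] at h
    rw [abs_of_nonpos (not_lt.1 h), neg_mul, neg_neg]

/-- The oriented Laplace transform in terms of the measure of a positive form. -/
theorem hasLaplaceTransform_iff {Δ : Set V} {o : Orientation ℝ V (Fin r)}
    {μ : V [⋀^Fin r]→ₗ[ℝ] ℝ} (hμ : IsPositive o μ) {δ : Set (StrongDual ℝ V)} {f : reg Δ → ℝ}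
    {g : dualReg Δ → ℝ} {ω : ⋀[ℝ]^r V} :
    HasLaplaceTransform o δ f g ω ↔
      HasScalarLaplace μ.measure δ f (exteriorPower.alternatingMapLinearEquiv μ ω • g) := by
  constructor
  · intro h y hy
    obtain ⟨h1, h2⟩ := h μ y hy
    refine ⟨h1, ?_⟩
    have h3 := orientedIntegral_smul hμ
      (fun h => Real.exp (-y.1 h) * Function.extend Subtype.val f 0 h) 1
    rw [one_smul, one_mul] at h3
    rw [← h3, h2, Pi.smul_apply, smul_eq_mul, mul_comm]
  · intro h dh y hy
    obtain ⟨h1, h2⟩ := h y hy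
    obtain ⟨c, rfl⟩ := exists_eq_smul_of_ne_zero hr.out hμ.1 dh
    refine ⟨?_, ?_⟩
    · rw [measure_smul]
      exact h1.smul_measure_nnreal
    · rw [orientedIntegral_smul hμ, h2, map_smul, LinearMap.smul_apply, Pi.smul_apply, smul_eq_mul,
        smul_eq_mul]
      ring

end Measure

/-! ### Contractions -/

theorem contractLeft_ιMulti_eq_zero {n : ℕ} (z : Module.Dual ℝ V) {v : Fin n → V}
    (hv : ∀ i, z (v i) = 0) :
    CliffordAlgebra.contractLeft (Q := (0 : QuadraticForm ℝ V)) z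
      (ExteriorAlgebra.ιMulti ℝ n v) = 0 := by
  induction n with
  | zero =>
    rw [ExteriorAlgebra.ιMulti_zero_apply]
    exact CliffordAlgebra.contractLeft_one (Q := (0 : QuadraticForm ℝ V)) z
  | succ n ih =>
    rw [ExteriorAlgebra.ιMulti_succ_apply]
    refine (CliffordAlgebra.contractLeft_ι_mul (Q := (0 : QuadraticForm ℝ V)) z _ _).trans ?_
    rw [hv, zero_smul, zero_sub, ih (v := Matrix.vecTail v) fun i => hv _, mul_zero, neg_zero]

theorem contractLeft_ιMulti_cons {n : ℕ} (z : Module.Dual ℝ V) (x : V) {v : Fin n → V}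
    (hv : ∀ i, z (v i) = 0) :
    CliffordAlgebra.contractLeft (Q := (0 : QuadraticForm ℝ V)) z
      (ExteriorAlgebra.ιMulti ℝ (n + 1) (Fin.cons x v : Fin (n + 1) → V)) =
      z x • ExteriorAlgebra.ιMulti ℝ n v := by
  rw [ExteriorAlgebra.ιMulti_succ_apply]
  refine (CliffordAlgebra.contractLeft_ι_mul (Q := (0 : QuadraticForm ℝ V)) z _ _).trans ?_
  have h1 : Matrix.vecTail (Fin.cons x v : Fin (n + 1) → V) = v := by
    ext i; simp [Matrix.vecTail]
  rw [h1, contractLeft_ιMulti_eq_zero z hv, mul_zero, sub_zero]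
  simp

theorem exists_basis_cons {n : ℕ} {V₀ : Submodule ℝ V} {z : V →ₗ[ℝ] ℝ}
    (hz : LinearMap.ker z = V₀) {x : V} (hx : z x ≠ 0) (b₀ : Module.Basis (Fin n) ℝ V₀) :
    ∃ b : Module.Basis (Fin (n + 1)) ℝ V, (b : Fin (n + 1) → V) = Fin.cons x ((↑) ∘ b₀) := by
  refine ⟨Module.Basis.mkFinCons x b₀ ?_ ?_, Module.Basis.coe_mkFinCons _ _ _ _⟩
  · intro c w hw hcw
    rw [← hz] at hw
    have := congrArg z hcw
    rw [map_add, map_smul, hw, add_zero, map_zero, smul_eq_mul] at this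
    exact (mul_eq_zero.1 this).resolve_right hx
  · intro w
    refine ⟨-(z w / z x), ?_⟩
    rw [← hz, LinearMap.mem_ker, map_add, map_smul, smul_eq_mul, neg_mul, div_mul_cancel₀ _ hx,
      add_neg_cancel]

/-- Projecting to V₀ and applying μ₀ extends the pairing with μ₀ to a linear form on the exterior
algebra of V. Composed with contraction by `z₀` it is a top degree form on V, and such forms are
compared on a single basis, here `v` followed by a basis of V₀. -/
theorem alternatingMapLinearEquiv_of_isContraction [FiniteDimensional ℝ V] {n : ℕ}
    {V₀ : Submodule ℝ V} (hn : Module.finrank ℝ V₀ = n)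
    {z₀ z : StrongDual ℝ V} (hz : LinearMap.ker (z : V →ₗ[ℝ] ℝ) = V₀) {v : V} (hv : z v ≠ 0)
    (hz₀ : LinearMap.ker (z₀ : V →ₗ[ℝ] ℝ) = V₀) {ω : ⋀[ℝ]^(n + 1) V} {ω₀ : ⋀[ℝ]^n V₀}
    (hω : IsContraction z₀ ω ω₀) {μ : V [⋀^Fin (n + 1)]→ₗ[ℝ] ℝ} {μ₀ : V₀ [⋀^Fin n]→ₗ[ℝ] ℝ}
    (hμ : ∀ (v : V) (w : Fin n → V₀),
      μ (Fin.cons v fun i => (w i : V) : Fin (n + 1) → V) = z v * μ₀ w) :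
    exteriorPower.alternatingMapLinearEquiv μ₀ ω₀ =
      z₀ v * (z v)⁻¹ * exteriorPower.alternatingMapLinearEquiv μ ω := by
  obtain ⟨P, hP⟩ := exists_projection V₀
  -- `liftAlternating` takes one form in each degree; only degree n matters.
  let fam : ∀ i, V₀ [⋀^Fin i]→ₗ[ℝ] ℝ := fun i => if h : n = i then h ▸ μ₀ else 0
  have hfam : fam n = μ₀ := by simp [fam]
  let ℓ : ExteriorAlgebra ℝ V →ₗ[ℝ] ℝ := ExteriorAlgebra.liftAlternating fam ∘ₗ
    (ExteriorAlgebra.map (P : V →ₗ[ℝ] V₀)).toLinearMap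
  have hℓ : ∀ w : Fin n → V, ℓ (ExteriorAlgebra.ιMulti ℝ n w) = μ₀ fun i => P (w i) := by
    intro w
    simp only [ℓ, LinearMap.comp_apply, AlgHom.toLinearMap_apply]
    rw [ExteriorAlgebra.map_apply_ιMulti, ExteriorAlgebra.liftAlternating_apply_ιMulti, hfam]
    rfl
  -- `⟨ω₀, μ₀⟩` is obtained by applying `ℓ` to the contraction
  have h1 : exteriorPower.alternatingMapLinearEquiv μ₀ ω₀ =
      ℓ (ExteriorAlgebra.map V₀.subtype (ω₀ : ExteriorAlgebra ℝ V₀)) := by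
    have : exteriorPower.alternatingMapLinearEquiv μ₀ =
        (ℓ ∘ₗ (ExteriorAlgebra.map V₀.subtype).toLinearMap) ∘ₗ Submodule.subtype _ := by
      refine exteriorPower.linearMap_ext ?_
      ext w
      simp only [LinearMap.compAlternatingMap_apply,
        exteriorPower.alternatingMapLinearEquiv_apply_ιMulti, LinearMap.comp_apply,
        Submodule.subtype_apply, exteriorPower.ιMulti_apply_coe, AlgHom.toLinearMap_apply]
      rw [ExteriorAlgebra.map_apply_ιMulti, hℓ]
      simp [hP]
    rw [this]
    rfl
  have h2 : ℓ ∘ₗ CliffordAlgebra.contractLeft (Q := (0 : QuadraticForm ℝ V))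
        (z₀ : Module.Dual ℝ V) ∘ₗ (⋀[ℝ]^(n + 1) V).subtype =
      (z₀ v * (z v)⁻¹) • exteriorPower.alternatingMapLinearEquiv μ := by
    refine exteriorPower.linearMap_ext ?_
    obtain ⟨b, hb⟩ := exists_basis_cons hz hv (Module.finBasisOfFinrankEq ℝ V₀ hn)
    have hb' : (b : Fin (n + 1) → V) =
      Fin.cons v fun i => ((Module.finBasisOfFinrankEq ℝ V₀ hn i : V₀) : V) := hb
    have hext : ∀ A B : V [⋀^Fin (n + 1)]→ₗ[ℝ] ℝ, A b = B b → A = B := fun A B h => by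
      rw [A.eq_smul_basis_det b, B.eq_smul_basis_det b, h]
    refine hext _ _ ?_
    have hb0 : ∀ i, (z₀ : Module.Dual ℝ V) ((Module.finBasisOfFinrankEq ℝ V₀ hn i : V₀) : V) = 0 :=
      fun i => apply_eq_zero_of_mem hz₀ (Subtype.property _)
    simp only [LinearMap.compAlternatingMap_apply, LinearMap.comp_apply, LinearMap.smul_apply,
      exteriorPower.alternatingMapLinearEquiv_apply_ιMulti, Submodule.subtype_apply,
      exteriorPower.ιMulti_apply_coe, hb']
    rw [contractLeft_ιMulti_cons _ _ hb0, map_smul, hℓ]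
    have h3 := hμ v (Module.finBasisOfFinrankEq ℝ V₀ hn)
    rw [h3]
    simp only [hP, smul_eq_mul]
    change z₀ v * _ = _
    field_simp
  rw [h1, hω]
  exact LinearMap.congr_fun h2 ω

/-- The volume of a basis adapted to a hyperplane. -/
theorem abs_apply_basis {n : ℕ} {V₀ : Submodule ℝ V} {z : StrongDual ℝ V}
    {μ : V [⋀^Fin (n + 1)]→ₗ[ℝ] ℝ} {μ₀ : V₀ [⋀^Fin n]→ₗ[ℝ] ℝ}
    (hμ : ∀ (v : V) (w : Fin n → V₀),
      μ (Fin.cons v fun i => (w i : V) : Fin (n + 1) → V) = z v * μ₀ w)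
    {b : Fin (n + 1) → V} {i₀ : Fin (n + 1)} {b₀ : Fin n → V₀}
    (hb₀ : ∀ j, (b₀ j : V) = b (i₀.succAbove j)) : |μ b| = |z (b i₀)| * |μ₀ b₀| := by
  -- A cycle brings the vector off V₀ to the front; its sign disappears in the absolute value.
  have h1 : b = (Fin.cons (b i₀) fun j => (b₀ j : V) : Fin (n + 1) → V) ∘ i₀.cycleRange := by
    rw [Fin.cons_comp_cycleRange]
    refine (Fin.insertNth_eq_iff.2 ⟨rfl, ?_⟩).symm
    ext j
    simp [hb₀, Fin.removeNth]
  conv_lhs => rw [h1]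
  rw [AlternatingMap.map_perm, hμ, Units.smul_def, zsmul_eq_mul, abs_mul, abs_mul]
  rcases Int.units_eq_one_or (Equiv.Perm.sign i₀.cycleRange) with h | h <;> simp [h]

/-! ### The inverse Laplace transform -/

section Inverse

variable [FiniteDimensional ℝ V] [MeasurableSpace V] [BorelSpace V] {r : ℕ}
  [Fact (Module.finrank ℝ V = r)]

/-- A function in `𝒫_Δ(δ)` with the right Laplace transform is the inverse Laplace transform. -/
theorem isInverseLaplace_and_unique {Δ : Set V} (hfin : Δ.Finite) (hsymm : ∀ α ∈ Δ, -α ∈ Δ)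
    {δ : Set (StrongDual ℝ V)} (hδ : IsComponent (dualReg Δ) δ) {o : Orientation ℝ V (Fin r)}
    {μ : V [⋀^Fin r]→ₗ[ℝ] ℝ} (hμ : IsPositive o μ) {ω : ⋀[ℝ]^r V} {φ : ℤ → dualReg Δ → ℝ}
    {f : reg Δ → ℝ} {g : dualReg Δ → ℝ} (hf : f ∈ locPolyCone Δ δ) (hg : IsPrinc φ g)
    (hL : HasScalarLaplace μ.measure δ f (exteriorPower.alternatingMapLinearEquiv μ ω • g)) :
    IsInverseLaplace o δ φ ω f ∧ ∀ f', IsInverseLaplace o δ φ ω f' → f' = f := by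
  have := isAddHaarMeasure_measure hμ.1
  refine ⟨⟨hf, g, hg, (hasLaplaceTransform_iff hμ).2 hL⟩, ?_⟩
  rintro f' ⟨hf', g', hg', hL'⟩
  rw [hasLaplaceTransform_iff hμ] at hL'
  -- Both principal parts differ from the same truncation by elements of NG, and G ∩ NG = 0.
  have hgg : g' = g := by
    refine sub_eq_zero.1 (eq_zero_of_mem_G_of_mem_NG hfin hsymm
      (Submodule.sub_mem _ hg'.1 hg.1) ?_)
    have := Submodule.sub_mem _ hg.2 hg'.2
    rwa [sub_sub_sub_cancel_left] at this
  rw [hgg] at hL'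
  have h0 : HasScalarLaplace μ.measure δ (f' + (-1 : ℝ) • f) 0 := by
    have := hL'.add (hL.smul (-1))
    rwa [neg_one_smul, neg_one_smul, add_neg_cancel, ← neg_one_smul ℝ f] at this
  have := eq_zero_of_hasScalarLaplace_zero (μ := μ.measure) hfin hδ
    (Submodule.add_mem _ hf' (Submodule.smul_mem _ _ hf)) h0
  rwa [neg_one_smul, ← sub_eq_add_neg, sub_eq_zero] at this

end Inverse

/-! ### The jump formula -/

/-- An element of `Δ ∩ V₀` which is positive on `δ` is positive on `δ₀`. -/
theorem pos_of_dualCone_subset {Δ : Set V} {V₀ : Submodule ℝ V} {δ : Set (StrongDual ℝ V)}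
    (hδ : IsComponent (dualReg Δ) δ) {δ₀ : Set (StrongDual ℝ V₀)}
    (hδ₀ : IsComponent (dualReg (restrictSystem Δ V₀)) δ₀)
    (hδδ₀ : ∀ h ∈ dualCone δ₀, (h : V) ∈ dualCone δ) {v : V₀} (hv : (v : V) ∈ Δ)
    (hpos : ∀ y ∈ δ, 0 < y v) : ∀ y ∈ δ₀, 0 < y v := by
  have hcont : Continuous fun y : StrongDual ℝ V₀ => y v := by fun_prop
  rcases pos_or_neg_of_isPreconnected hδ₀.isPreconnected hcont
    (fun y hy => hδ₀.subset hy v hv) with h | h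
  · exact h
  · obtain ⟨y, hy⟩ := hδ.nonempty
    -- This is where the inclusion of dual cones enters: it makes the sign choices on δ and δ₀
    -- compatible.
    have h1 : -v ∈ dualCone δ₀ := fun y hy => by
      rw [map_neg]; exact neg_nonneg.2 (h y hy).le
    have h2 := hδδ₀ _ h1 y hy
    rw [NegMemClass.coe_neg, map_neg] at h2
    exact absurd (hpos y hy) (not_lt.2 (neg_nonneg.1 h2))

theorem eq_mul_of_ker_eq {V₀ : Submodule ℝ V} {z z₀ : StrongDual ℝ V}
    (hz : LinearMap.ker (z : V →ₗ[ℝ] ℝ) = V₀) (hz₀ : LinearMap.ker (z₀ : V →ₗ[ℝ] ℝ) = V₀) {v : V}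
    (hv : z v = 1) (x : V) : z₀ x = z₀ v * z x := by
  have h1 : x - z x • v ∈ V₀ := by
    rw [← hz]
    change z (x - z x • v) = 0
    rw [map_sub, map_smul, hv, smul_eq_mul, mul_one, sub_self]
  have h2 := apply_eq_zero_of_mem hz₀ h1
  rw [map_sub, map_smul, smul_eq_mul, sub_eq_zero] at h2
  rw [h2, mul_comm]

section JumpFormula

variable [FiniteDimensional ℝ V] [MeasurableSpace V] [BorelSpace V] {n : ℕ}
  [Fact (Module.finrank ℝ V = n + 1)] {V₀ : Submodule ℝ V} [Fact (Module.finrank ℝ V₀ = n)]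

/-- The jump formula for the fractions `1 / ∏ α_i ^ (m_i + 1)` and their linear combinations. -/
theorem exists_jump_of_mem_simpleG {Δ : Set V} (hfin : Δ.Finite) (hsymm : ∀ α ∈ Δ, -α ∈ Δ)
    {δ : Set (StrongDual ℝ V)} (hδ : IsComponent (dualReg Δ) δ) {δ₀ : Set (StrongDual ℝ V₀)}
    (hδ₀ : IsComponent (dualReg (restrictSystem Δ V₀)) δ₀)
    (hδδ₀ : ∀ h ∈ dualCone δ₀, (h : V) ∈ dualCone δ) (hV₀ : V₀ ≠ ⊤) {z z₀ : StrongDual ℝ V}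
    (hz : LinearMap.ker (z : V →ₗ[ℝ] ℝ) = V₀) (hz₀ : LinearMap.ker (z₀ : V →ₗ[ℝ] ℝ) = V₀) {v : V}
    (hv : z v = 1) {μ : V [⋀^Fin (n + 1)]→ₗ[ℝ] ℝ} {μ₀ : V₀ [⋀^Fin n]→ₗ[ℝ] ℝ} (hμ0 : μ ≠ 0)
    (hμ₀0 : μ₀ ≠ 0) (hμ : ∀ (v : V) (w : Fin n → V₀),
      μ (Fin.cons v fun i => (w i : V) : Fin (n + 1) → V) = z v * μ₀ w)
    {g : dualReg Δ → ℝ} (hg : g ∈ simpleG Δ (n + 1)) :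
    ∃ f ∈ locPolyCone Δ δ, ∃ g₀ ∈ simpleG (restrictSystem Δ V₀) n,
      ∃ f₀ ∈ locPolyCone (restrictSystem Δ V₀) δ₀,
        HasScalarLaplace μ.measure δ f g ∧ HasScalarLaplace μ₀.measure δ₀ f₀ (z₀ v • g₀) ∧
        IsHyperplaneResidue V₀ z₀ g g₀ ∧ HasPointwiseJump v f f₀ := by
  have := isAddHaarMeasure_measure hμ0
  have := isAddHaarMeasure_measure hμ₀0
  have hg' := simpleG_le_span_pos hsymm hδ (n + 1) hg
  clear hg
  induction hg' using Submodule.span_induction with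
  | zero =>
    refine ⟨0, Submodule.zero_mem _, 0, Submodule.zero_mem _, 0, Submodule.zero_mem _,
      HasScalarLaplace.zero _ δ, ?_, IsHyperplaneResidue.zero V₀ z₀, HasPointwiseJump.zero v⟩
    rw [smul_zero]
    exact HasScalarLaplace.zero _ δ₀
  | add g g' _ _ h h' =>
    obtain ⟨f, hf, g₀, hg₀, f₀, hf₀, h1, h2, h3, h4⟩ := h
    obtain ⟨f', hf', g₀', hg₀', f₀', hf₀', h1', h2', h3', h4'⟩ := h'
    refine ⟨_, Submodule.add_mem _ hf hf', _, Submodule.add_mem _ hg₀ hg₀', _,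
      Submodule.add_mem _ hf₀ hf₀', h1.add h1', ?_, h3.add h3', h4.add h4'⟩
    rw [smul_add]
    exact h2.add h2'
  | smul c g _ h =>
    obtain ⟨f, hf, g₀, hg₀, f₀, hf₀, h1, h2, h3, h4⟩ := h
    refine ⟨_, Submodule.smul_mem _ c hf, _, Submodule.smul_mem _ c hg₀, _,
      Submodule.smul_mem _ c hf₀, h1.smul c, ?_, h3.smul c, h4.smul c⟩
    rw [smul_comm]
    exact h2.smul c
  | mem g hg =>
    obtain ⟨b, m, hb, hpos, rfl⟩ := hg
    obtain ⟨i₀, hi₀⟩ : ∃ i₀, b i₀ ∉ V₀ := by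
      by_contra! h
      refine hV₀ (top_le_iff.1 ?_)
      rw [← b.span_eq]
      exact Submodule.span_le.2 (by rintro _ ⟨i, rfl⟩; exact h i)
    have hK : |μ b| ≠ 0 := abs_ne_zero.2 ((AlternatingMap.map_basis_ne_zero_iff b μ).2 hμ0)
    have hf := coneFun_mem_locPolyCone b hb hpos m
    have hL : HasScalarLaplace μ.measure δ (|μ b|⁻¹ • fun h : reg Δ => coneFun b m h.1)
        (fun y : dualReg Δ => (∏ i, y.1 (b i) ^ (m i + 1))⁻¹) := by
      have := (hasScalarLaplace_coneFun μ.measure hfin b hpos m).smul |μ b|⁻¹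
      rwa [toReal_measure_parallelepiped, inv_smul_smul₀ hK] at this
    -- If all remaining vectors lie in V₀, then V₀ is a facet hyperplane; otherwise residue and jump
    -- both vanish.
    by_cases hmem : ∀ j, b (i₀.succAbove j) ∈ V₀
    · obtain ⟨b₀, hb₀⟩ := exists_basis_hyperplane Fact.out b i₀ hmem
      have hb₀Δ : ∀ j, b₀ j ∈ restrictSystem Δ V₀ := fun j => by
        change (b₀ j : V) ∈ Δ; rw [hb₀]; exact hb _
      have hpos₀ : ∀ j, ∀ y ∈ δ₀, 0 < y (b₀ j) := fun j =>
        pos_of_dualCone_subset hδ hδ₀ hδδ₀ (hb₀Δ j) (by rw [hb₀]; exact hpos _)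
      refine ⟨_, Submodule.smul_mem _ _ hf, _,
        Submodule.smul_mem _ _ (Submodule.subset_span ⟨b₀, fun j => m (i₀.succAbove j), hb₀Δ, rfl⟩),
        _, Submodule.smul_mem _ _ (Submodule.smul_mem _ _
          (coneFun_mem_locPolyCone b₀ hb₀Δ hpos₀ fun j => m (i₀.succAbove j))), hL, ?_,
        isHyperplaneResidue_simple hfin hz₀ b i₀ hi₀ b₀ hb₀ m,
        (hasPointwiseJump_coneFun hfin hz hv b hb i₀ hi₀ b₀ hb₀ m).smul _⟩
      have h1 := ((hasScalarLaplace_coneFun (Δ := restrictSystem Δ V₀) μ₀.measure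
        (finite_restrictSystem hfin V₀) b₀ hpos₀ fun j => m (i₀.succAbove j)).smul
        (if m i₀ = 0 then (SignType.sign (z (b i₀)) : ℝ) else 0)).smul |μ b|⁻¹
      convert h1 using 1
      have hzb : z (b i₀) ≠ 0 := apply_ne_zero_of_notMem hz hi₀
      have hz₀b : z₀ (b i₀) ≠ 0 := apply_ne_zero_of_notMem hz₀ hi₀
      have hμ₀b : |μ₀ b₀| ≠ 0 :=
        abs_ne_zero.2 ((AlternatingMap.map_basis_ne_zero_iff b₀ μ₀).2 hμ₀0)
      rw [toReal_measure_parallelepiped, smul_smul, smul_smul, smul_smul, abs_apply_basis hμ hb₀]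
      congr 1
      split_ifs
      -- The volume |μ b| = |z(b i₀)| |μ₀ b₀| turns the jump sign(z(b i₀)) into 1/z(b i₀), which is
      -- z₀(v)/z₀(b i₀) because z₀ = z₀(v) z.
      · rw [eq_mul_of_ker_eq hz hz₀ hv (b i₀)] at hz₀b ⊢
        have hc : z₀ v ≠ 0 := left_ne_zero_of_mul hz₀b
        have habs : |z (b i₀)| ≠ 0 := abs_ne_zero.2 hzb
        have hs : (SignType.sign (z (b i₀)) : ℝ) * z (b i₀) = |z (b i₀)| := sign_mul_self _
        field_simp
        linarith
      · simp
    · push Not at hmem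
      obtain ⟨j, hj⟩ := hmem
      have hij : i₀ ≠ i₀.succAbove j := (i₀.succAbove_ne j).symm
      refine ⟨_, Submodule.smul_mem _ _ hf, 0, Submodule.zero_mem _, 0, Submodule.zero_mem _, hL,
        ?_, isHyperplaneResidue_simple_zero hfin hz₀ b hij hi₀ hj hb m, ?_⟩
      · rw [smul_zero]
        exact HasScalarLaplace.zero _ δ₀
      · have := (hasPointwiseJump_coneFun_zero hfin hz hv b hb hij hi₀ hj m).smul |μ b|⁻¹
        rwa [smul_zero] at this

end JumpFormula

end

end HyperplaneLaplace

theorem mainTheorem9 {V : Type*} [NormedAddCommGroup V] [NormedSpace ℝ V]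
    [FiniteDimensional ℝ V] [MeasurableSpace V] [BorelSpace V]
    {n : ℕ} [Fact (Module.finrank ℝ V = n + 1)]
    (Δ : Set V) (hfin : Δ.Finite) (hzero : (0 : V) ∉ Δ)
    (hspan : Submodule.span ℝ Δ = ⊤) (hsymm : ∀ α ∈ Δ, -α ∈ Δ)
    (V₀ : Submodule ℝ V) (hV₀ : IsWall Δ V₀) [Fact (Module.finrank ℝ V₀ = n)]
    (o : Orientation ℝ V (Fin (n + 1))) (o₀ : Orientation ℝ V₀ (Fin n))
    (z : StrongDual ℝ V) (hz : IsOrientedEquation o o₀ z)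
    (δ : Set (StrongDual ℝ V)) (hδ : IsComponent (dualReg Δ) δ)
    (δ₀ : Set (StrongDual ℝ V₀)) (hδ₀ : IsComponent (dualReg (restrictSystem Δ V₀)) δ₀)
    (hδδ₀ : ∀ h ∈ dualCone δ₀, (h : V) ∈ dualCone δ)
    (z₀ : StrongDual ℝ V) (hz₀ : LinearMap.ker (z₀ : V →ₗ[ℝ] ℝ) = V₀)
    (ω : ⋀[ℝ]^(n + 1) V) (ω₀ : ⋀[ℝ]^n V₀) (hω : IsContraction z₀ ω ω₀)
    (φ : ℤ → dualReg Δ → ℝ) (hφ : φ ∈ RHat Δ) :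
    -- the residue is well defined and belongs to `R̂_{Δ₀}`
    (∀ j, IsHyperplaneResidue V₀ z₀ (φ (j - 1)) (hyperplaneResidue V₀ z₀ φ j)) ∧
    hyperplaneResidue V₀ z₀ φ ∈ RHat (restrictSystem Δ V₀) ∧
    -- both inverse Laplace transforms are well defined
    (∃! f, IsInverseLaplace o δ φ ω f) ∧
    (∃! g, IsInverseLaplace o₀ δ₀ (hyperplaneResidue V₀ z₀ φ) ω₀ g) ∧
    -- the jump formula
    IsJump z (inverseLaplace o δ φ ω)
      (inverseLaplace o₀ δ₀ (hyperplaneResidue V₀ z₀ φ) ω₀) := by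
  refine ⟨isHyperplaneResidue_hyperplaneResidue hfin hz₀ hφ,
    hyperplaneResidue_mem_RHat hfin hz₀ hzero hφ, ?_⟩
  obtain ⟨hzV, μ, μ₀, hμo, hμ₀o, hμ⟩ := hz
  have hdim : Module.finrank ℝ V = n + 1 := Fact.out
  have hdim₀ : Module.finrank ℝ V₀ = n := Fact.out
  obtain ⟨v, hv⟩ : ∃ v, z v = 1 := by
    obtain ⟨x, hx⟩ : ∃ x, x ∉ V₀ := by
      by_contra! h
      exact hV₀.ne_top (Submodule.eq_top_iff'.2 h)
    have hzx : z x ≠ 0 := apply_ne_zero_of_notMem hzV hx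
    exact ⟨(z x)⁻¹ • x, by rw [map_smul, smul_eq_mul, inv_mul_cancel₀ hzx]⟩
  -- The truncation degree is -r written as -(r-1) - 1, the form in which it matches the truncation
  -- of the residue at -(r-1).
  obtain ⟨g, hg, ν, hν, hgν⟩ := Submodule.mem_sup.1
    (taylor_mem_simpleG_sup_NG hdim hφ (-(Module.finrank ℝ V₀ : ℤ) - 1))
  obtain ⟨f, hf, g₀, hg₀, f₀, hf₀, hL, hL₀, hres, hjump⟩ := exists_jump_of_mem_simpleG hfin hsymm
    hδ hδ₀ hδδ₀ hV₀.ne_top hzV hz₀ hv hμo.1 hμ₀o.1 hμ hg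
  obtain ⟨ν₀, hν₀, hresν⟩ := exists_isHyperplaneResidue_mem_NG hfin hz₀ hν
  -- The residue of the decomposition g + ν is again a decomposition into G and NG parts, now for
  -- Δ₀; thus principal parts commute with the residue.
  have htaylor : taylor (-(Module.finrank ℝ V₀ : ℤ)) (hyperplaneResidue V₀ z₀ φ) = g₀ + ν₀ := by
    refine (isHyperplaneResidue_taylor hfin hz₀ hφ _).unique ?_
    rw [← hgν]
    exact hres.add hresν
  have hprinc : IsPrinc φ g := by
    refine ⟨simpleG_le_G Δ _ hg, ?_⟩
    have hK : -(Module.finrank ℝ V : ℤ) = -(Module.finrank ℝ V₀ : ℤ) - 1 := by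
      rw [hdim, hdim₀]; push_cast; ring
    rw [hK, ← hgν, add_sub_cancel_left]
    exact hν
  have hprinc₀ : IsPrinc (hyperplaneResidue V₀ z₀ φ) g₀ := by
    refine ⟨simpleG_le_G _ _ hg₀, ?_⟩
    rw [htaylor, add_sub_cancel_left]
    exact hν₀
  -- The pairing of ω₀ is z₀(v) times that of ω. This supplies the factor z₀(v) in the transform of
  -- `f₀`, so the same scalar `w` multiplies both `f` and `f₀`.
  have hω₀ := alternatingMapLinearEquiv_of_isContraction hdim₀ hzV (v := v)
    (by rw [hv]; exact one_ne_zero) hz₀ hω hμ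
  rw [hv, inv_one, mul_one] at hω₀
  set w := exteriorPower.alternatingMapLinearEquiv μ ω with hw
  have hF := isInverseLaplace_and_unique hfin hsymm hδ hμo (ω := ω)
    (Submodule.smul_mem _ w hf) hprinc (hL.smul w)
  have hF₀ := isInverseLaplace_and_unique (finite_restrictSystem hfin V₀)
    (neg_mem_restrictSystem hsymm V₀) hδ₀ hμ₀o (ω := ω₀) (Submodule.smul_mem _ w hf₀) hprinc₀
    (by
      rw [hω₀, mul_comm, mul_smul]
      exact hL₀.smul w)
  refine ⟨⟨_, hF⟩, ⟨_, hF₀⟩, ?_⟩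
  have h1 : inverseLaplace o δ φ ω = w • f := hF.2 _ (Classical.epsilon_spec ⟨_, hF.1⟩)
  have h2 : inverseLaplace o₀ δ₀ (hyperplaneResidue V₀ z₀ φ) ω₀ = w • f₀ :=
    hF₀.2 _ (Classical.epsilon_spec ⟨_, hF₀.1⟩)
  rw [h1, h2]
  exact (hjump.smul w).isJump hfin hzV hV₀ hv
    (locPolyCone_subset_locPoly (Submodule.smul_mem _ w hf))
    (locPolyCone_subset_locPoly (Submodule.smul_mem _ w hf₀))
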